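/- Let $F$ be an algebraically closed field, $m\ge 1$, and $V=\mathrm{Mat}(m\times m^2;F)$. An element $A=(A^i_{j,k})\in V$ (row $i$, column $(j,k)$) is the matrix of structure constants of an $m$-dimensional algebra $W$ with bilinear product (not assumed associative, commutative or unital) in a basis $e_1,\dots,e_m$ if $e_j\cdot e_k=\sum_i A^i_{j,k}e_i$. The group $GL(m,F)$ acts on $V$ by $\tau(g,A)=gA(g^{-1}\otimes g^{-1})$. For $k\ge 1$, a *contraction* of $A^{\otimes k}$ is obtained by contracting its $k$ upper indices with $k$ different ones of its $2k$ lower indices; the $k$ remaining lower indices, in their original order, make the result a row vector with $m^k$ entries. For a choice $\rho$ of $m^k$ contractions let $Q(A)$ be the $m^k\times m^k$ matrix with these rows. Let $\mathrm{Tr}_1(A)$ be the row vector with entries $\sum_j A^j_{j,i}$. For $k\ge 2$ and a choice $\gamma$ of $m$ distinct columns, let $P(A)$ be the inverse of the $m\times m$ submatrix of $\bigl(A\otimes \mathrm{Tr}_1(A)^{\otimes (k-2)}\bigr)Q(A)^{-1}$ with the columns $\gamma$, and put $$V_0=\{A\in V:\ \det P(A)\cdot\det Q(A)\neq 0\},$$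 that is, the set of $A$ for which $Q(A)$ and the chosen submatrix are both nonsingular. **Theorem.** 1. For all sufficiently large $k$ (depending on $m$ and $F$) one can choose $m^k$ contractions such that $\det Q(A)\ne 0$ for some $A\in V$ (equivalently, $\det Q$ is not the zero polynomial). 2. For every $k\ge 2$ and every choice of $m^k$ contractions such that $\det Q(A)\neq 0$ for some $A$, there is a choice of $m$ columns for which $V_0\neq\emptyset$. 3. For every $k\ge 2$ and every choice of contractions and columns for which $V_0\ne\emptyset$: the set $V_0$ is $GL(m,F)$-invariant, and it is open and dense in $V$ in the Zariski topology; and two $m$-dimensional algebras over $F$ whose matrices of structure constants $A,B$ (in some bases) lie in $V_0$ are isomorphic if and only if $$P(A)\,A\,\bigl(P(A)^{-1}\otimes P(A)^{-1}\bigr)=P(B)\,B\,\bigl(P(B)^{-1}\otimes P(B)^{-1}\bigr).$$ -/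

import Mathlib

open scoped Kronecker

namespace StructureConstants

/-- The space `Mat(m × m²; F)` of matrices of structure constants of `m`-dimensional algebras.
The entry `A i (j, k)` is `A^i_{j,k}`: the upper index is the row, the lower indices the column. -/
abbrev Space (m : ℕ) (F : Type*) := Matrix (Fin m) (Fin m × Fin m) F

section Algebra

variable {m : ℕ} {F W W' : Type*} [Field F] [AddCommGroup W] [Module F W]
  [AddCommGroup W'] [Module F W']

/-- The matrix of structure constants of the algebra `(W, μ)` with respect to the basis `e`:
`e_j · e_k = ∑ i, A^i_{j,k} e_i`. -/
noncomputable def ofAlgebra (e : Module.Basis (Fin m) F W) (μ : W →ₗ[F] W →ₗ[F] W) : Space m F :=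
  Matrix.of fun i jk => e.repr (μ (e jk.1) (e jk.2)) i

/-- Isomorphism of two (not necessarily associative or unital) algebras `(W, μ)`, `(W', μ')`. -/
def AlgebrasIsomorphic (μ : W →ₗ[F] W →ₗ[F] W) (μ' : W' →ₗ[F] W' →ₗ[F] W') : Prop :=
  ∃ φ : W ≃ₗ[F] W', ∀ u v, φ (μ u v) = μ' (φ u) (φ v)

end Algebra

section Zariski

variable {m : ℕ} {F : Type*} [Field F]

/-- Zariski closed subsets of the affine space `Mat(m × m²; F)`: common zero sets of
polynomials in the `m³` matrix entries. -/
def IsZariskiClosed (S : Set (Space m F)) : Prop :=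
  ∃ I : Ideal (MvPolynomial (Fin m × Fin m × Fin m) F),
    S = {A | (fun x => A x.1 x.2) ∈ MvPolynomial.zeroLocus F I}

def IsZariskiOpen (S : Set (Space m F)) : Prop := IsZariskiClosed Sᶜ

/-- The Zariski closure is the whole space. -/
def IsZariskiDense (S : Set (Space m F)) : Prop :=
  ∀ Z : Set (Space m F), IsZariskiClosed Z → S ⊆ Z → Z = Set.univ

end Zariski

section NormalForm

variable {m : ℕ} {F : Type*} [Field F]

/-- The base change action `τ(g, A) = g A (g⁻¹ ⊗ g⁻¹)`. -/
noncomputable def act (g : Matrix (Fin m) (Fin m) F) (A : Space m F) : Space m F :=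
  g * A * (g⁻¹ ⊗ₖ g⁻¹)

/-- The tensor power `A^{⊗k}`. It has `k` upper indices and `2k` lower indices; the two lower
indices of the `s`-th factor occupy the slots `(s, 0)` and `(s, 1)`. -/
def tensorPower (A : Space m F) (k : ℕ) : Matrix (Fin k → Fin m) (Fin k × Fin 2 → Fin m) F :=
  Matrix.of fun a l => ∏ s, A (a s) (l (s, 0), l (s, 1))

/-- A complete contraction of the `k` upper indices of `A^{⊗k}` with `k` of its `2k` lower
indices. The `s`-th upper index is contracted with the lower slot `slot (inl s)`; the `k`
remaining lower slots are `slot (inr 0), slot (inr 1), …`, in their original order. -/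
structure Contraction (k : ℕ) where
  slot : Fin k ⊕ Fin k ≃ Fin k × Fin 2
  free_strictMono : StrictMono fun q : Fin k => toLex (slot (Sum.inr q))

/-- The row vector with `m^k` entries obtained from `A^{⊗k}` by the contraction `c`. -/
def contract {k : ℕ} (c : Contraction k) (A : Space m F) (p : Fin k → Fin m) : F :=
  ∑ a : Fin k → Fin m, tensorPower A k a fun t => Sum.elim a p (c.slot.symm t)

/-- The square matrix `Q(A)` of size `m^k` whose rows are the chosen contractions of `A^{⊗k}`. -/
def Q {k : ℕ} (ρ : (Fin k → Fin m) → Contraction k) (A : Space m F) :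
    Matrix (Fin k → Fin m) (Fin k → Fin m) F :=
  Matrix.of fun r p => contract (ρ r) A p

/-- The row vector `Tr₁(A)`, with entries `∑ j, A^j_{j,i}`. -/
def Tr₁ (A : Space m F) (i : Fin m) : F := ∑ j, A j (j, i)

/-- The `m × m^k` matrix `A ⊗ Tr₁(A)^{⊗(k-2)}`, where `k = n + 2`. -/
def tensorTrace (n : ℕ) (A : Space m F) : Matrix (Fin m) (Fin (n + 2) → Fin m) F :=
  Matrix.of fun i p => A i (p 0, p 1) * ∏ s : Fin n, Tr₁ A (p s.succ.succ)

/-- `P(A)`, the inverse of the `m × m` submatrix of `(A ⊗ Tr₁(A)^{⊗(k-2)}) Q(A)⁻¹` with the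
columns chosen by `γ`. -/
noncomputable def P {n : ℕ} (ρ : (Fin (n + 2) → Fin m) → Contraction (n + 2))
    (γ : Fin m ↪ (Fin (n + 2) → Fin m)) (A : Space m F) : Matrix (Fin m) (Fin m) F :=
  ((tensorTrace n A * (Q ρ A)⁻¹).submatrix id γ)⁻¹

/-- `V₀ = {A : det P(A) · det Q(A) ≠ 0}`. -/
def V₀ (F : Type*) [Field F] {n : ℕ} (ρ : (Fin (n + 2) → Fin m) → Contraction (n + 2))
    (γ : Fin m ↪ (Fin (n + 2) → Fin m)) : Set (Space m F) :=
  {A | (P ρ γ A).det * (Q ρ A).det ≠ 0}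

end NormalForm

end StructureConstants

open StructureConstants

open scoped Kronecker
open StructureConstants

/-! Normal form. Under a change of basis `g` every contraction picks up only the factors `g⁻¹` on
its free lower indices, so `Q(gA) = Q(A) (g⁻¹)^{⊗k}`, while `A ⊗ Tr₁(A)^{⊗(k-2)}` picks up the same
right factor and `g` on the left. Hence `P(gA) = P(A) g⁻¹`, and `P(A)` moves `A` to a point that
depends only on its orbit (`P_act`, `algebrasIsomorphic_iff_normalForm_eq`). Openness and density
hold because `V₀` is the nonvanishing locus of one polynomial (`V₀_eq`), and the columns exist
because `A ⊗ Tr₁(A)^{⊗(k-2)}` has generic rank `m`.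

The substance is the existence of contractions with `det Q ≠ 0`, that is, an algebra over some
extension field whose contractions span all `k`-tensors. Only contractions leaving one free slot in
each factor are used; they are products of traces of words in left and right multiplications. Their
span is stable under the symmetric group. Permutations are conjugate to their inverses, so a simple
module with invariants under a subgroup also has coinvariants, in any characteristic; therefore a
proper stable subspace is detected after polarization into polynomials in several vectors
(`eq_top_of_wordMap`). It remains to show that the algebra of trace polynomials contains all forms
of large degree. A graded subalgebra of a polynomial ring does so if it separates points, and
tangent vectors at nonzero points: the ring is then finite over it, and the conductor vanishes at
most at the origin (`exists_forall_isHomogeneous_mem`).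

The algebra is a deformation `x * y = x ∘ ((1 + δ E) y)` of the coordinatewise product, whose
letters degenerate to `diag x` and `N = diag x * E - diag (E x)`. Over a valued field take `E k l =
eps l * e l k` with `e` generic and the `eps l` of very different sizes. Separation of points
follows because terms of distinct valuations cannot cancel (`IsGenericWeighted.eq_of_trace_eq`). For
tangent vectors the trace conditions are rescaled, reduced to the residue field, and solved there by
nonvanishing generic minors (`ScaledVector.eq_zero`, `weightedMatrix_immersion`). -/

namespace StructureConstants

/-! ### Equivariance of the contractions, of `Q` and of `P` under change of basis. -/

section Equivariance

variable {m : ℕ} {F : Type*} [Field F]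

/-- The tensor power `g ⊗ ⋯ ⊗ g` of a square matrix, with factors indexed by `ι`. -/
def kroneckerPower (ι : Type*) [Fintype ι] (g : Matrix (Fin m) (Fin m) F) :
    Matrix (ι → Fin m) (ι → Fin m) F :=
  Matrix.of fun q p => ∏ s, g (q s) (p s)

theorem kroneckerPower_mul (ι : Type*) [Fintype ι] [DecidableEq ι]
    (g h : Matrix (Fin m) (Fin m) F) :
    kroneckerPower ι (g * h) = kroneckerPower ι g * kroneckerPower ι h := by
  ext q p
  simp only [kroneckerPower, Matrix.of_apply, Matrix.mul_apply, Finset.prod_univ_sum,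
    Fintype.piFinset_univ, Finset.prod_mul_distrib]

theorem kroneckerPower_one (ι : Type*) [Fintype ι] [DecidableEq ι] :
    kroneckerPower ι (1 : Matrix (Fin m) (Fin m) F) = 1 := by
  ext q p
  by_cases h : q = p
  · subst h
    simp [kroneckerPower]
  · obtain ⟨s, hs⟩ := Function.ne_iff.mp h
    rw [Matrix.one_apply_ne h]
    simp only [kroneckerPower, Matrix.of_apply]
    exact Finset.prod_eq_zero (Finset.mem_univ s) (Matrix.one_apply_ne hs)

theorem act_apply (g : Matrix (Fin m) (Fin m) F) (A : Space m F) (i : Fin m)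
    (jk : Fin m × Fin m) :
    act g A i jk = ∑ i', ∑ l : Fin m × Fin m, g i i' * A i' l * (g⁻¹ l.1 jk.1 * g⁻¹ l.2 jk.2) := by
  simp only [act, Matrix.mul_apply, Matrix.kroneckerMap_apply, Finset.sum_mul]
  rw [Finset.sum_comm]

theorem tensorPower_act (g : Matrix (Fin m) (Fin m) F) (A : Space m F) (k : ℕ) :
    tensorPower (act g A) k =
      kroneckerPower (Fin k) g * tensorPower A k * kroneckerPower (Fin k × Fin 2) g⁻¹ := by
  ext a l
  have e : (∑ b : Fin k → Fin m, ∑ l' : Fin k → Fin m × Fin m,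
      ∏ s, (g (a s) (b s) * A (b s) (l' s) *
        (g⁻¹ (l' s).1 (l (s, 0)) * g⁻¹ (l' s).2 (l (s, 1))))) =
      tensorPower (act g A) k a l := by
    simp only [tensorPower, Matrix.of_apply, act_apply]
    simp only [Finset.prod_univ_sum, Fintype.piFinset_univ]
  rw [← e]
  simp only [Matrix.mul_apply, Finset.sum_mul]
  rw [Finset.sum_comm]
  let E : (Fin k → Fin m × Fin m) ≃ (Fin k × Fin 2 → Fin m) :=
    { toFun := fun f t => if t.2 = 0 then (f t.1).1 else (f t.1).2
      invFun := fun l s => (l (s, 0), l (s, 1))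
      left_inv := fun f => by ext s <;> simp
      right_inv := fun l => by
        ext ⟨s, t⟩
        fin_cases t <;> simp }
  refine Fintype.sum_equiv E _ _ fun l' => Finset.sum_congr rfl fun b _ => ?_
  simp only [kroneckerPower, tensorPower, Matrix.of_apply, Fintype.prod_prod_type,
    Fin.prod_univ_two, ← Finset.prod_mul_distrib]
  rfl

/-- At each contracted pair the `g` of the upper index meets the `g⁻¹` of the lower one and cancels;
only the free lower indices keep a factor `g⁻¹`. -/
theorem contract_act {k : ℕ} (c : Contraction k) {g : Matrix (Fin m) (Fin m) F}
    (hg : IsUnit g.det) (A : Space m F) (p : Fin k → Fin m) :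
    contract c (act g A) p =
      ∑ q, contract c A q * kroneckerPower (Fin k) g⁻¹ q p := by
  have inv : kroneckerPower (Fin k) g⁻¹ * kroneckerPower (Fin k) g = 1 := by
    rw [← kroneckerPower_mul, Matrix.nonsing_inv_mul _ hg, kroneckerPower_one]
  let E : (Fin k → Fin m) × (Fin k → Fin m) ≃ (Fin k × Fin 2 → Fin m) :=
    (Equiv.sumArrowEquivProdArrow _ _ _).symm.trans (c.slot.arrowCongr (Equiv.refl _))
  have hE : ∀ b q t, E (b, q) t = Sum.elim b q (c.slot.symm t) := fun b q t => rfl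
  have split : ∀ a b q : Fin k → Fin m,
      kroneckerPower (Fin k × Fin 2) g⁻¹ (E (b, q)) (fun t => Sum.elim a p (c.slot.symm t)) =
        kroneckerPower (Fin k) g⁻¹ b a * kroneckerPower (Fin k) g⁻¹ q p := by
    intro a b q
    simp only [kroneckerPower, Matrix.of_apply, hE]
    rw [← c.slot.prod_comp]
    simp [Fintype.prod_sum_type]
  simp only [contract, tensorPower_act, Matrix.mul_apply, Finset.sum_mul]
  calc _ = ∑ a : Fin k → Fin m, ∑ x : (Fin k → Fin m) × (Fin k → Fin m), ∑ i : Fin k → Fin m,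
        kroneckerPower (Fin k) g a i * tensorPower A k i (E x) *
          (kroneckerPower (Fin k) g⁻¹ x.1 a * kroneckerPower (Fin k) g⁻¹ x.2 p) := by
        refine Finset.sum_congr rfl fun a _ => ?_
        refine (Fintype.sum_equiv E _ _ fun x => ?_).symm
        refine Finset.sum_congr rfl fun i _ => ?_
        rw [← split a x.1 x.2]
    _ = ∑ x : (Fin k → Fin m) × (Fin k → Fin m), ∑ i : Fin k → Fin m,
        (∑ a, kroneckerPower (Fin k) g⁻¹ x.1 a * kroneckerPower (Fin k) g a i) *
          tensorPower A k i (E x) * kroneckerPower (Fin k) g⁻¹ x.2 p := by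
        rw [Finset.sum_comm]
        refine Finset.sum_congr rfl fun x _ => ?_
        rw [Finset.sum_comm]
        refine Finset.sum_congr rfl fun i _ => ?_
        simp only [Finset.sum_mul]
        refine Finset.sum_congr rfl fun a _ => ?_
        ring
    _ = ∑ x : (Fin k → Fin m) × (Fin k → Fin m),
          tensorPower A k x.1 (E x) * kroneckerPower (Fin k) g⁻¹ x.2 p := by
        refine Finset.sum_congr rfl fun x _ => ?_
        simp only [← Matrix.mul_apply, inv, Matrix.one_apply, ite_mul, one_mul, zero_mul]
        simp
    _ = _ := by
        rw [Fintype.sum_prod_type_right]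
        rfl

theorem Q_act {k : ℕ} (ρ : (Fin k → Fin m) → Contraction k) {g : Matrix (Fin m) (Fin m) F}
    (hg : IsUnit g.det) (A : Space m F) :
    Q ρ (act g A) = Q ρ A * kroneckerPower (Fin k) g⁻¹ := by
  ext r p
  simp only [Q, Matrix.of_apply, contract_act _ hg, Matrix.mul_apply]

theorem Tr₁_act {g : Matrix (Fin m) (Fin m) F} (hg : IsUnit g.det) (A : Space m F) (i : Fin m) :
    Tr₁ (act g A) i = ∑ j, Tr₁ A j * g⁻¹ j i := by
  have inv := Matrix.nonsing_inv_mul _ hg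
  simp only [Tr₁, act_apply, Fintype.sum_prod_type]
  calc _ = ∑ i', ∑ l, ∑ q, (∑ j, g⁻¹ l j * g j i') * A i' (l, q) * g⁻¹ q i := by
        rw [Finset.sum_comm]
        refine Finset.sum_congr rfl fun i' _ => ?_
        rw [Finset.sum_comm]
        refine Finset.sum_congr rfl fun l _ => ?_
        rw [Finset.sum_comm]
        refine Finset.sum_congr rfl fun q _ => ?_
        simp only [Finset.sum_mul]
        refine Finset.sum_congr rfl fun j _ => ?_
        ring
    _ = ∑ i', ∑ q, A i' (i', q) * g⁻¹ q i := by
        refine Finset.sum_congr rfl fun i' _ => ?_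
        simp only [← Matrix.mul_apply, inv, Matrix.one_apply, ite_mul, one_mul, zero_mul]
        rw [Finset.sum_comm]
        simp
    _ = _ := by
        rw [Finset.sum_comm]
        simp only [Finset.sum_mul]

theorem tensorTrace_act (n : ℕ) {g : Matrix (Fin m) (Fin m) F} (hg : IsUnit g.det)
    (A : Space m F) :
    tensorTrace n (act g A) = g * tensorTrace n A * kroneckerPower (Fin (n + 2)) g⁻¹ := by
  ext i p
  let E : (Fin m × Fin m) × (Fin n → Fin m) ≃ (Fin (n + 2) → Fin m) :=
    { toFun := fun x => Fin.cons x.1.1 (Fin.cons x.1.2 x.2)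
      invFun := fun q => ((q 0, q 1), fun s => q s.succ.succ)
      left_inv := fun x => rfl
      right_inv := fun q => by
        ext s
        refine Fin.cases rfl (fun s => ?_) s
        refine Fin.cases rfl (fun s => rfl) s }
  simp only [tensorTrace, Matrix.of_apply, Matrix.mul_apply, Tr₁_act hg, act_apply,
    Finset.prod_univ_sum, Fintype.piFinset_univ]
  rw [← E.sum_comp, Fintype.sum_prod_type, Finset.sum_mul_sum]
  simp only [Finset.sum_mul]
  rw [Finset.sum_comm]
  conv_rhs => rw [Finset.sum_comm]
  refine Finset.sum_congr rfl fun y _ => ?_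
  rw [Finset.sum_comm]
  refine Finset.sum_congr rfl fun l _ => Finset.sum_congr rfl fun i' _ => ?_
  have h0 : E (l, y) 0 = l.1 := rfl
  have h1 : E (l, y) 1 = l.2 := rfl
  have h2 : ∀ s : Fin n, E (l, y) s.succ.succ = y s := fun _ => rfl
  simp only [kroneckerPower, Matrix.of_apply, Fin.prod_univ_succ, h0, h2, Fin.succ_zero_eq_one, h1,
    Finset.prod_mul_distrib]
  ring

/-- The submatrix whose inverse is `P`. -/
noncomputable def selectedColumns {n : ℕ} (ρ : (Fin (n + 2) → Fin m) → Contraction (n + 2))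
    (γ : Fin m ↪ (Fin (n + 2) → Fin m)) (A : Space m F) : Matrix (Fin m) (Fin m) F :=
  (tensorTrace n A * (Q ρ A)⁻¹).submatrix id γ

/-- The inverse of a singular matrix is `0` by convention and the determinant of an inverse is the
inverse of the determinant, so `det P ≠ 0` really does express that the submatrix is nonsingular. -/
theorem mem_V₀_iff {n : ℕ} (ρ : (Fin (n + 2) → Fin m) → Contraction (n + 2))
    (γ : Fin m ↪ (Fin (n + 2) → Fin m)) (A : Space m F) :
    A ∈ V₀ F ρ γ ↔ (selectedColumns ρ γ A).det ≠ 0 ∧ (Q ρ A).det ≠ 0 := by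
  simp only [V₀, Set.mem_ofPred_eq, mul_ne_zero_iff]
  refine and_congr_left fun _ => ?_
  change (selectedColumns ρ γ A)⁻¹.det ≠ 0 ↔ _
  rw [Matrix.det_nonsing_inv, Ring.inverse_eq_inv']
  simp

/-- The tensor powers of `g⁻¹` coming from `tensorTrace` and from `Q` cancel, and left
multiplication by `g` commutes with the selection of columns. -/
theorem selectedColumns_act {n : ℕ} (ρ : (Fin (n + 2) → Fin m) → Contraction (n + 2))
    (γ : Fin m ↪ (Fin (n + 2) → Fin m)) {g : Matrix (Fin m) (Fin m) F} (hg : IsUnit g.det)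
    (A : Space m F) :
    selectedColumns ρ γ (act g A) = g * selectedColumns ρ γ A := by
  have inv : kroneckerPower (Fin (n + 2)) g⁻¹ * kroneckerPower (Fin (n + 2)) g = 1 := by
    rw [← kroneckerPower_mul, Matrix.nonsing_inv_mul _ hg, kroneckerPower_one]
  have inv' : (kroneckerPower (Fin (n + 2)) g⁻¹)⁻¹ = kroneckerPower (Fin (n + 2)) g :=
    Matrix.inv_eq_right_inv inv
  have : tensorTrace n (act g A) * (Q ρ (act g A))⁻¹ = g * (tensorTrace n A * (Q ρ A)⁻¹) := by
    rw [tensorTrace_act n hg, Q_act ρ hg, Matrix.mul_inv_rev, inv']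
    simp only [Matrix.mul_assoc]
    rw [← Matrix.mul_assoc (kroneckerPower _ g⁻¹), inv, Matrix.one_mul]
  rw [selectedColumns, this]
  ext i j
  simp [selectedColumns, Matrix.mul_apply]

theorem P_act {n : ℕ} (ρ : (Fin (n + 2) → Fin m) → Contraction (n + 2))
    (γ : Fin m ↪ (Fin (n + 2) → Fin m)) {g : Matrix (Fin m) (Fin m) F} (hg : IsUnit g.det)
    (A : Space m F) : P ρ γ (act g A) = P ρ γ A * g⁻¹ := by
  change (selectedColumns ρ γ (act g A))⁻¹ = (selectedColumns ρ γ A)⁻¹ * _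
  rw [selectedColumns_act ρ γ hg, Matrix.mul_inv_rev]

theorem act_mem_V₀ {n : ℕ} (ρ : (Fin (n + 2) → Fin m) → Contraction (n + 2))
    (γ : Fin m ↪ (Fin (n + 2) → Fin m)) {g : Matrix (Fin m) (Fin m) F} (hg : IsUnit g.det)
    {A : Space m F} (hA : A ∈ V₀ F ρ γ) : act g A ∈ V₀ F ρ γ := by
  rw [mem_V₀_iff] at hA ⊢
  have unit : IsUnit (kroneckerPower (Fin (n + 2)) g⁻¹).det := by
    refine (Matrix.isUnit_iff_isUnit_det _).mp ?_
    refine .of_mul_eq_one (kroneckerPower (Fin (n + 2)) g) ?_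
    rw [← kroneckerPower_mul, Matrix.nonsing_inv_mul _ hg, kroneckerPower_one]
  rw [selectedColumns_act ρ γ hg, Q_act ρ hg, Matrix.det_mul, Matrix.det_mul]
  exact ⟨mul_ne_zero hg.ne_zero hA.1, mul_ne_zero hA.2 unit.ne_zero⟩

theorem act_act {g h : Matrix (Fin m) (Fin m) F} (A : Space m F) :
    act g (act h A) = act (g * h) A := by
  simp only [act, Matrix.mul_inv_rev, Matrix.mul_assoc, Matrix.mul_kronecker_mul]

theorem act_one (A : Space m F) : act 1 A = A := by
  simp [act]

end Equivariance

/-! ### Isomorphism classes as orbits, and the normal form. -/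

section Isomorphism

variable {m : ℕ} {F W W' : Type*} [Field F] [AddCommGroup W] [Module F W]
  [AddCommGroup W'] [Module F W']

theorem ofAlgebra_eq_act_iff (e : Module.Basis (Fin m) F W) (e' : Module.Basis (Fin m) F W')
    (μ : W →ₗ[F] W →ₗ[F] W) (μ' : W' →ₗ[F] W' →ₗ[F] W') (φ : W ≃ₗ[F] W') :
    (∀ u v, φ (μ u v) = μ' (φ u) (φ v)) ↔
      ofAlgebra e' μ' = act (LinearMap.toMatrix e e' φ) (ofAlgebra e μ) := by
  have hg : IsUnit (LinearMap.toMatrix e e' φ.toLinearMap).det := LinearEquiv.isUnit_det φ e e'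
  set g := LinearMap.toMatrix e e' φ.toLinearMap with hgdef
  have col : ∀ j, φ (e j) = ∑ i, g i j • e' i := fun j => by
    simp [hgdef, LinearMap.toMatrix_apply, e'.sum_repr]
  -- With the inverses cleared, the equation `g A = B (g ⊗ g)` is the homomorphism identity on pairs
  -- of basis vectors.
  have key : (∀ u v, φ (μ u v) = μ' (φ u) (φ v)) ↔
      g * ofAlgebra e μ = ofAlgebra e' μ' * (g ⊗ₖ g) := by
    have h1 : ∀ i j k, (g * ofAlgebra e μ) i (j, k) = e'.repr (φ (μ (e j) (e k))) i := by
      intro i j k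
      have := congrFun (LinearMap.toMatrix_mulVec_repr e e' φ.toLinearMap (μ (e j) (e k))) i
      simpa [Matrix.mul_apply, Matrix.mulVec, dotProduct, ofAlgebra] using this
    have h2 : ∀ i j k, (ofAlgebra e' μ' * (g ⊗ₖ g)) i (j, k) =
        e'.repr (μ' (φ (e j)) (φ (e k))) i := by
      intro i j k
      rw [col, col]
      simp only [Matrix.mul_apply, ofAlgebra, Fintype.sum_prod_type, map_sum, map_smul,
        LinearMap.sum_apply, LinearMap.smul_apply, Finsupp.coe_finsetSum, Finset.sum_apply,
        Finsupp.coe_smul, Pi.smul_apply, smul_eq_mul, Matrix.of_apply, Matrix.kroneckerMap_apply,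
        Finset.mul_sum]
      rw [Finset.sum_comm]
      refine Finset.sum_congr rfl fun x _ => Finset.sum_congr rfl fun y _ => ?_
      ring
    constructor
    · intro h
      ext i ⟨j, k⟩
      rw [h1, h2, h]
    · intro h
      have : μ.compr₂ φ.toLinearMap = μ'.compl₁₂ φ.toLinearMap φ.toLinearMap := by
        refine e.ext fun j => e.ext fun k => e'.repr.injective ?_
        ext i
        have := congrFun (congrFun h i) (j, k)
        rw [h1, h2] at this
        simpa using this
      intro u v
      simpa using LinearMap.congr_fun (LinearMap.congr_fun this u) v
  rw [key]
  have inv : (g ⊗ₖ g) * (g⁻¹ ⊗ₖ g⁻¹) = 1 := by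
    rw [← Matrix.mul_kronecker_mul, Matrix.mul_nonsing_inv _ hg, Matrix.one_kronecker_one]
  have inv' : (g⁻¹ ⊗ₖ g⁻¹) * (g ⊗ₖ g) = 1 := by
    rw [← Matrix.mul_kronecker_mul, Matrix.nonsing_inv_mul _ hg, Matrix.one_kronecker_one]
  constructor
  · intro h
    rw [act, h, Matrix.mul_assoc, inv, Matrix.mul_one]
  · intro h
    rw [h, act, Matrix.mul_assoc, inv', Matrix.mul_one]

theorem algebrasIsomorphic_iff (e : Module.Basis (Fin m) F W) (e' : Module.Basis (Fin m) F W')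
    (μ : W →ₗ[F] W →ₗ[F] W) (μ' : W' →ₗ[F] W' →ₗ[F] W') :
    AlgebrasIsomorphic μ μ' ↔
      ∃ g : Matrix (Fin m) (Fin m) F, IsUnit g.det ∧
        ofAlgebra e' μ' = act g (ofAlgebra e μ) := by
  constructor
  · rintro ⟨φ, h⟩
    exact ⟨_, LinearEquiv.isUnit_det φ e e', (ofAlgebra_eq_act_iff e e' μ μ' φ).mp h⟩
  · rintro ⟨g, hg, h⟩
    have hφ : IsUnit (LinearMap.toMatrix e e' (Matrix.toLin e e' g)).det := by
      rwa [LinearMap.toMatrix_toLin]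
    refine ⟨LinearEquiv.ofIsUnitDet hφ, ?_⟩
    rw [ofAlgebra_eq_act_iff e e']
    have : ((LinearEquiv.ofIsUnitDet hφ : W ≃ₗ[F] W') : W →ₗ[F] W') = Matrix.toLin e e' g := by
      ext; rfl
    rw [this, LinearMap.toMatrix_toLin, h]

theorem algebrasIsomorphic_iff_normalForm_eq {n : ℕ}
    (ρ : (Fin (n + 2) → Fin m) → Contraction (n + 2))
    (γ : Fin m ↪ (Fin (n + 2) → Fin m))
    (e : Module.Basis (Fin m) F W) (e' : Module.Basis (Fin m) F W')
    (μ : W →ₗ[F] W →ₗ[F] W) (μ' : W' →ₗ[F] W' →ₗ[F] W')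
    (hA : ofAlgebra e μ ∈ V₀ F ρ γ) (hB : ofAlgebra e' μ' ∈ V₀ F ρ γ) :
    AlgebrasIsomorphic μ μ' ↔
      act (P ρ γ (ofAlgebra e μ)) (ofAlgebra e μ) =
        act (P ρ γ (ofAlgebra e' μ')) (ofAlgebra e' μ') := by
  rw [algebrasIsomorphic_iff e e']
  set A := ofAlgebra e μ
  set B := ofAlgebra e' μ'
  have uA : IsUnit (P ρ γ A).det := (left_ne_zero_of_mul hA).isUnit
  have uB : IsUnit (P ρ γ B).det := (left_ne_zero_of_mul hB).isUnit
  constructor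
  · rintro ⟨g, hg, h⟩
    rw [h, P_act ρ γ hg, act_act, Matrix.mul_assoc, Matrix.nonsing_inv_mul _ hg, Matrix.mul_one]
  · intro h
    -- Go from `A` to the common normal form and back to `B`.
    refine ⟨(P ρ γ B)⁻¹ * P ρ γ A, ?_, ?_⟩
    · rw [Matrix.det_mul]
      exact (Matrix.isUnit_nonsing_inv_det _ uB).mul uA
    · rw [← act_act, h, act_act, Matrix.nonsing_inv_mul _ uB, act_one]

end Isomorphism
end StructureConstants

namespace StructureConstants

/-! ### Polynomial functions of the structure constants and the Zariski topology. -/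

section PolynomialFunctions

variable {m : ℕ} {F : Type*} [Field F]

/-- The algebra of polynomial functions on `Mat(m × m²; F)`. -/
noncomputable def polynomialFunctions (m : ℕ) (F : Type*) [Field F] :
    Subalgebra F (Space m F → F) :=
  (AlgHom.pi (R := F) fun A : Space m F =>
    MvPolynomial.aeval (fun x : Fin m × Fin m × Fin m => A x.1 x.2)).range

theorem mem_polynomialFunctions_iff {f : Space m F → F} :
    f ∈ polynomialFunctions m F ↔ ∃ p : MvPolynomial (Fin m × Fin m × Fin m) F,
      ∀ A : Space m F, MvPolynomial.eval (fun x => A x.1 x.2) p = f A := by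
  simp only [polynomialFunctions, AlgHom.mem_range, funext_iff, AlgHom.pi_apply]
  rfl

theorem entry_mem (i : Fin m) (l : Fin m × Fin m) :
    (fun A : Space m F => A i l) ∈ polynomialFunctions m F :=
  mem_polynomialFunctions_iff.mpr ⟨MvPolynomial.X (i, l), fun A => by simp⟩

theorem const_mem (c : F) : (fun _ : Space m F => c) ∈ polynomialFunctions m F :=
  (polynomialFunctions m F).algebraMap_mem c

theorem sum_mem' {ι : Type*} (s : Finset ι) {f : ι → Space m F → F}
    (h : ∀ i, f i ∈ polynomialFunctions m F) :
    (fun A => ∑ i ∈ s, f i A) ∈ polynomialFunctions m F := by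
  have := Subalgebra.sum_mem (polynomialFunctions m F) (t := s) fun i _ => h i
  convert this using 1
  ext A
  simp

theorem prod_mem' {ι : Type*} (s : Finset ι) {f : ι → Space m F → F}
    (h : ∀ i, f i ∈ polynomialFunctions m F) :
    (fun A => ∏ i ∈ s, f i A) ∈ polynomialFunctions m F := by
  have := Subalgebra.prod_mem (polynomialFunctions m F) (t := s) fun i _ => h i
  convert this using 1
  ext A
  simp

theorem mul_mem' {f g : Space m F → F} (hf : f ∈ polynomialFunctions m F)
    (hg : g ∈ polynomialFunctions m F) : (fun A => f A * g A) ∈ polynomialFunctions m F :=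
  Subalgebra.mul_mem _ hf hg

theorem det_mem {ι : Type*} [Fintype ι] [DecidableEq ι] {M : Space m F → Matrix ι ι F}
    (h : ∀ i j, (fun A => M A i j) ∈ polynomialFunctions m F) :
    (fun A => (M A).det) ∈ polynomialFunctions m F := by
  simp only [Matrix.det_apply']
  exact sum_mem' _ fun σ => mul_mem' (const_mem _) (prod_mem' _ fun i => h _ _)

theorem adjugate_mem {ι : Type*} [Fintype ι] [DecidableEq ι] {M : Space m F → Matrix ι ι F}
    (h : ∀ i j, (fun A => M A i j) ∈ polynomialFunctions m F) (i j : ι) :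
    (fun A => (M A).adjugate i j) ∈ polynomialFunctions m F := by
  simp only [Matrix.adjugate_apply]
  refine det_mem fun a b => ?_
  by_cases hj : a = j
  · subst hj
    simp only [Matrix.updateRow_self]
    exact const_mem _
  · simp only [Matrix.updateRow_ne hj]
    exact h a b

theorem contract_mem {k : ℕ} (c : Contraction k) (p : Fin k → Fin m) :
    (fun A : Space m F => contract c A p) ∈ polynomialFunctions m F :=
  sum_mem' _ fun a => by
    simp only [tensorPower, Matrix.of_apply]
    exact prod_mem' _ fun _ => entry_mem _ _

theorem tensorTrace_mem (n : ℕ) (i : Fin m) (p : Fin (n + 2) → Fin m) :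
    (fun A : Space m F => tensorTrace n A i p) ∈ polynomialFunctions m F :=
  mul_mem' (entry_mem _ _) (prod_mem' _ fun _ => sum_mem' _ fun _ => entry_mem _ _)

theorem det_Q_mem {k : ℕ} (ρ : (Fin k → Fin m) → Contraction k) :
    (fun A : Space m F => (Q ρ A).det) ∈ polynomialFunctions m F :=
  det_mem fun r p => contract_mem (ρ r) p

theorem isZariskiOpen_ne_zero {f : Space m F → F} (hf : f ∈ polynomialFunctions m F) :
    IsZariskiOpen {A | f A ≠ 0} := by
  obtain ⟨p, hp⟩ := mem_polynomialFunctions_iff.mp hf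
  refine ⟨Ideal.span {p}, ?_⟩
  ext A
  simp [MvPolynomial.zeroLocus_span, hp]

/-- Irreducibility of affine space over an infinite field: the product vanishes everywhere, hence is
the zero polynomial, and the polynomial ring is a domain. -/
theorem exists_of_mul_eq_zero [Infinite F] {p q : MvPolynomial (Fin m × Fin m × Fin m) F}
    (h : ∀ A : Space m F, MvPolynomial.eval (fun x => A x.1 x.2) p = 0 ∨
      MvPolynomial.eval (fun x => A x.1 x.2) q = 0) : p = 0 ∨ q = 0 := by
  rw [← mul_eq_zero]
  refine MvPolynomial.funext fun v => ?_
  have := h (Matrix.of fun i l => v (i, l))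
  rw [map_mul, map_zero, mul_eq_zero]
  exact this

theorem exists_ne_zero_and_ne_zero [Infinite F] {f g : Space m F → F}
    (hf : f ∈ polynomialFunctions m F) (hg : g ∈ polynomialFunctions m F)
    (hf' : ∃ A, f A ≠ 0) (hg' : ∃ A, g A ≠ 0) : ∃ A, f A ≠ 0 ∧ g A ≠ 0 := by
  obtain ⟨p, hp⟩ := mem_polynomialFunctions_iff.mp hf
  obtain ⟨q, hq⟩ := mem_polynomialFunctions_iff.mp hg
  by_contra! h
  obtain ⟨A, hA⟩ := hf'
  obtain ⟨B, hB⟩ := hg'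
  rcases exists_of_mul_eq_zero (p := p) (q := q) fun A => by
    rw [hp, hq, or_iff_not_imp_left]
    exact h A with rfl | rfl
  · exact hA (by rw [← hp, map_zero])
  · exact hB (by rw [← hq, map_zero])

theorem isZariskiDense_ne_zero [Infinite F] {f : Space m F → F}
    (hf : f ∈ polynomialFunctions m F) (hf' : ∃ A, f A ≠ 0) :
    IsZariskiDense {A | f A ≠ 0} := by
  obtain ⟨p, hp⟩ := mem_polynomialFunctions_iff.mp hf
  rintro Z ⟨I, rfl⟩ hZ
  rw [Set.eq_univ_iff_forall]
  intro B q hq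
  have h0 : p = 0 ∨ q = 0 := exists_of_mul_eq_zero fun A => by
    rw [or_iff_not_imp_left]
    intro hA
    rw [hp] at hA
    simpa [MvPolynomial.coe_aeval_eq_eval] using hZ hA q hq
  obtain ⟨A, hA⟩ := hf'
  rcases h0 with rfl | rfl
  · exact absurd (by rw [← hp, map_zero]) hA
  · simp

end PolynomialFunctions

/-! ### `V₀` as a principal open set, and the choice of columns. -/

section Genericity

variable {m : ℕ} {F : Type*} [Field F]

/-- A polynomial function with nonvanishing locus `V₀`. -/
noncomputable def discriminant {n : ℕ} (ρ : (Fin (n + 2) → Fin m) → Contraction (n + 2))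
    (γ : Fin m ↪ (Fin (n + 2) → Fin m)) (A : Space m F) : F :=
  ((tensorTrace n A * (Q ρ A).adjugate).submatrix id γ).det * (Q ρ A).det

theorem discriminant_mem {n : ℕ} (ρ : (Fin (n + 2) → Fin m) → Contraction (n + 2))
    (γ : Fin m ↪ (Fin (n + 2) → Fin m)) :
    discriminant ρ γ ∈ polynomialFunctions m F := by
  refine mul_mem' (det_mem fun i j => ?_) (det_Q_mem ρ)
  simp only [Matrix.submatrix_apply, Matrix.mul_apply]
  exact sum_mem' _ fun q => mul_mem' (tensorTrace_mem _ _ _)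
    (adjugate_mem (fun r p => contract_mem (ρ r) p) _ _)

/-- Where `det Q ≠ 0`, the adjugate is a nonzero multiple of the inverse. Using it clears the
denominators without changing the nonvanishing locus. -/
theorem V₀_eq {n : ℕ} (ρ : (Fin (n + 2) → Fin m) → Contraction (n + 2))
    (γ : Fin m ↪ (Fin (n + 2) → Fin m)) : V₀ F ρ γ = {A | discriminant ρ γ A ≠ 0} := by
  ext A
  rw [mem_V₀_iff, Set.mem_ofPred_eq, discriminant, mul_ne_zero_iff]
  refine and_congr_left fun hQ => ?_
  rw [selectedColumns, Matrix.inv_def, Ring.inverse_eq_inv', Matrix.mul_smul,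
    Matrix.submatrix_smul]
  simp [hQ]

theorem exists_tensorTrace_minor_ne_zero (n : ℕ) :
    ∃ A : Space m F,
      ((tensorTrace n A).submatrix id fun (c : Fin m) (_ : Fin (n + 2)) => c).det ≠ 0 := by
  -- The coordinatewise product on `F^m`: here `Tr₁` is the row of ones, and the columns of constant
  -- words form the identity matrix.
  refine ⟨Matrix.of fun i l => if i = l.1 ∧ i = l.2 then 1 else 0, ?_⟩
  have : (tensorTrace n (Matrix.of fun i l => if i = l.1 ∧ i = l.2 then (1 : F) else 0)).submatrix
      id (fun (c : Fin m) (_ : Fin (n + 2)) => c) = 1 := by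
    ext i c
    simp [tensorTrace, Tr₁, Matrix.one_apply]
  rw [this]
  simp

theorem exists_columns_det_ne_zero {ι : Type*} [Fintype ι] (M : Matrix (Fin m) ι F)
    (hM : Function.Surjective M.mulVecLin) :
    ∃ γ : Fin m ↪ ι, (M.submatrix id γ).det ≠ 0 := by
  obtain ⟨κ, a, ha, hspan, hli⟩ := exists_linearIndependent' F (fun j => M.col j)
  have top : ⊤ ≤ Submodule.span F (Set.range ((fun j => M.col j) ∘ a)) := by
    rw [hspan]
    have := Matrix.range_mulVecLin M
    rw [LinearMap.range_eq_top.mpr hM] at this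
    exact this.le
  let b := Module.Basis.mk hli top
  let e : Fin m ≃ κ := (Pi.basisFun F (Fin m)).indexEquiv b
  refine ⟨⟨a ∘ e, ha.comp e.injective⟩, ?_⟩
  have : LinearIndependent F (M.submatrix id (a ∘ e)).col := hli.comp e e.injective
  rw [Matrix.linearIndependent_cols_iff_isUnit] at this
  exact ((Matrix.isUnit_iff_isUnit_det _).mp this).ne_zero

theorem exists_V₀_nonempty [Infinite F] {n : ℕ}
    (ρ : (Fin (n + 2) → Fin m) → Contraction (n + 2)) (h : ∃ A : Space m F, (Q ρ A).det ≠ 0) :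
    ∃ γ : Fin m ↪ (Fin (n + 2) → Fin m), (V₀ F ρ γ).Nonempty := by
  -- Two nonzero polynomials have a common point of nonvanishing; there `tensorTrace` has rank `m`,
  -- and so has its product with `Q⁻¹`.
  obtain ⟨A, hQ, hT⟩ := exists_ne_zero_and_ne_zero (det_Q_mem ρ)
    (det_mem fun i c => tensorTrace_mem n i fun _ => c) h (exists_tensorTrace_minor_ne_zero n)
  have hT' : IsUnit ((tensorTrace n A).submatrix id fun (c : Fin m) (_ : Fin (n + 2)) => c) :=
    (Matrix.isUnit_iff_isUnit_det _).mpr hT.isUnit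
  have surj : Function.Surjective (tensorTrace n A * (Q ρ A)⁻¹).mulVecLin := by
    rw [Matrix.mulVecLin_mul]
    refine Function.Surjective.comp (g := (tensorTrace n A).mulVecLin) ?_ ?_
    · have := Matrix.range_mulVecLin (tensorTrace n A)
      rw [← LinearMap.range_eq_top, this, eq_top_iff]
      have hcol := (Matrix.linearIndependent_cols_iff_isUnit.mpr hT').span_eq_top_of_card_eq_finrank'
        (by simp)
      rw [← hcol]
      refine Submodule.span_mono ?_
      rintro _ ⟨c, rfl⟩
      exact ⟨fun _ => c, rfl⟩
    · intro v
      refine ⟨(Q ρ A).mulVec v, ?_⟩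
      simp [Matrix.nonsing_inv_mul _ hQ.isUnit]
  obtain ⟨γ, hγ⟩ := exists_columns_det_ne_zero _ surj
  exact ⟨γ, A, (mem_V₀_iff ρ γ A).mpr ⟨hγ, hQ⟩⟩

end Genericity
end StructureConstants

/-! ### Graded subalgebras of polynomial rings and their conductors. -/

theorem exists_sub_one_mem_and_mul_eq_algebraMap {A B : Type*} [CommRing A] [CommRing B]
    [Algebra A B] [Module.Finite A B] (I : Ideal A)
    (h : ∀ b : B, ∃ a : A, b - algebraMap A B a ∈ I.map (algebraMap A B)) :
    ∃ r : A, r - 1 ∈ I ∧ ∀ b : B, ∃ a : A, algebraMap A B r * b = algebraMap A B a := by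
  set R : Submodule A B := Submodule.span A {1} with hR
  -- Modulo `I B` everything comes from `A`, so `B / (A · 1)` equals `I` times itself and Nakayama's
  -- lemma yields an `r ≡ 1` that annihilates it.
  have hquot : (⊤ : Submodule A (B ⧸ R)) ≤ I • ⊤ := by
    rintro q -
    obtain ⟨f, rfl⟩ := Submodule.Quotient.mk_surjective R q
    obtain ⟨a, ha⟩ := h f
    have hq : Submodule.Quotient.mk f = R.mkQ (f - algebraMap A B a) := by
      rw [Submodule.mkQ_apply, Submodule.Quotient.eq]
      simp only [sub_sub_cancel]
      exact Submodule.mem_span_singleton.mpr ⟨a, by rw [Algebra.smul_def, mul_one]⟩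
    rw [hq]
    have h2 : f - algebraMap A B a ∈ (I • ⊤ : Submodule A B) := by
      rw [Ideal.smul_top_eq_map]
      exact ha
    have h3 := Submodule.mem_map_of_mem (f := R.mkQ) h2
    rw [Submodule.map_smul''] at h3
    exact Submodule.smul_mono le_rfl le_top h3
  obtain ⟨r, hr, hr0⟩ := Submodule.exists_sub_one_mem_and_smul_eq_zero_of_fg_of_le_smul I _
    (Module.Finite.fg_top (R := A) (M := B ⧸ R)) hquot
  refine ⟨r, hr, fun b => ?_⟩
  have := hr0 (R.mkQ b) trivial
  rw [← map_smul, Submodule.mkQ_apply, Submodule.Quotient.mk_eq_zero] at this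
  obtain ⟨t, ht⟩ := Submodule.mem_span_singleton.mp this
  exact ⟨t, by rw [← Algebra.smul_def, ← ht, Algebra.smul_def, mul_one]⟩

namespace MvPolynomial

section Graded

variable {σ K : Type*} [Field K]

/-- First-order Taylor expansion, used to read the cotangent space `𝔪 / 𝔪²` at `ξ` off the
gradients. -/
theorem sub_taylor_mem_sq [Fintype σ] (ξ : σ → K) (f : MvPolynomial σ K) :
    f - C (eval ξ f) - ∑ i, C (eval ξ (pderiv i f)) * (X i - C (ξ i)) ∈
      (RingHom.ker (eval ξ)) ^ 2 := by
  classical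
  have hX : ∀ i, (X i - C (ξ i) : MvPolynomial σ K) ∈ RingHom.ker (eval ξ) := fun i => by
    simp [RingHom.mem_ker]
  induction f using MvPolynomial.induction_on with
  | C a => simp
  | add p q hp hq =>
    convert add_mem hp hq using 1
    simp only [map_add, add_mul, Finset.sum_add_distrib]
    ring
  | mul_X p j hp =>
    have key : p * X j - C (eval ξ (p * X j)) -
        ∑ i, C (eval ξ (pderiv i (p * X j))) * (X i - C (ξ i)) =
        (p - C (eval ξ p) - ∑ i, C (eval ξ (pderiv i p)) * (X i - C (ξ i))) * C (ξ j) +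
          (p - C (eval ξ p)) * (X j - C (ξ j)) := by
      have : ∑ i, C (eval ξ (pderiv i (p * X j))) * (X i - C (ξ i)) =
          (∑ i, C (eval ξ (pderiv i p)) * (X i - C (ξ i))) * C (ξ j) +
            C (eval ξ p) * (X j - C (ξ j)) := by
        have h2 : ∀ i, C (eval ξ (pderiv i (p * X j))) * (X i - C (ξ i)) =
            C (eval ξ (pderiv i p)) * (X i - C (ξ i)) * C (ξ j) +
              (if i = j then C (eval ξ p) * (X j - C (ξ j)) else 0) := by
          intro i
          rw [pderiv_mul, pderiv_X]
          by_cases h : i = j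
          · subst h
            simp
            ring
          · simp [h, Ne.symm h]
            ring
        rw [Finset.sum_congr rfl fun i _ => h2 i, Finset.sum_add_distrib, Finset.sum_mul]
        simp
      rw [this]
      simp only [map_mul, eval_X]
      ring
    rw [key]
    refine add_mem (Ideal.mul_mem_right _ _ hp) ?_
    rw [pow_two]
    exact Ideal.mul_mem_mul (by simp [RingHom.mem_ker]) (hX j)

/-- The conductor of the ring of polynomials into a subalgebra. -/
def conductor (S : Subalgebra K (MvPolynomial σ K)) : Ideal (MvPolynomial σ K) where
  carrier := {c | ∀ b, c * b ∈ S}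
  add_mem' ha hb c := by rw [add_mul]; exact S.add_mem (ha c) (hb c)
  zero_mem' b := by simp [S.zero_mem]
  smul_mem' r a ha b := by
    have := ha (r * b)
    rw [smul_eq_mul]
    convert this using 1
    ring

theorem conductor_le {S : Subalgebra K (MvPolynomial σ K)} {c : MvPolynomial σ K}
    (h : c ∈ conductor S) : c ∈ S := by simpa using h 1

/-- Pigeonhole: if `X i ^ e i ∈ I` for all `i`, a monomial of degree above `∑ e i` is divisible by
one of these powers. -/
theorem exists_forall_isHomogeneous_mem_of_X_mem_radical [Finite σ]
    (I : Ideal (MvPolynomial σ K)) (h : ∀ i, X i ∈ I.radical) :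
    ∃ N, ∀ n ≥ N, ∀ f : MvPolynomial σ K, f.IsHomogeneous n → f ∈ I := by
  classical
  have := Fintype.ofFinite σ
  choose e he using h
  refine ⟨∑ i, e i + 1, fun n hn f hf => ?_⟩
  rw [f.as_sum]
  refine Ideal.sum_mem _ fun d hd => ?_
  have hdn : ∑ i, d i = n := by
    have := hf (mem_support_iff.mp hd)
    rw [← this, Finsupp.weight_apply, Finsupp.sum_fintype _ _ (by simp)]
    simp
  have : ∃ i, e i ≤ d i := by
    by_contra! hlt
    have := Finset.sum_le_sum fun i (_ : i ∈ Finset.univ) => (hlt i).le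
    omega
  obtain ⟨i, hi⟩ := this
  have hd' : monomial d (coeff d f) = monomial (d - Finsupp.single i (e i)) (coeff d f) * X i ^ e i := by
    rw [X_pow_eq_monomial, monomial_mul, mul_one, tsub_add_cancel_of_le]
    rwa [Finsupp.single_le_iff]
  rw [hd']
  exact Ideal.mul_mem_left _ _ (he i)

/-- Graded Nakayama. The forms of positive degree in `S` vanish together only at the origin, so by
the Nullstellensatz the ideal they generate contains all forms of degree at least some `D`.
Induction on the degree then shows that the monomials of degree below `D` generate the ring over
`S`. -/
theorem finite_of_zeroLocus_homogeneous [IsAlgClosed K] [Finite σ]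
    (S : Subalgebra K (MvPolynomial σ K))
    (hgr : ∀ s ∈ S, ∀ n, homogeneousComponent n s ∈ S)
    (hz : ∀ ξ : σ → K, ξ ≠ 0 → ∃ s ∈ S, eval ξ s ≠ eval 0 s) :
    Module.Finite S (MvPolynomial σ K) := by
  classical
  set T : Set (MvPolynomial σ K) := {s | s ∈ S ∧ ∃ e, 0 < e ∧ s.IsHomogeneous e} with hT
  have hXr : ∀ i, X i ∈ (Ideal.span T).radical := by
    intro i
    rw [← vanishingIdeal_zeroLocus_eq_radical (K := K), zeroLocus_span]
    intro x hx
    have : x = 0 := by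
      by_contra hne
      obtain ⟨s, hs, hsx⟩ := hz x hne
      apply hsx
      have hsum := sum_homogeneousComponent s
      have hx' : ∀ p ∈ T, eval x p = 0 := by simpa [aeval_eq_eval] using hx
      -- At a common zero of `T` only the constant term of `s` survives, so `s` cannot separate that
      -- point from the origin.
      have h0 : ∀ y : σ → K, (∀ p ∈ T, eval y p = 0) → eval y s = coeff 0 s := by
        intro y hy
        conv_lhs => rw [← hsum, map_sum]
        rw [Finset.sum_eq_single 0]
        · simp
        · intro n _ hn
          exact hy _ ⟨hgr s hs n, n, Nat.pos_of_ne_zero hn, homogeneousComponent_isHomogeneous n s⟩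
        · intro h; simp at h
      rw [h0 x hx', h0 0]
      rintro p ⟨_, e, he, hp⟩
      rw [eval_zero, constantCoeff_eq]
      exact hp.coeff_eq_zero (by simpa using he.ne)
    simp [this]
  obtain ⟨D, hD⟩ := exists_forall_isHomogeneous_mem_of_X_mem_radical _ hXr
  set G : Set (MvPolynomial σ K) := {f | ∃ n < D, ∃ d : σ →₀ ℕ, d.degree = n ∧ f = monomial d 1} with hG
  have hGfin : G.Finite := by
    refine ((Finsupp.finite_of_degree_lt (σ := σ) D).image fun d => monomial d (1 : K)).subset ?_
    rintro f ⟨n, hn, d, hd, rfl⟩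
    exact ⟨d, by simpa [hd] using hn, rfl⟩
  set M := Submodule.span S G with hM
  have hKM : ∀ (c : K) (f), f ∈ M → C c * f ∈ M := by
    intro c f hf
    have : C c * f = (⟨C c, S.algebraMap_mem c⟩ : S) • f := rfl
    rw [this]
    exact M.smul_mem _ hf
  have main : ∀ n, ∀ f : MvPolynomial σ K, f.IsHomogeneous n → f ∈ M := by
    intro n
    induction n using Nat.strong_induction_on with
    | _ n ih =>
    intro f hf
    by_cases hnD : n < D
    · rw [f.as_sum]
      refine Submodule.sum_mem _ fun d hd => ?_
      have : monomial d (coeff d f) = C (coeff d f) * monomial d 1 := by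
        rw [C_mul_monomial, mul_one]
      rw [this]
      refine hKM _ _ (Submodule.subset_span ⟨n, hnD, d, ?_, rfl⟩)
      have := hf (mem_support_iff.mp hd)
      rw [← this, Finsupp.degree_eq_weight_one]
      rfl
    · have hfI := hD n (not_lt.mp hnD) f hf
      have : homogeneousComponent n f ∈ M := by
        refine Submodule.closure_induction (p := fun g _ => homogeneousComponent n g ∈ M)
          ?_ ?_ ?_ hfI
        · simp
        · intro g g' _ _ hg hg'
          rw [map_add]
          exact add_mem hg hg'
        · rintro b s ⟨hs, e, he, hse⟩
          rw [smul_eq_mul, ← sum_homogeneousComponent b, Finset.sum_mul, map_sum]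
          refine Submodule.sum_mem _ fun i _ => ?_
          have hbi := homogeneousComponent_isHomogeneous i b
          rw [homogeneousComponent_of_mem (hbi.mul hse)]
          split_ifs with hin
          · have := M.smul_mem (⟨s, hs⟩ : S) (ih i (by omega) _ hbi)
            rw [mul_comm]
            exact this
          · exact M.zero_mem
      rwa [homogeneousComponent_eq_self hf] at this
  refine ⟨⟨hGfin.toFinset, ?_⟩⟩
  rw [hGfin.coe_toFinset, eq_top_iff]
  intro f _
  rw [← sum_homogeneousComponent f]
  exact Submodule.sum_mem _ fun n _ => main n _ (homogeneousComponent_isHomogeneous n f)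

/-- Let `J` be the extension of the maximal ideal `𝔫` of `S` below `ξ`. Separation of points makes
`𝔪` the radical of `J`, separation of tangent vectors gives `𝔪 ≤ J + 𝔪²`, so `J = 𝔪`. Then `S`
surjects onto the ring modulo `𝔫`, and finiteness provides an element of `S`, equal to `1` at `ξ`,
that multiplies the whole ring into `S`. -/
theorem exists_mem_conductor_eval_ne_zero [IsAlgClosed K] [Finite σ]
    (S : Subalgebra K (MvPolynomial σ K)) [Module.Finite S (MvPolynomial σ K)]
    (ξ : σ → K) (hsep : ∀ η : σ → K, η ≠ ξ → ∃ s ∈ S, eval η s ≠ eval ξ s)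
    (himm : ∀ η : σ → K, η ≠ 0 → ∃ s ∈ S, ∑ᶠ i, η i * eval ξ (pderiv i s) ≠ 0) :
    ∃ c ∈ conductor S, eval ξ c ≠ 0 := by
  classical
  have := Fintype.ofFinite σ
  set 𝔪 : Ideal (MvPolynomial σ K) := RingHom.ker (eval ξ) with h𝔪
  set 𝔫 : Ideal S := 𝔪.comap (algebraMap S (MvPolynomial σ K)) with h𝔫
  set J : Ideal (MvPolynomial σ K) := 𝔫.map (algebraMap S (MvPolynomial σ K)) with hJ
  have hmemJ : ∀ s ∈ S, eval ξ s = 0 → s ∈ J := fun s hs h0 =>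
    Ideal.mem_map_of_mem (algebraMap S (MvPolynomial σ K)) (show (⟨s, hs⟩ : S) ∈ 𝔫 from h0)
  have hJ𝔪 : J ≤ 𝔪 := Ideal.map_comap_le
  have hrad : 𝔪 ≤ J.radical := by
    rw [← vanishingIdeal_zeroLocus_eq_radical (K := K)]
    intro f hf x hx
    have hxξ : x = ξ := by
      by_contra hne
      obtain ⟨s, hs, hsx⟩ := hsep x hne
      have hJs := hmemJ (s - C (eval ξ s)) (S.sub_mem hs (S.algebraMap_mem _)) (by simp)
      have := hx _ hJs
      rw [aeval_eq_eval] at this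
      apply hsx
      simpa [sub_eq_zero] using this
    rw [hxξ, aeval_eq_eval]
    exact hf
  have hsq : 𝔪 ≤ J ⊔ 𝔪 ^ 2 := by
    let grad : MvPolynomial σ K →ₗ[K] (σ → K) :=
      LinearMap.pi fun i => (aeval ξ).toLinearMap ∘ₗ (pderiv i).toLinearMap
    have hgrad : ∀ s i, grad s i = eval ξ (pderiv i s) := fun s i => by
      simp [grad, aeval_eq_eval]
    -- A nonzero functional that kills all gradients of elements of `S` would be a tangent vector
    -- not separated by `S`.
    have hsurj : (Subalgebra.toSubmodule S).map grad = ⊤ := by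
      by_contra hne
      obtain ⟨φ, hφ, hφ0⟩ := Submodule.exists_le_ker_of_lt_top _ (lt_top_iff_ne_top.mpr hne)
      have hφ' : ∀ v, φ v = ∑ i, φ (Pi.single i 1) * v i := by
        intro v
        conv_lhs => rw [LinearMap.pi_apply_eq_sum_univ φ v]
        refine Finset.sum_congr rfl fun i _ => ?_
        rw [smul_eq_mul, mul_comm]
        congr 2
        ext j
        simp [Pi.single_apply, eq_comm]
      obtain ⟨s, hs, hs0⟩ := himm (fun i => φ (Pi.single i 1)) (by
        intro h0
        apply hφ
        ext i
        simpa using congrFun h0 i)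
      apply hs0
      have : φ (grad s) = 0 := hφ0 ⟨s, hs, rfl⟩
      rw [hφ'] at this
      rw [finsum_eq_sum_of_fintype]
      simpa [hgrad] using this
    have hX : ∀ i, (X i - C (ξ i) : MvPolynomial σ K) ∈ J ⊔ 𝔪 ^ 2 := by
      intro i
      have : (Pi.single i 1 : σ → K) ∈ (Subalgebra.toSubmodule S).map grad := by
        rw [hsurj]; trivial
      obtain ⟨s, hs, hsi⟩ := this
      have ht := sub_taylor_mem_sq ξ s
      have hg : ∀ j, eval ξ (pderiv j s) = (Pi.single i 1 : σ → K) j := fun j => by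
        rw [← hgrad, hsi]
      simp only [hg] at ht
      rw [Finset.sum_eq_single i (fun j _ hj => by simp [hj]) (by simp)] at ht
      simp only [Pi.single_eq_same, map_one, one_mul] at ht
      have hJs := hmemJ (s - C (eval ξ s)) (S.sub_mem hs (S.algebraMap_mem _)) (by simp)
      have : (X i - C (ξ i) : MvPolynomial σ K) =
          (s - C (eval ξ s)) - (s - C (eval ξ s) - (X i - C (ξ i))) := by ring
      rw [this]
      exact sub_mem (Ideal.mem_sup_left hJs) (Ideal.mem_sup_right ht)
    intro f hf
    have ht := sub_taylor_mem_sq ξ f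
    rw [show eval ξ f = 0 from hf, map_zero, sub_zero] at ht
    rw [← sub_add_cancel f (∑ i, C (eval ξ (pderiv i f)) * (X i - C (ξ i)))]
    exact add_mem (Ideal.mem_sup_right ht)
      (Ideal.sum_mem _ fun i _ => Ideal.mul_mem_left _ _ (hX i))
  -- Iterate `𝔪 ≤ J + 𝔪²` until the power of `𝔪` is contained in `J`.
  have hpow : ∀ j, 𝔪 ≤ J ⊔ 𝔪 ^ (j + 1) := by
    intro j
    induction j with
    | zero => simp
    | succ j ih =>
      refine ih.trans (sup_le le_sup_left ?_)
      calc 𝔪 ^ (j + 1) = 𝔪 ^ j * 𝔪 := pow_succ _ _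
        _ ≤ 𝔪 ^ j * (J ⊔ 𝔪 ^ 2) := Ideal.mul_mono_right hsq
        _ = 𝔪 ^ j * J ⊔ 𝔪 ^ j * 𝔪 ^ 2 := Ideal.mul_sup _ _ _
        _ ≤ J ⊔ 𝔪 ^ (j + 1 + 1) := sup_le_sup Ideal.mul_le_right (by rw [← pow_add])
  have hJeq : 𝔪 ≤ J := by
    obtain ⟨n, hn⟩ := Ideal.exists_pow_le_of_le_radical_of_fg hrad (IsNoetherian.noetherian 𝔪)
    have := hpow n
    rwa [sup_eq_left.mpr ((Ideal.pow_le_pow_right (Nat.le_succ n)).trans hn)] at this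
  obtain ⟨r, hr, hr0⟩ := exists_sub_one_mem_and_mul_eq_algebraMap 𝔫 fun f =>
    (⟨⟨C (eval ξ f), S.algebraMap_mem _⟩, hJeq (by simp [h𝔪, RingHom.mem_ker])⟩ :
      ∃ a : S, f - algebraMap S (MvPolynomial σ K) a ∈ J)
  refine ⟨r, fun b => ?_, ?_⟩
  · obtain ⟨t, ht⟩ := hr0 b
    have h4 : (r : MvPolynomial σ K) * b = t := ht
    rw [h4]
    exact t.2
  · have : eval ξ ((r : MvPolynomial σ K) - 1) = 0 := hr
    rw [map_sub, map_one, sub_eq_zero] at this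
    rw [this]
    exact one_ne_zero

/-- A graded subalgebra of a polynomial ring whose elements separate points, and tangent vectors
at the nonzero points, contains all homogeneous polynomials of large degree. -/
theorem exists_forall_isHomogeneous_mem [IsAlgClosed K] [Finite σ]
    (S : Subalgebra K (MvPolynomial σ K))
    (hgr : ∀ s ∈ S, ∀ n, homogeneousComponent n s ∈ S)
    (hsep : ∀ ξ η : σ → K, η ≠ ξ → ∃ s ∈ S, eval η s ≠ eval ξ s)
    (himm : ∀ ξ η : σ → K, ξ ≠ 0 → η ≠ 0 → ∃ s ∈ S, ∑ᶠ i, η i * eval ξ (pderiv i s) ≠ 0) :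
    ∃ N, ∀ n ≥ N, ∀ f : MvPolynomial σ K, f.IsHomogeneous n → f ∈ S := by
  have := finite_of_zeroLocus_homogeneous S hgr fun ξ hξ => hsep 0 ξ hξ
  -- The conductor vanishes at no nonzero point, so it contains a power of every variable. The
  -- origin needs no tangent condition.
  obtain ⟨N, hN⟩ := exists_forall_isHomogeneous_mem_of_X_mem_radical (conductor S) (fun i => by
    rw [← vanishingIdeal_zeroLocus_eq_radical (K := K)]
    intro x hx
    by_cases h : x = 0
    · simp [h]
    obtain ⟨c, hc, hc0⟩ := exists_mem_conductor_eval_ne_zero S x (hsep x) fun η => himm x η h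
    refine absurd ?_ hc0
    rw [← aeval_eq_eval]
    exact hx c hc)
  exact ⟨N, fun n hn f hf => conductor_le (hN n hn f hf)⟩

end Graded

end MvPolynomial

/-! ### Invariants and coinvariants when group elements are conjugate to their inverses. -/

section SelfDual

open scoped MonoidAlgebra

variable {K G V : Type*} [Field K] [Group G]

/-- The anti-involution `g ↦ g⁻¹` of a group algebra. -/
noncomputable def MonoidAlgebra.invHom (K G : Type*) [Field K] [Group G] :
    MonoidAlgebra K G →ₐ[K] (MonoidAlgebra K G)ᵐᵒᵖ :=
  MonoidAlgebra.lift K (MonoidAlgebra K G)ᵐᵒᵖ G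
    { toFun := fun g => MulOpposite.op (MonoidAlgebra.of K G g⁻¹)
      map_one' := by rw [inv_one, map_one]; rfl
      map_mul' := fun g h => by rw [← MulOpposite.op_mul, mul_inv_rev, map_mul] }

theorem MonoidAlgebra.invHom_of (g : G) :
    MonoidAlgebra.invHom K G (MonoidAlgebra.of K G g) =
      MulOpposite.op (MonoidAlgebra.of K G g⁻¹) := by
  simp [MonoidAlgebra.invHom]

variable [AddCommGroup V] [Module K V] [Module (MonoidAlgebra K G) V]
  [IsScalarTower K (MonoidAlgebra K G) V] 

/-- Burnside's theorem: by Schur's lemma the endomorphisms of `V` are scalars, and the density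
theorem applies to a finite spanning set. -/
theorem exists_smul_eq_of_isSimpleModule [IsAlgClosed K] {A : Type*} [Ring A] [Algebra K A]
    [Module A V] [IsScalarTower K A V] [IsSimpleModule A V] [FiniteDimensional K V]
    (f : V →ₗ[K] V) : ∃ a : A, ∀ v, f v = a • v := by
  classical
  have hb := (IsSimpleModule.algebraMap_end_bijective_of_isAlgClosed K (A := A) (V := V)).2
  let f' : Module.End (Module.End A V) V :=
    { toFun := f
      map_add' := f.map_add
      map_smul' := fun e v => by
        obtain ⟨c, rfl⟩ := hb e
        simp }
  obtain ⟨s, hs⟩ := Module.Finite.fg_top (R := K) (M := V)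
  obtain ⟨a, ha⟩ := jacobson_density f' s
  refine ⟨a, fun v => ?_⟩
  have hv : v ∈ Submodule.span K (s : Set V) := hs ▸ trivial
  induction hv using Submodule.span_induction with
  | mem x hx => exact ha x hx
  | zero => simp
  | add x y _ _ hx hy => rw [map_add, hx, hy, smul_add]
  | smul c x _ hx =>
    rw [map_smul, hx, smul_comm]

-- The character of `V` is invariant under `g ↦ g⁻¹`, and the trace form on the image of the group
-- algebra, which is all of `End V`, is nondegenerate. So the annihilator of `V` is stable under
-- inversion; this is the self-duality needed, without semisimplicity of the group algebra.
open MonoidAlgebra in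
theorem invHom_smul_eq_zero [IsAlgClosed K] [IsSimpleModule (MonoidAlgebra K G) V]
    [FiniteDimensional K V] (hG : ∀ g : G, IsConj g g⁻¹) (a : MonoidAlgebra K G)
    (ha : ∀ v : V, a • v = 0) (v : V) : (invHom K G a).unop • v = 0 := by
  classical
  let r : MonoidAlgebra K G →ₐ[K] Module.End K V := Algebra.lsmul K K V
  let i : MonoidAlgebra K G →ₗ[K] MonoidAlgebra K G :=
    (MulOpposite.opLinearEquiv K).symm.toLinearMap ∘ₗ (invHom K G).toLinearMap
  have hi : ∀ x, i x = (invHom K G x).unop := fun x => rfl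
  have hiof : ∀ g, i (of K G g) = of K G g⁻¹ := fun g => by rw [hi, invHom_of]; rfl
  have himul : ∀ x y, i (x * y) = i y * i x := fun x y => by simp only [hi, map_mul]; rfl
  have hii : ∀ x, i (i x) = x := by
    have : i ∘ₗ i = LinearMap.id := by
      refine MonoidAlgebra.lhom_ext' fun g => LinearMap.ext_ring ?_
      change i (i (of K G g)) = of K G g
      rw [hiof, hiof, inv_inv]
    exact fun x => LinearMap.congr_fun this x
  have htr : ∀ x, LinearMap.trace K V (r (i x)) = LinearMap.trace K V (r x) := by
    have : (LinearMap.trace K V ∘ₗ r.toLinearMap) ∘ₗ i = LinearMap.trace K V ∘ₗ r.toLinearMap := by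
      ext g
      change LinearMap.trace K V (r (i (of K G g))) = LinearMap.trace K V (r (of K G g))
      obtain ⟨c, hc⟩ := isConj_iff.mp (hG g)
      rw [hiof, ← hc, map_mul, map_mul, LinearMap.trace_mul_comm, ← map_mul, ← map_mul, ← mul_assoc,
        inv_mul_cancel, one_mul]
    exact fun x => LinearMap.congr_fun this x
  have hra : r a = 0 := LinearMap.ext ha
  have h0 : r (i a) = 0 := by
    by_contra hne
    obtain ⟨w, hw⟩ : ∃ w, r (i a) w ≠ 0 := by
      by_contra! h
      exact hne (LinearMap.ext h)
    obtain ⟨φ, hφ⟩ : ∃ φ : Module.Dual K V, φ (r (i a) w) ≠ 0 := by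
      by_contra! h
      exact hw ((Module.forall_dual_apply_eq_zero_iff K _).mp h)
    -- `b` acts as the rank-one map `x ↦ φ x • w`, so the trace of `i a * b` is `φ (i a • w)`.
    obtain ⟨b, hb⟩ := exists_smul_eq_of_isSimpleModule (A := MonoidAlgebra K G)
      (LinearMap.toSpanSingleton K V w ∘ₗ φ)
    have hrb : r b = LinearMap.toSpanSingleton K V w ∘ₗ φ := (LinearMap.ext hb).symm
    have h1 : LinearMap.trace K V (r (i a * b)) = 0 := by
      rw [← hii b, ← himul, htr, map_mul, hra, mul_zero, map_zero]
    rw [map_mul, LinearMap.trace_mul_comm, hrb] at h1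
    apply hφ
    rw [← h1, Module.End.mul_eq_comp, LinearMap.comp_assoc, LinearMap.trace_comp_comm']
    have : (φ ∘ₗ r (i a)) ∘ₗ LinearMap.toSpanSingleton K V w =
      φ (r (i a) w) • LinearMap.id := by ext; simp
    rw [this]
    simp
  exact LinearMap.congr_fun h0 v

open MonoidAlgebra in
/-- In a group all of whose elements are conjugate to their inverses, a simple module with nonzero
invariants under a subgroup has nonzero coinvariants. -/
theorem exists_invariant_functional [IsAlgClosed K] [Finite G]
    [IsSimpleModule (MonoidAlgebra K G) V] [FiniteDimensional K V]
    (hG : ∀ g : G, IsConj g g⁻¹) (H : Subgroup G) (z : V) (hz : z ≠ 0)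
    (hzH : ∀ h ∈ H, of K G h • z = z) :
    ∃ φ : V →ₗ[K] K, φ ≠ 0 ∧ ∀ h ∈ H, ∀ v, φ (of K G h • v) = φ v := by
  classical
  have := Fintype.ofFinite G
  let r : MonoidAlgebra K G →ₐ[K] Module.End K V := Algebra.lsmul K K V
  have hr : ∀ a v, r a v = a • v := fun _ _ => rfl
  -- The functionals that vanish on the range of `T` are exactly the `H`-invariant ones.
  let T : (H → V) →ₗ[K] V := ∑ h : H, (r (of K G h) - 1) ∘ₗ LinearMap.proj h
  by_cases htop : LinearMap.range T = ⊤
  · obtain ⟨s, hs⟩ := T.exists_rightInverse_of_surjective htop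
    choose b hb using fun h : H => exists_smul_eq_of_isSimpleModule (A := MonoidAlgebra K G)
      (LinearMap.proj h ∘ₗ s)
    -- If `T` were onto, the identity would act as `∑ (h - 1) b_h`. Inversion turns this into `∑
    -- i(b_h) (h⁻¹ - 1)`, which kills the invariant vector `z`.
    have h1 : ∀ v : V, ((∑ h : H, (of K G (h : G) - 1) * b h) - 1) • v = 0 := by
      intro v
      have := LinearMap.congr_fun hs v
      rw [sub_smul, one_smul, Finset.sum_smul, sub_eq_zero]
      conv_rhs => rw [← LinearMap.id_apply (R := K) v, ← this]
      simp only [T, LinearMap.comp_apply, LinearMap.sum_apply]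
      refine Finset.sum_congr rfl fun h _ => ?_
      rw [mul_smul, ← hb h]
      simp [hr, sub_smul]
    have h2 := invHom_smul_eq_zero hG _ h1 z
    rw [map_sub, map_one, map_sum, MulOpposite.unop_sub, MulOpposite.unop_one, sub_smul, one_smul,
      Finset.unop_sum, Finset.sum_smul, Finset.sum_eq_zero, zero_sub, neg_eq_zero] at h2
    · exact absurd h2 hz
    · intro h _
      rw [map_mul, MulOpposite.unop_mul, map_sub, map_one, invHom_of, MulOpposite.unop_sub,
        MulOpposite.unop_op, MulOpposite.unop_one, mul_smul, sub_smul, one_smul,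
        hzH _ (H.inv_mem h.2), sub_self, smul_zero]
  · obtain ⟨φ, hφ, hφ0⟩ := Submodule.exists_le_ker_of_lt_top _ (lt_top_iff_ne_top.mpr htop)
    refine ⟨φ, hφ, fun h hh v => ?_⟩
    have : φ (T (Pi.single ⟨h, hh⟩ v)) = 0 := hφ0 ⟨_, rfl⟩
    have hS : T (Pi.single ⟨h, hh⟩ v) = of K G h • v - v := by
      simp only [T, LinearMap.sum_apply, LinearMap.comp_apply, LinearMap.proj_apply]
      rw [Finset.sum_eq_single ⟨h, hh⟩]
      · simp [hr]
      · intro b _ hb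
        simp [Pi.single_eq_of_ne hb]
      · simp
    rw [hS, map_sub, sub_eq_zero] at this
    exact this

-- Pass to the simple quotient by a maximal submodule above `M`. Since the `e p` span, one of them
-- survives there, as a nonzero vector fixed by its stabilizer.
open MonoidAlgebra in
theorem exists_invariant_functional_of_ne_top [IsAlgClosed K] [Finite G] [FiniteDimensional K V]
    (hG : ∀ g : G, IsConj g g⁻¹) {P : Type*} (e : P → V) (he : Submodule.span K (Set.range e) = ⊤)
    (M : Submodule (MonoidAlgebra K G) V) (hM : M ≠ ⊤) :
    ∃ (p : P) (φ : V →ₗ[K] K), φ ≠ 0 ∧ (∀ t ∈ M, φ t = 0) ∧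
      ∀ g : G, of K G g • e p = e p → ∀ t, φ (of K G g • t) = φ t := by
  have hfin : Module.Finite (MonoidAlgebra K G) V :=
    Module.Finite.of_restrictScalars_finite K _ _
  obtain ⟨N, hN, hMN⟩ := (eq_top_or_exists_le_coatom M).resolve_left hM
  have hsimple : IsSimpleModule (MonoidAlgebra K G) (V ⧸ N) :=
    isSimpleModule_iff_isCoatom.mpr hN
  obtain ⟨p, hp⟩ : ∃ p, e p ∉ N := by
    by_contra! h
    apply hN.1
    have : Submodule.span K (Set.range e) ≤ N.restrictScalars K :=
      Submodule.span_le.mpr (by rintro _ ⟨p, rfl⟩; exact h p)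
    rw [he] at this
    exact eq_top_iff.mpr fun x _ => this trivial
  let H : Subgroup G :=
    { carrier := {g | of K G g • e p = e p}
      mul_mem' := fun {a b} ha hb => by
        change of K G (a * b) • e p = e p
        rw [map_mul, mul_smul, show of K G b • e p = e p from hb]
        exact ha
      one_mem' := by
        change of K G 1 • e p = e p
        rw [map_one, one_smul]
      inv_mem' := fun {a} ha => by
        change of K G a⁻¹ • e p = e p
        conv_lhs => rw [← show of K G a • e p = e p from ha]
        rw [← mul_smul, ← map_mul, inv_mul_cancel, map_one, one_smul] }
  have hfinK : FiniteDimensional K (V ⧸ N) :=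
    Module.Finite.of_surjective (N.mkQ.restrictScalars K) N.mkQ_surjective
  obtain ⟨φ, hφ, hφH⟩ := exists_invariant_functional (K := K) (V := V ⧸ N) hG H (N.mkQ (e p))
    (by rwa [Submodule.mkQ_apply, ne_eq, Submodule.Quotient.mk_eq_zero])
    (fun h hh => by rw [← map_smul, show of K G h • e p = e p from hh])
  refine ⟨p, φ ∘ₗ N.mkQ.restrictScalars K, ?_, ?_, ?_⟩
  · intro h0
    apply hφ
    ext x
    obtain ⟨y, rfl⟩ := N.mkQ_surjective x
    exact LinearMap.congr_fun h0 y
  · intro t ht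
    change φ (N.mkQ t) = 0
    rw [Submodule.mkQ_apply, (Submodule.Quotient.mk_eq_zero N).mpr (hMN ht), map_zero]
  · intro g hg t
    change φ (N.mkQ (_ • t)) = φ (N.mkQ t)
    rw [map_smul]
    exact hφH g hg _

end SelfDual

/-! ### Tensors as a representation of the symmetric group. -/

section Words

open scoped Matrix

variable {K : Type*} [Field K] {ι α : Type*}

/-- The representation of the symmetric group on tensors by permutation of the slots. -/
def permRep (K ι α : Type*) [Field K] : Representation K (Equiv.Perm ι) ((ι → α) → K) where
  toFun σ := LinearMap.funLeft K K fun r => r ∘ σ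
  map_one' := rfl
  map_mul' _ _ := rfl

theorem permRep_apply (σ : Equiv.Perm ι) (t : (ι → α) → K) (r : ι → α) :
    permRep K ι α σ t r = t (r ∘ σ) := rfl

theorem permRep_single [DecidableEq (ι → α)] (σ : Equiv.Perm ι) (p : ι → α) :
    permRep K ι α σ (Pi.single p 1) = Pi.single (p ∘ σ.symm) 1 := by
  ext r
  rw [permRep_apply, Pi.single_apply, Pi.single_apply]
  refine if_congr ?_ rfl rfl
  constructor
  · rintro rfl; ext i; simp
  · rintro rfl; ext i; simp

/-- A proper subspace of tensors which is stable under permutation of the slots is killed by a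
nonzero functional which is invariant under the stabilizer of a word. -/
theorem exists_functional_of_permRep_stable [IsAlgClosed K] [Finite ι] [Finite α]
    (L : Submodule K ((ι → α) → K)) (hL : ∀ σ, ∀ t ∈ L, permRep K ι α σ t ∈ L) (hne : L ≠ ⊤) :
    ∃ (p : ι → α) (φ : ((ι → α) → K) →ₗ[K] K), φ ≠ 0 ∧ (∀ t ∈ L, φ t = 0) ∧
      ∀ σ : Equiv.Perm ι, p ∘ σ = p → ∀ t, φ (permRep K ι α σ t) = φ t := by
  classical
  have := Fintype.ofFinite ι
  have := Fintype.ofFinite α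
  let ρ := permRep K ι α
  let e := ρ.asModuleEquiv
  have hsmul : ∀ σ x, MonoidAlgebra.of K (Equiv.Perm ι) σ • e.symm x = e.symm (ρ σ x) := fun σ x =>
    (ρ.asModuleEquiv_symm_map_rho σ x).symm
  let M : Submodule (MonoidAlgebra K (Equiv.Perm ι)) ρ.asModule :=
    { carrier := {x | e x ∈ L}
      add_mem' := fun {a b} ha hb => by
        change e (a + b) ∈ L
        rw [map_add]; exact L.add_mem ha hb
      zero_mem' := by change e 0 ∈ L; rw [map_zero]; exact L.zero_mem
      smul_mem' := fun a x hx => by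
        change e (a • x) ∈ L
        change e x ∈ L at hx
        rw [ρ.asModuleEquiv_map_smul]
        induction a using MonoidAlgebra.induction_on with
        | of g => rw [Representation.asAlgebraHom_of]; exact hL _ _ hx
        | add a b ha hb => rw [map_add]; exact L.add_mem ha hb
        | smul c a ha => rw [map_smul]; exact L.smul_mem _ ha }
  have hM : M ≠ ⊤ := by
    intro h
    apply hne
    rw [eq_top_iff]
    intro x _
    have : e.symm x ∈ M := h ▸ trivial
    exact this
  obtain ⟨p, φ, hφ, hφM, hφH⟩ := exists_invariant_functional_of_ne_top (V := ρ.asModule)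
    -- A permutation and its inverse have the same cycle type.
    (fun σ => Equiv.Perm.isConj_iff_cycleType_eq.mpr (Equiv.Perm.cycleType_inv σ).symm)
    (fun p : ι → α => e.symm (Pi.single p 1))
    (((Pi.basisFun K (ι → α)).map e.symm).span_eq ▸ by
      congr 1; ext; simp) M hM
  refine ⟨p, φ ∘ₗ e.symm.toLinearMap, ?_, ?_, ?_⟩
  · intro h0
    apply hφ
    ext x
    exact LinearMap.congr_fun h0 (e x)
  · exact fun t ht => hφM _ ht
  · intro σ hσ t
    change φ (e.symm (ρ σ t)) = φ (e.symm t)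
    rw [← hsmul]
    refine hφH σ ?_ _
    rw [hsmul]
    congr 1
    change permRep K ι α σ _ = _
    rw [permRep_single]
    have : p ∘ ⇑σ.symm = p := by
      conv_lhs => rw [← hσ]
      ext i; simp
    rw [this]

end Words

/-! ### Polarization: from tensors to polynomials in several vectors. -/

section Words

open MvPolynomial

variable {K : Type*} [Field K] {ι α β : Type*}

/-- Two families with the same multiset of values differ by a permutation of the indices. -/
theorem exists_perm_comp_eq_of_sum_single_eq [Fintype ι] {u v : ι → β}
    (h : ∑ s, Finsupp.single (u s) 1 = ∑ s, (Finsupp.single (v s) 1 : β →₀ ℕ)) :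
    ∃ σ : Equiv.Perm ι, u ∘ σ = v := by
  classical
  have hcard : ∀ b, Fintype.card {s // v s = b} = Fintype.card {s // u s = b} := by
    intro b
    have := DFunLike.congr_fun h b
    simp only [Finsupp.coe_finsetSum, Finset.sum_apply, Finsupp.single_apply, Finset.sum_boole,
      Nat.cast_id] at this
    rw [Fintype.card_subtype, Fintype.card_subtype, this]
  let e : ∀ b, {s // v s = b} ≃ {s // u s = b} := fun b => Fintype.equivOfCardEq (hcard b)
  let σ : ι ≃ ι := (Equiv.sigmaFiberEquiv v).symm.trans
    ((Equiv.sigmaCongrRight e).trans (Equiv.sigmaFiberEquiv u))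
  refine ⟨σ, ?_⟩
  ext s
  exact (e (v s) ⟨s, rfl⟩).2

/-- The map from tensors to polynomials which substitutes for the `s`-th slot the vector of
variables with index `f s`. -/
noncomputable def wordMap [Fintype ι] [Fintype α] [DecidableEq ι] (f : ι → β) :
    ((ι → α) → K) →ₗ[K] MvPolynomial (β × α) K :=
  ∑ r : ι → α, (LinearMap.toSpanSingleton K _ (∏ s, X (f s, r s))) ∘ₗ LinearMap.proj r

theorem wordMap_apply [Fintype ι] [Fintype α] [DecidableEq ι] (f : ι → β) (t : (ι → α) → K) :
    wordMap f t = ∑ r : ι → α, t r • ∏ s, X (f s, r s) := by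
  simp [wordMap]

/-- A functional that is invariant under the stabilizer of `p` agrees on basis tensors `r`, `r'`
giving the same monomial `∏ X (p s, r s)`, so it factors through `wordMap p`. If it kills `L` and
`wordMap p` maps `L` onto all such monomials, it is zero. -/
theorem eq_top_of_wordMap [IsAlgClosed K] [Fintype ι] [Fintype α] [DecidableEq ι]
    (L : Submodule K ((ι → α) → K)) (hL : ∀ σ, ∀ t ∈ L, permRep K ι α σ t ∈ L)
    (h : ∀ f : ι → α, ∀ r : ι → α, ∃ t ∈ L, wordMap f t = ∏ s, X (f s, r s)) : L = ⊤ := by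
  classical
  by_contra hne
  obtain ⟨p, φ, hφ, hφL, hφp⟩ := exists_functional_of_permRep_stable L hL hne
  have hsum : ∀ t, φ t = ∑ r, t r • φ (Pi.single r 1) := fun t => by
    conv_lhs => rw [pi_eq_sum_univ' t, map_sum]
    simp
  let d : (ι → α) → (α × α →₀ ℕ) := fun r => ∑ s, Finsupp.single (p s, r s) 1
  have hmon : ∀ r : ι → α, (∏ s, X (p s, r s) : MvPolynomial (α × α) K) = monomial (d r) 1 := by
    intro r
    simp only [d, X, monomial_sum_one]
  have hinv : ∀ r r', d r = d r' → φ (Pi.single r 1) = φ (Pi.single r' 1) := by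
    intro r r' hd
    obtain ⟨σ, hσ⟩ := exists_perm_comp_eq_of_sum_single_eq
      (u := fun s => (p s, r s)) (v := fun s => (p s, r' s)) hd
    have h1 : p ∘ σ = p := funext fun s => congrArg Prod.fst (congrFun hσ s)
    have h2 : r ∘ σ = r' := funext fun s => congrArg Prod.snd (congrFun hσ s)
    rw [← h2]
    have := hφp σ h1 (Pi.single (r ∘ σ) 1)
    rw [permRep_single] at this
    rw [← this]
    congr 3
    ext i; simp
  -- Monomials of another multidegree do not occur in `wordMap p`; the value `0` there is arbitrary.
  let g : (α × α →₀ ℕ) → K := fun e => if h : ∃ r, d r = e then φ (Pi.single h.choose 1) else 0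
  have hg : ∀ r, g (d r) = φ (Pi.single r 1) := fun r => by
    have hex : ∃ r', d r' = d r := ⟨r, rfl⟩
    simp only [g]
    rw [dif_pos hex]
    exact hinv _ _ hex.choose_spec
  let Λ : MvPolynomial (α × α) K →ₗ[K] K := (basisMonomials (α × α) K).constr K g
  have hΛ : ∀ r : ι → α, Λ (∏ s, X (p s, r s)) = φ (Pi.single r 1) := by
    intro r
    rw [hmon, ← hg]
    exact Module.Basis.constr_basis (basisMonomials (α × α) K) K g (d r)
  have hfac : ∀ t, Λ (wordMap p t) = φ t := by
    intro t
    rw [wordMap_apply, map_sum, hsum]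
    refine Finset.sum_congr rfl fun r _ => ?_
    rw [map_smul, hΛ]
  apply hφ
  refine LinearMap.ext fun t => ?_
  rw [hsum, LinearMap.zero_apply]
  refine Finset.sum_eq_zero fun r _ => ?_
  obtain ⟨t', ht', htr⟩ := h p r
  rw [← hΛ, ← htr, hfac, hφL t' ht', smul_zero]

end Words

/-! ### Word tensors and their span. -/

section TraceWords

open MvPolynomial

variable {K : Type*} [Field K] {α β : Type*} [Fintype α] 

/-- The invariant tensor attached to a permutation `π` and a choice of letters: the tensor of the
products of the traces of the words in the letters along the cycles of `π`. -/
def wordTensor {R ι : Type*} [CommRing R] [Fintype ι] [DecidableEq ι] (P : Bool → α → Matrix α α R)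
    (π : Equiv.Perm ι) (b : ι → Bool) (p : ι → α) : R :=
  ∑ a : ι → α, ∏ s, P (b s) (p s) (a s) (a (π.symm s))

/-- The span of the word tensors. -/
def wordSpan (P : Bool → α → Matrix α α K) (k : ℕ) : Submodule K ((Fin k → α) → K) :=
  Submodule.span K (Set.range fun πb : Equiv.Perm (Fin k) × (Fin k → Bool) =>
    wordTensor P πb.1 πb.2)

/-- Relabelling the slots conjugates the permutation and transports the letters; this makes
`wordSpan` stable under the symmetric group. -/
theorem permRep_wordTensor {ι : Type*} [Fintype ι] [DecidableEq ι] (P : Bool → α → Matrix α α K)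
    (σ π : Equiv.Perm ι) (b : ι → Bool) :
    permRep K ι α σ (wordTensor P π b) = wordTensor P (σ * π * σ⁻¹) (b ∘ σ.symm) := by
  ext r
  rw [permRep_apply, wordTensor, wordTensor]
  refine Fintype.sum_equiv (σ.arrowCongr (Equiv.refl α)) _ _ fun a => ?_
  refine Fintype.prod_equiv σ _ _ fun s => ?_
  simp [Equiv.Perm.mul_def, Equiv.Perm.inv_def]

theorem permRep_mem_wordSpan (P : Bool → α → Matrix α α K) {k : ℕ} (σ : Equiv.Perm (Fin k))
    {t : (Fin k → α) → K} (ht : t ∈ wordSpan P k) : permRep K (Fin k) α σ t ∈ wordSpan P k := by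
  have : wordSpan P k ≤ (wordSpan P k).comap (permRep K (Fin k) α σ) := by
    conv_lhs => rw [wordSpan]
    rw [Submodule.span_le]
    rintro _ ⟨⟨π, b⟩, rfl⟩
    change permRep K (Fin k) α σ (wordTensor P π b) ∈ wordSpan P k
    rw [permRep_wordTensor]
    exact Submodule.subset_span ⟨(_, _), rfl⟩
  exact this ht

/-- Words in linear combinations of letters are linear combinations of words. -/
theorem wordTensor_linearCombination {ι : Type*} [Fintype ι] [DecidableEq ι]
    (P P' : Bool → α → Matrix α α K) (c : Bool → Bool → K)
    (h : ∀ b p, P' b p = ∑ b', c b b' • P b' p) (π : Equiv.Perm ι) (b : ι → Bool) :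
    wordTensor P' π b = ∑ b' : ι → Bool, (∏ s, c (b s) (b' s)) • wordTensor P π b' := by
  ext p
  simp only [Finset.sum_apply, Pi.smul_apply, wordTensor, h, Matrix.sum_apply, Matrix.smul_apply,
    smul_eq_mul, Finset.prod_univ_sum, Fintype.piFinset_univ, Finset.mul_sum]
  rw [Finset.sum_comm]
  refine Finset.sum_congr rfl fun b' _ => Finset.sum_congr rfl fun a _ => ?_
  rw [← Finset.prod_mul_distrib]

theorem wordSpan_le (P P' : Bool → α → Matrix α α K) (c : Bool → Bool → K)
    (h : ∀ b p, P' b p = ∑ b', c b b' • P b' p) (k : ℕ) : wordSpan P' k ≤ wordSpan P k := by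
  rw [wordSpan, Submodule.span_le]
  rintro _ ⟨⟨π, b⟩, rfl⟩
  change wordTensor P' π b ∈ wordSpan P k
  rw [wordTensor_linearCombination P P' c h]
  exact Submodule.sum_mem _ fun b' _ => Submodule.smul_mem _ _ (Submodule.subset_span ⟨(_, _), rfl⟩)

/-- The square matrix of the coefficients of chosen word tensors. -/
def wordMatrix {R : Type*} [CommRing R] [DecidableEq α] (P : Bool → α → Matrix α α R) {k : ℕ}
    (ρ : (Fin k → α) → Equiv.Perm (Fin k) × (Fin k → Bool)) :
    Matrix (Fin k → α) (Fin k → α) R :=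
  Matrix.of fun r => wordTensor P (ρ r).1 (ρ r).2

/-- Links two viewpoints: the determinant depends polynomially on the letters, while the span is
insensitive to invertible linear changes of letters. -/
theorem wordSpan_eq_top_iff [DecidableEq α] (P : Bool → α → Matrix α α K) (k : ℕ) :
    wordSpan P k = ⊤ ↔ ∃ ρ, (wordMatrix P ρ : Matrix (Fin k → α) (Fin k → α) K).det ≠ 0 := by
  constructor
  · intro h
    obtain ⟨κ, a, ha, hspan, hli⟩ := exists_linearIndependent' K
      fun πb : Equiv.Perm (Fin k) × (Fin k → Bool) => wordTensor P πb.1 πb.2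
    rw [show Submodule.span K (Set.range fun πb : Equiv.Perm (Fin k) × (Fin k → Bool) =>
      wordTensor P πb.1 πb.2) = ⊤ from h] at hspan
    let B := Module.Basis.mk hli hspan.ge
    let e := B.indexEquiv (Pi.basisFun K (Fin k → α))
    refine ⟨a ∘ e.symm, ?_⟩
    rw [← isUnit_iff_ne_zero, ← Matrix.isUnit_iff_isUnit_det,
      ← Matrix.linearIndependent_rows_iff_isUnit]
    exact hli.comp _ e.symm.injective
  · rintro ⟨ρ, hρ⟩
    rw [← isUnit_iff_ne_zero, ← Matrix.isUnit_iff_isUnit_det,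
      ← Matrix.linearIndependent_rows_iff_isUnit] at hρ
    have := hρ.span_eq_top_of_card_eq_finrank' (by simp)
    rw [eq_top_iff, ← this, wordSpan]
    refine Submodule.span_mono ?_
    rintro _ ⟨r, rfl⟩
    exact ⟨ρ r, rfl⟩

/-- The polynomials obtained by substituting vectors of variables in the word tensors. -/
noncomputable def traceModule (P : Bool → α → Matrix α α K) (β : Type*) :
    Submodule K (MvPolynomial (β × α) K) :=
  Submodule.span K {g | ∃ (k : ℕ) (π : Equiv.Perm (Fin k)) (b : Fin k → Bool) (f : Fin k → β),
    g = wordMap f (wordTensor P π b)}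

theorem wordMap_comp_perm {ι : Type*} [Fintype ι] [DecidableEq ι] (f : ι → β) (σ : Equiv.Perm ι)
    (t : (ι → α) → K) : wordMap (f ∘ σ) t = wordMap f (permRep K ι α σ t) := by
  rw [wordMap_apply, wordMap_apply]
  refine Fintype.sum_equiv (σ.arrowCongr (Equiv.refl α)) _ _ fun r => ?_
  rw [permRep_apply]
  congr 1
  · congr 1
    ext i; simp
  · refine Fintype.prod_equiv σ _ _ fun s => ?_
    simp

theorem isWeightedHomogeneous_wordMap {ι : Type*} [Fintype ι] [DecidableEq ι] (f : ι → β)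
    (t : (ι → α) → K) :
    IsWeightedHomogeneous (fun x : β × α => (Finsupp.single x.1 1 : β →₀ ℕ)) (wordMap f t)
      (∑ s, Finsupp.single (f s) 1) := by
  rw [wordMap_apply]
  refine IsWeightedHomogeneous.sum _ _ _ fun r _ => ?_
  rw [smul_eq_C_mul]
  rw [← zero_add (∑ s, Finsupp.single (f s) 1)]
  refine (isWeightedHomogeneous_C _ _).mul ?_
  refine IsWeightedHomogeneous.prod _ _ _ fun s _ => ?_
  exact isWeightedHomogeneous_X K (fun x : β × α => (Finsupp.single x.1 1 : β →₀ ℕ)) (f s, r s)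

/-- In the grading that counts how often each vector occurs, only words whose index family is a
rearrangement of `f` contribute to this component, and the rearrangement is absorbed by the
stability of `wordSpan`. -/
theorem weightedHomogeneousComponent_mem_map_wordMap [DecidableEq β] (P : Bool → α → Matrix α α K)
    {g : MvPolynomial (β × α) K} (hg : g ∈ traceModule P β) {k : ℕ} (f : Fin k → β) :
    weightedHomogeneousComponent (fun x : β × α => (Finsupp.single x.1 1 : β →₀ ℕ))
      (∑ s, Finsupp.single (f s) 1) g ∈ (wordSpan P k).map (wordMap f) := by
  induction hg using Submodule.span_induction with
  | zero => simp
  | add x y _ _ hx hy => rw [map_add]; exact add_mem hx hy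
  | smul c x _ hx => rw [map_smul]; exact Submodule.smul_mem _ _ hx
  | mem x hx =>
    obtain ⟨k', π, b, f', rfl⟩ := hx
    by_cases heq : ∑ s, Finsupp.single (f' s) 1 = ∑ s, (Finsupp.single (f s) 1 : β →₀ ℕ)
    · have hk : k' = k := by
        have := congrArg Finsupp.degree heq
        simpa using this
      subst hk
      obtain ⟨σ, rfl⟩ := exists_perm_comp_eq_of_sum_single_eq heq.symm
      rw [← heq, (isWeightedHomogeneous_wordMap _ _).weightedHomogeneousComponent_same,
        wordMap_comp_perm]
      exact Submodule.mem_map_of_mem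
        (permRep_mem_wordSpan P σ (Submodule.subset_span ⟨(π, b), rfl⟩))
    · rw [(isWeightedHomogeneous_wordMap _ _).weightedHomogeneousComponent_ne _ (Ne.symm heq)]
      exact zero_mem _

/-- If all homogeneous polynomials of degree `k` are combinations of traces of words, then the word
tensors span the space of tensors. -/
theorem wordSpan_eq_top_of_traceModule [IsAlgClosed K] [DecidableEq α] (P : Bool → α → Matrix α α K)
    {k : ℕ} (h : ∀ g : MvPolynomial (α × α) K, g.IsHomogeneous k → g ∈ traceModule P α) :
    wordSpan P k = ⊤ := by
  refine eq_top_of_wordMap _ (fun σ t ht => permRep_mem_wordSpan P σ ht) fun f r => ?_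
  have hmem : (∏ s, X (f s, r s) : MvPolynomial (α × α) K) ∈ traceModule P α := by
    refine h _ ?_
    have := IsHomogeneous.prod Finset.univ (fun s => (X (f s, r s) : MvPolynomial (α × α) K))
      (fun _ => 1) fun s _ => isHomogeneous_X K _
    simpa using this
  have hw : IsWeightedHomogeneous (fun x : α × α => (Finsupp.single x.1 1 : α →₀ ℕ))
      (∏ s, X (f s, r s) : MvPolynomial (α × α) K) (∑ s, Finsupp.single (f s) 1) :=
    IsWeightedHomogeneous.prod _ _ _ fun s _ =>
      isWeightedHomogeneous_X K (fun x : α × α => (Finsupp.single x.1 1 : α →₀ ℕ)) (f s, r s)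
  have := weightedHomogeneousComponent_mem_map_wordMap P hmem f
  rw [hw.weightedHomogeneousComponent_same] at this
  exact this

end TraceWords

namespace StructureConstants

open MvPolynomial

/-! ### Contractions that are word tensors. -/

section Contractions

variable {m : ℕ}

/-- The contraction which leaves free the lower slot `b s` of the factor `s` and contracts the other
one with the upper index of the factor `π⁻¹ s`. -/
def contractionOfPerm {k : ℕ} (π : Equiv.Perm (Fin k)) (b : Fin k → Bool) : Contraction k where
  slot :=
    { toFun := Sum.elim (fun s => (π s, if b (π s) then 1 else 0)) (fun s => (s, if b s then 0 else 1))
      invFun := fun x => if x.2 = (if b x.1 then 0 else 1) then Sum.inr x.1 else Sum.inl (π.symm x.1)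
      left_inv := by
        rintro (s | s)
        · cases h : b (π s) <;> simp [h]
        · cases h : b s <;> simp [h]
      right_inv := by
        rintro ⟨s, j⟩
        cases h : b s <;> fin_cases j <;> simp [h] }
  free_strictMono := by
    intro s t hst
    simpa [Prod.Lex.toLex_lt_toLex] using Or.inl hst

/-- The left and right multiplication letters of an algebra. -/
def multiplicationLetters {K : Type*} (A : Space m K) : Bool → Fin m → Matrix (Fin m) (Fin m) K
  | false, p => Matrix.of fun i j => A i (j, p)
  | true, p => Matrix.of fun i j => A i (p, j)

theorem contract_contractionOfPerm {K : Type*} [Field K] (A : Space m K) {k : ℕ}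
    (π : Equiv.Perm (Fin k)) (b : Fin k → Bool) :
    contract (contractionOfPerm π b) A = wordTensor (multiplicationLetters A) π b := by
  ext p
  refine Finset.sum_congr rfl fun a _ => ?_
  rw [tensorPower, Matrix.of_apply]
  refine Finset.prod_congr rfl fun s _ => ?_
  cases h : b s <;> simp [contractionOfPerm, multiplicationLetters, h]

theorem Q_contractionOfPerm {K : Type*} [Field K] (A : Space m K) {k : ℕ}
    (ρ : (Fin k → Fin m) → Equiv.Perm (Fin k) × (Fin k → Bool)) :
    Q (fun r => contractionOfPerm (ρ r).1 (ρ r).2) A = wordMatrix (multiplicationLetters A) ρ := by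
  ext r p
  exact congrFun (contract_contractionOfPerm A _ _) p

/-- The polynomial in the structure constants given by the determinant of `Q`. -/
noncomputable def detQPolynomial (F : Type*) [Field F] {k : ℕ}
    (ρ : (Fin k → Fin m) → Contraction k) : MvPolynomial (Fin m × Fin m × Fin m) F :=
  (Matrix.of fun r p => ∑ a : Fin k → Fin m, ∏ s,
    X (a s, Sum.elim a p ((ρ r).slot.symm (s, 0)), Sum.elim a p ((ρ r).slot.symm (s, 1)))).det

theorem aeval_detQPolynomial {F K : Type*} [Field F] [Field K] [Algebra F K] {k : ℕ}
    (ρ : (Fin k → Fin m) → Contraction k) (A : Space m K) :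
    aeval (fun x => A x.1 x.2) (detQPolynomial F ρ) = (Q ρ A).det := by
  rw [detQPolynomial, AlgHom.map_det]
  congr 1
  ext r p
  simp [Q, contract, tensorPower]

/-- Generic nonsingularity of `Q` can be checked over an extension field. -/
theorem exists_det_Q_ne_zero_of_extension {F K : Type*} [Field F] [Infinite F] [Field K]
    [Algebra F K] {k : ℕ} (ρ : (Fin k → Fin m) → Contraction k)
    (h : ∃ A : Space m K, (Q ρ A).det ≠ 0) : ∃ A : Space m F, (Q ρ A).det ≠ 0 := by
  obtain ⟨A, hA⟩ := h
  by_contra! h0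
  apply hA
  -- `det Q` is the same polynomial with coefficients in `F` over both fields; vanishing at all
  -- `F`-points makes it zero, as `F` is infinite.
  have : detQPolynomial F ρ = 0 := by
    refine MvPolynomial.funext fun x => ?_
    have := h0 (Matrix.of fun i jk => x (i, jk))
    rw [← aeval_detQPolynomial (F := F), aeval_eq_eval] at this
    simpa using this
  rw [← aeval_detQPolynomial (F := F), this, map_zero]

end Contractions

/-! ### The deformed algebra and its limiting letters. -/

section Pencil

variable {m : ℕ} {K : Type*} [Field K]

/-- The letters `diag x` and `diag x * E - diag (E x)`. -/
def pencilLetters {R : Type*} [CommRing R] (E : Matrix (Fin m) (Fin m) R) :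
    Bool → Fin m → Matrix (Fin m) (Fin m) R
  | false, p => Matrix.diagonal (Pi.single p 1)
  | true, p => Matrix.diagonal (Pi.single p 1) * E - Matrix.diagonal (E.mulVec (Pi.single p 1))

/-- The algebra with product `x * y = x ∘ ((1 + δ E) y)`. -/
def deformedAlgebra (E : Matrix (Fin m) (Fin m) K) (δ : K) : Space m K :=
  Matrix.of fun i jk => if i = jk.1 then (1 + δ • E) i jk.2 else 0

/-- The letters of the deformed algebra, with the second letter rescaled. -/
def deformedLetters {R : Type*} [CommRing R] (δ : R) (E : Matrix (Fin m) (Fin m) R) :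
    Bool → Fin m → Matrix (Fin m) (Fin m) R
  | false, p => pencilLetters E false p + δ • Matrix.diagonal (E.mulVec (Pi.single p 1))
  | true, p => pencilLetters E true p

theorem deformedLetters_map {R S : Type*} [CommRing R] [CommRing S] (φ : R →+* S) (δ : R)
    (E : Matrix (Fin m) (Fin m) R) (b : Bool) (p i j : Fin m) :
    φ (deformedLetters δ E b p i j) = deformedLetters (φ δ) (E.map φ) b p i j := by
  have h1 : ∀ i : Fin m, φ ((Pi.single p 1 : Fin m → R) i) = (Pi.single p 1 : Fin m → S) i :=
    fun i => by by_cases h : i = p <;> simp [h]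
  cases b
  · by_cases h : i = j <;> simp [deformedLetters, pencilLetters, h, h1]
  · by_cases h : i = j <;>
      simp [deformedLetters, pencilLetters, h, h1]

/-- In the deformed algebra, right multiplication by `e_p` is the first deformed letter, and left
minus right multiplication is `δ` times the second. For `δ ≠ 0` the two pairs of letters have the
same span, and at `δ = 0` the deformed letters are the pencil letters. The determinant is a
polynomial in `δ` that is nonzero at `0`, hence at some nonzero `δ`. -/
theorem exists_contractions_of_wordSpan_pencilLetters [Infinite K] (E : Matrix (Fin m) (Fin m) K)
    {k : ℕ} (h : wordSpan (pencilLetters E) k = ⊤) :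
    ∃ (ρ : (Fin k → Fin m) → Contraction k) (A : Space m K), (Q ρ A).det ≠ 0 := by
  obtain ⟨ρ, hρ⟩ := (wordSpan_eq_top_iff _ _).mp h
  let g : Polynomial K := (wordMatrix (deformedLetters Polynomial.X (E.map Polynomial.C)) ρ).det
  have hg : ∀ δ, g.eval δ = (wordMatrix (deformedLetters δ E) ρ).det := by
    intro δ
    rw [← Polynomial.coe_evalRingHom, RingHom.map_det]
    congr 1
    ext r p
    simp only [wordMatrix, wordTensor, RingHom.mapMatrix_apply, Matrix.map_apply, Matrix.of_apply,
      map_sum, map_prod, deformedLetters_map]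
    simp [Function.comp_def]
  have hL0 : deformedLetters 0 E = pencilLetters E := by
    funext b p
    cases b <;> simp [deformedLetters]
  have hg0 : g ≠ 0 := by
    intro h0
    apply hρ
    rw [← hL0, ← hg, h0, Polynomial.eval_zero]
  -- The factor `X` excludes `δ = 0`, where the change of letters degenerates.
  obtain ⟨δ, hδ⟩ : ∃ δ, (Polynomial.X * g).eval δ ≠ 0 := by
    by_contra! hz
    have := Polynomial.funext (p := Polynomial.X * g) (q := 0) (by simpa using hz)
    exact mul_ne_zero Polynomial.X_ne_zero hg0 this
  rw [Polynomial.eval_mul, Polynomial.eval_X] at hδ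
  have hδ0 : δ ≠ 0 := left_ne_zero_of_mul hδ
  have htop := (wordSpan_eq_top_iff (deformedLetters δ E) k).mpr ⟨ρ, hg δ ▸ right_ne_zero_of_mul hδ⟩
  have hle := wordSpan_le (multiplicationLetters (deformedAlgebra E δ)) (deformedLetters δ E)
    (fun b b' => if b then (if b' then δ⁻¹ else -δ⁻¹) else (if b' then 0 else 1)) (by
      intro b p
      have h1 : multiplicationLetters (deformedAlgebra E δ) false p =
          pencilLetters E false p + δ • Matrix.diagonal (E.mulVec (Pi.single p 1)) := by
        ext i j
        by_cases h : i = j <;> simp [multiplicationLetters, deformedAlgebra, pencilLetters, h,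
          Matrix.one_apply, Pi.single_apply]
      have h2 : multiplicationLetters (deformedAlgebra E δ) true p =
          pencilLetters E false p + δ • (Matrix.diagonal (Pi.single p 1) * E) := by
        ext i j
        by_cases h : i = p <;> simp [multiplicationLetters, deformedAlgebra, pencilLetters, h,
          Matrix.diagonal_apply, Matrix.one_apply, Matrix.diagonal_mul]
      rw [Fintype.sum_bool, h1, h2]
      cases b
      · simp [deformedLetters]
      · ext i j
        simp [deformedLetters, pencilLetters]
        field_simp
        ring) k
  rw [htop, top_le_iff, wordSpan_eq_top_iff] at hle
  obtain ⟨ρ', hρ'⟩ := hle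
  exact ⟨_, deformedAlgebra E δ, by rw [Q_contractionOfPerm]; exact hρ'⟩

end Pencil

end StructureConstants

/-! ### The algebra of trace polynomials. -/

section TraceAlgebra

open MvPolynomial

variable {K : Type*} [Field K] {α β : Type*} [Fintype α] [DecidableEq α]

theorem list_ofFn_prod_apply {R : Type*} [CommRing R] {n : ℕ} (M : Fin n → Matrix α α R) (i j : α) :
    (List.ofFn M).prod i j = ∑ c : Fin (n + 1) → α,
      if c 0 = i ∧ c (Fin.last n) = j then ∏ s : Fin n, M s (c s.castSucc) (c s.succ) else 0 := by
  induction n generalizing i with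
  | zero =>
    simp only [List.ofFn_zero, List.prod_nil, Finset.univ_eq_empty, Finset.prod_empty]
    have hsum : (∑ c : Fin 1 → α, if c 0 = i ∧ c (Fin.last 0) = j then (1 : R) else 0) =
        ∑ x : α, if x = i ∧ x = j then (1 : R) else 0 :=
      Fintype.sum_equiv (Equiv.funUnique (Fin 1) α) _ _ fun c => rfl
    rw [hsum]
    by_cases h : i = j
    · subst h; simp
    · rw [Matrix.one_apply_ne h, Finset.sum_eq_zero]
      intro x _
      rw [if_neg]
      rintro ⟨rfl, rfl⟩
      exact h rfl
  | succ n ih =>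
    rw [List.ofFn_succ, List.prod_cons, Matrix.mul_apply]
    simp only [ih]
    symm
    rw [← (Fin.consEquiv fun _ => α).sum_comp, Fintype.sum_prod_type]
    rw [Finset.sum_eq_single i]
    · simp only [Finset.mul_sum]
      rw [Finset.sum_comm]
      refine Finset.sum_congr rfl fun c _ => ?_
      rw [Finset.sum_eq_single (c 0)]
      · simp [Fin.consEquiv, ← Fin.succ_last,
          Fin.prod_univ_succ]
      · intro x _ hx
        rw [if_neg fun h => hx h.1.symm, mul_zero]
      · simp
    · intro x _ hx
      refine Finset.sum_eq_zero fun c _ => ?_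
      rw [if_neg]
      simp [Fin.consEquiv, hx]
    · simp

theorem trace_list_ofFn_prod {R : Type*} [CommRing R] {n : ℕ}
    (M : Fin (n + 1) → Matrix α α R) :
    ((List.ofFn M).prod).trace = ∑ a : Fin (n + 1) → α, ∏ s, M s (a s) (a (finRotate _ s)) := by
  simp only [Matrix.trace, Matrix.diag, list_ofFn_prod_apply]
  rw [Finset.sum_comm, ← (Fin.snocEquiv fun _ => α).sum_comp, Fintype.sum_prod_type, Finset.sum_comm]
  refine Finset.sum_congr rfl fun a _ => ?_
  rw [Finset.sum_eq_single (a 0)]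
  · rw [Finset.sum_eq_single (a 0)]
    · rw [if_pos (by constructor <;> simp [Fin.snocEquiv])]
      refine Finset.prod_congr rfl fun s _ => ?_
      simp only [Fin.snocEquiv, Equiv.coe_fn_mk, Fin.snoc_castSucc]
      congr 1
      refine Fin.lastCases ?_ (fun s => ?_) s
      · rw [Fin.succ_last, Fin.snoc_last, finRotate_last]
      · rw [Fin.succ_castSucc, Fin.snoc_castSucc, finRotate_of_lt (by simp)]
        congr 1
    · intro i _ hi
      rw [if_neg]
      rintro ⟨h, -⟩
      apply hi
      rw [← h]
      simp [Fin.snocEquiv]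
    · simp
  · intro x _ hx
    refine Finset.sum_eq_zero fun i _ => ?_
    rw [if_neg]
    rintro ⟨h1, h2⟩
    apply hx
    simp only [Fin.snocEquiv, Equiv.coe_fn_mk, Fin.snoc_last] at h2
    rw [h2, ← h1]
    simp [Fin.snocEquiv]
  · simp

/-- The generic element `∑ x_p P_p` of the span of the letters `P_p`. -/
def letter {R : Type*} [CommRing R] [Algebra K R] (P : Bool → α → Matrix α α K) (b : Bool)
    (x : α → R) : Matrix α α R :=
  ∑ p, x p • (P b p).map (algebraMap K R)

omit [DecidableEq α] in
theorem letter_apply {R : Type*} [CommRing R] [Algebra K R] (P : Bool → α → Matrix α α K) (b : Bool)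
    (x : α → R) (i j : α) : letter P b x i j = ∑ p, x p * algebraMap K R (P b p i j) := by
  simp [letter, Matrix.sum_apply]

theorem map_letter {R S : Type*} [CommRing R] [Algebra K R] [CommRing S] [Algebra K S]
    (φ : R →ₐ[K] S) (P : Bool → α → Matrix α α K) (b : Bool) (x : α → R) :
    φ.mapMatrix (letter P b x) = letter P b (φ ∘ x) := by
  ext i j
  simp [letter_apply]

omit [DecidableEq α] in
theorem wordMap_wordTensor {ι : Type*} [Fintype ι] [DecidableEq ι] (P : Bool → α → Matrix α α K)
    (π : Equiv.Perm ι) (b : ι → Bool) (f : ι → β) :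
    wordMap f (wordTensor P π b) =
      ∑ a : ι → α, ∏ s, letter P (b s) (fun p => (X (f s, p) : MvPolynomial (β × α) K))
        (a s) (a (π.symm s)) := by
  simp only [wordMap_apply, wordTensor, letter_apply, Finset.sum_smul, Finset.prod_univ_sum,
    Fintype.piFinset_univ]
  rw [Finset.sum_comm]
  refine Finset.sum_congr rfl fun a _ => Finset.sum_congr rfl fun r _ => ?_
  rw [Finset.prod_mul_distrib, smul_eq_C_mul, map_prod, mul_comm]
  rfl

omit [DecidableEq α] in
theorem wordMap_wordTensor_mem {ι : Type*} [Fintype ι] [DecidableEq ι]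
    (P : Bool → α → Matrix α α K) (π : Equiv.Perm ι) (b : ι → Bool) (f : ι → β) :
    wordMap f (wordTensor P π b) ∈ traceModule P β := by
  let e := Fintype.equivFin ι
  refine Submodule.subset_span ⟨Fintype.card ι, (e.symm.trans π).trans e, b ∘ e.symm, f ∘ e.symm, ?_⟩
  rw [wordMap_wordTensor, wordMap_wordTensor]
  refine Fintype.sum_equiv (e.arrowCongr (Equiv.refl α)) _ _ fun a => ?_
  refine Fintype.prod_equiv e _ _ fun s => ?_
  simp

/-- The algebra spanned by the traces of words. -/
noncomputable def traceAlgebra (P : Bool → α → Matrix α α K) (β : Type*) :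
    Subalgebra K (MvPolynomial (β × α) K) :=
  (traceModule P β).toSubalgebra
    (by
      have := wordMap_wordTensor_mem (ι := Fin 0) P 1 finZeroElim (finZeroElim : Fin 0 → β)
      rw [wordMap_wordTensor] at this
      simpa using this)
    (by
      intro x y hx hy
      induction hx, hy using Submodule.span_induction₂ with
      | zero_left => rw [zero_mul]; exact zero_mem _
      | zero_right => rw [mul_zero]; exact zero_mem _
      | add_left x y z _ _ _ h1 h2 => rw [add_mul]; exact add_mem h1 h2
      | add_right x y z _ _ _ h1 h2 => rw [mul_add]; exact add_mem h1 h2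
      | smul_left c x y _ _ h => rw [smul_mul_assoc]; exact Submodule.smul_mem _ _ h
      | smul_right c x y _ _ h => rw [mul_smul_comm]; exact Submodule.smul_mem _ _ h
      | mem_mem x y hx hy =>
        obtain ⟨k, π, b, f, rfl⟩ := hx
        obtain ⟨k', π', b', f', rfl⟩ := hy
        -- The product of two word polynomials belongs to the disjoint union of the two
        -- permutations.
        have := wordMap_wordTensor_mem P (Equiv.sumCongr π π') (Sum.elim b b') (Sum.elim f f')
        rw [wordMap_wordTensor] at this
        rw [wordMap_wordTensor, wordMap_wordTensor, Finset.sum_mul_sum]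
        convert this using 1
        rw [← (Equiv.sumArrowEquivProdArrow (Fin k) (Fin k') α).symm.sum_comp,
          Fintype.sum_prod_type]
        refine Finset.sum_congr rfl fun a _ => Finset.sum_congr rfl fun a' _ => ?_
        rw [Fintype.prod_sum_type]
        simp)

omit [DecidableEq α] in
theorem mem_traceAlgebra {P : Bool → α → Matrix α α K} {g : MvPolynomial (β × α) K} :
    g ∈ traceAlgebra P β ↔ g ∈ traceModule P β := Iff.rfl

omit [DecidableEq α] in
theorem homogeneousComponent_mem_traceAlgebra (P : Bool → α → Matrix α α K) 
    (g : MvPolynomial (β × α) K) (hg : g ∈ traceAlgebra P β) (n : ℕ) :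
    homogeneousComponent n g ∈ traceAlgebra P β := by
  rw [mem_traceAlgebra] at hg ⊢
  induction hg using Submodule.span_induction with
  | zero => simp
  | add x y _ _ hx hy => rw [map_add]; exact add_mem hx hy
  | smul c x _ hx => rw [map_smul]; exact Submodule.smul_mem _ _ hx
  | mem x hx =>
    obtain ⟨k, π, b, f, rfl⟩ := hx
    have hh : (wordMap f (wordTensor P π b)).IsHomogeneous k := by
      rw [wordMap_apply]
      refine IsHomogeneous.sum _ _ _ fun r _ => ?_
      rw [smul_eq_C_mul]
      refine IsHomogeneous.C_mul ?_ _
      have := IsHomogeneous.prod Finset.univ (fun s => (X (f s, r s) : MvPolynomial (β × α) K))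
        (fun _ => 1) fun s _ => isHomogeneous_X K _
      simpa using this
    rw [homogeneousComponent_of_mem hh]
    split_ifs
    · exact wordMap_wordTensor_mem P π b f
    · exact zero_mem _

/-- Expand the trace multilinearly in the vectors; each term is a word tensor of one full cycle. -/
theorem trace_word_mem_traceAlgebra [Fintype β] (P : Bool → α → Matrix α α K) (c : β → K)
    (w : List Bool) :
    ((w.map fun b => letter P b fun p => ∑ i, C (c i) * X (i, p)).prod).trace ∈
      traceAlgebra P β := by
  classical
  rcases w with _ | ⟨b₀, w⟩
  · simp
  · obtain ⟨n, b, hb⟩ : ∃ (n : ℕ) (b : Fin (n + 1) → Bool), b₀ :: w = List.ofFn b :=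
      ⟨w.length, (b₀ :: w).get, (List.ofFn_get _).symm⟩
    rw [hb, List.map_ofFn, trace_list_ofFn_prod]
    have hlin : ∀ b : Bool, ∀ i j, letter P b (fun p => ∑ i, C (c i) * X (i, p)) i j =
        ∑ f : β, C (c f) * letter P b (fun p => (X (f, p) : MvPolynomial (β × α) K)) i j := by
      intro b i j
      simp only [letter_apply, Finset.sum_mul, Finset.mul_sum]
      rw [Finset.sum_comm]
      simp only [mul_assoc]
    have : ∑ a : Fin (n + 1) → α, ∏ s, ((fun b => letter P b
        (fun p => ∑ i, C (c i) * X (i, p) : α → MvPolynomial (β × α) K)) ∘ b) s (a s)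
          (a (finRotate _ s)) =
        ∑ f : Fin (n + 1) → β, (∏ s, c (f s)) • wordMap f (wordTensor P (finRotate _).symm b) := by
      simp only [Function.comp_apply, hlin, Finset.prod_univ_sum, Fintype.piFinset_univ]
      rw [Finset.sum_comm]
      refine Finset.sum_congr rfl fun f _ => ?_
      rw [wordMap_wordTensor, Finset.smul_sum]
      refine Finset.sum_congr rfl fun a _ => ?_
      rw [Finset.prod_mul_distrib, smul_eq_C_mul, map_prod]
      rfl
    rw [this]
    exact Subalgebra.sum_mem _ fun f _ => Subalgebra.smul_mem _ (wordMap_wordTensor_mem P _ b f) _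

end TraceAlgebra

/-! ### Directional derivatives through dual numbers. -/

section DualNumbers

open MvPolynomial

/-- Evaluation of a polynomial at a tangent vector. -/
theorem aeval_inl_add_inr {K σ : Type*} [Field K] [Finite σ] (ξ η : σ → K) (g : MvPolynomial σ K) :
    aeval (fun i => (TrivSqZeroExt.inl (ξ i) + TrivSqZeroExt.inr (η i) : DualNumber K)) g =
      TrivSqZeroExt.inl (eval ξ g) + TrivSqZeroExt.inr (∑ᶠ i, η i * eval ξ (pderiv i g)) := by
  classical
  have := Fintype.ofFinite σ
  simp only [finsum_eq_sum_of_fintype]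
  induction g using MvPolynomial.induction_on with
  | C a => simp [TrivSqZeroExt.algebraMap_eq_inl]
  | add p q hp hq =>
    rw [map_add, hp, hq]
    ext <;> simp [mul_add, Finset.sum_add_distrib]
  | mul_X p j hp =>
    rw [map_mul, hp, aeval_X]
    ext
    · simp
    · have h1 : ∀ i, η i * eval ξ (pderiv i (p * X j)) =
          ξ j * (η i * eval ξ (pderiv i p)) + if i = j then η j * eval ξ p else 0 := by
        intro i
        rw [pderiv_mul, pderiv_X]
        by_cases h : i = j
        · subst h
          simp
          ring
        · simp [h, Ne.symm h]
          ring
      simp only [h1, Finset.sum_add_distrib, ← Finset.mul_sum]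
      simp [add_comm, mul_comm]

end DualNumbers

/-! ### Reduction to the traces of pencil words at a single vector. -/

namespace StructureConstants

open MvPolynomial

variable {m : ℕ} {K : Type*} [Field K]

/-- The matrix `diag x * E - diag (E x)`. -/
def pencilMatrix {R : Type*} [CommRing R] (E : Matrix (Fin m) (Fin m) R) (x : Fin m → R) :
    Matrix (Fin m) (Fin m) R :=
  Matrix.diagonal x * E - Matrix.diagonal (E.mulVec x)

/-- Products of the matrices `diag x` and `diag x * E - diag (E x)`. -/
def pencilWord {R : Type*} [CommRing R] (E : Matrix (Fin m) (Fin m) R) (x : Fin m → R)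
    (w : List Bool) : Matrix (Fin m) (Fin m) R :=
  (w.map fun b => if b then pencilMatrix E x else Matrix.diagonal x).prod

theorem letter_pencilLetters {R : Type*} [CommRing R] [Algebra K R] (E : Matrix (Fin m) (Fin m) K)
    (b : Bool) (x : Fin m → R) : letter (pencilLetters E) b x =
      if b then pencilMatrix (E.map (algebraMap K R)) x else Matrix.diagonal x := by
  have h1 : ∀ i p : Fin m, algebraMap K R ((Pi.single p 1 : Fin m → K) i) = if i = p then 1 else 0 :=
    fun i p => by by_cases h : i = p <;> simp [h]
  cases b
  · ext i j
    by_cases h : i = j <;> simp [letter_apply, pencilLetters, h, h1]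
  · ext i j
    by_cases h : i = j
    · subst h
      simp [letter_apply, pencilLetters, pencilMatrix, h1, Matrix.mulVec, dotProduct, mul_sub,
        Finset.sum_sub_distrib, mul_comm]
    · simp [letter_apply, pencilLetters, pencilMatrix, h, h1]

theorem aeval_trace_word {R β : Type*} [Fintype β] [CommRing R] [Algebra K R]
    (E : Matrix (Fin m) (Fin m) K) (c : β → K) (w : List Bool) (y : β × Fin m → R) :
    aeval y ((w.map fun b => letter (pencilLetters E) b
      fun p => ∑ i, C (c i) * X (i, p)).prod).trace =
      (pencilWord (E.map (algebraMap K R)) (fun p => ∑ i, algebraMap K R (c i) * y (i, p)) w).trace := by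
  have htr : ∀ M : Matrix (Fin m) (Fin m) (MvPolynomial (β × Fin m) K),
      aeval y M.trace = ((aeval y).mapMatrix M).trace := fun M => by simp [Matrix.trace]
  rw [htr, map_list_prod, List.map_map, pencilWord]
  congr 3
  funext b
  rw [Function.comp_apply, map_letter, letter_pencilLetters]
  congr 2
  all_goals
    funext p
    simp

/-- A point of the polynomial ring is a tuple of `m` vectors. Words in a linear combination of these
vectors are trace polynomials of the tuple, so separation for single vectors gives separation for
tuples. -/
theorem exists_wordSpan_pencilLetters_eq_top [IsAlgClosed K] (E : Matrix (Fin m) (Fin m) K)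
    (hsep : ∀ x x' : Fin m → K, x ≠ x' →
      ∃ w, (pencilWord E x w).trace ≠ (pencilWord E x' w).trace)
    (himm : ∀ x y : Fin m → K, x ≠ 0 → y ≠ 0 → ∃ w,
      (pencilWord (E.map (algebraMap K (DualNumber K)))
        (fun p => TrivSqZeroExt.inl (x p) + TrivSqZeroExt.inr (y p)) w).trace.snd ≠ 0) :
    ∃ N, ∀ k ≥ N, wordSpan (pencilLetters E) k = ⊤ := by
  obtain ⟨N, hN⟩ := exists_forall_isHomogeneous_mem (traceAlgebra (pencilLetters E) (Fin m))
    (homogeneousComponent_mem_traceAlgebra _) (fun ξ η hne => by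
      obtain ⟨i, hi⟩ : ∃ i, (fun p => η (i, p)) ≠ fun p => ξ (i, p) := by
        by_contra! h
        exact hne (funext fun x => congrFun (h x.1) x.2)
      obtain ⟨w, hw⟩ := hsep _ _ hi
      refine ⟨_, trace_word_mem_traceAlgebra _ (Pi.single i 1) w, ?_⟩
      rw [← aeval_eq_eval, ← aeval_eq_eval]
      change aeval η _ ≠ aeval ξ _
      rw [aeval_trace_word, aeval_trace_word]
      have h1 : ∀ (y : Fin m × Fin m → K) p,
          ∑ j, algebraMap K K ((Pi.single i 1 : Fin m → K) j) * y (j, p) = y (i, p) := by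
        intro y p
        rw [Finset.sum_eq_single i] <;> simp +contextual
      simp only [h1]
      exact hw) (fun ξ η hξ hη => by
      -- One combination must keep both the point and the tangent vector nonzero: a single row does,
      -- or the sum of a row where only `ξ` survives and one where only `η` does.
      obtain ⟨c, hcξ, hcη⟩ : ∃ c : Fin m → K, (fun p => ∑ i, c i * ξ (i, p)) ≠ 0 ∧
          (fun p => ∑ i, c i * η (i, p)) ≠ 0 := by
        obtain ⟨⟨i, p⟩, hip⟩ := Function.ne_iff.mp hξ
        obtain ⟨⟨j, q⟩, hjq⟩ := Function.ne_iff.mp hη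
        have h1 : ∀ (y : Fin m × Fin m → K) i p,
            ∑ j, (Pi.single i 1 : Fin m → K) j * y (j, p) = y (i, p) := by
          intro y i p
          rw [Finset.sum_eq_single i] <;> simp +contextual
        by_cases hηi : ∃ q, η (i, q) ≠ 0
        · obtain ⟨q, hq⟩ := hηi
          exact ⟨Pi.single i 1, Function.ne_iff.mpr ⟨p, by simpa [h1] using hip⟩,
            Function.ne_iff.mpr ⟨q, by simpa [h1] using hq⟩⟩
        by_cases hξj : ∃ q, ξ (j, q) ≠ 0
        · obtain ⟨p, hp⟩ := hξj
          exact ⟨Pi.single j 1, Function.ne_iff.mpr ⟨p, by simpa [h1] using hp⟩,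
            Function.ne_iff.mpr ⟨q, by simpa [h1] using hjq⟩⟩
        push Not at hηi hξj
        refine ⟨Pi.single i 1 + Pi.single j 1, Function.ne_iff.mpr ⟨p, ?_⟩,
            Function.ne_iff.mpr ⟨q, ?_⟩⟩
        · simpa [add_mul, Finset.sum_add_distrib, h1, hξj] using hip
        · simpa [add_mul, Finset.sum_add_distrib, h1, hηi] using hjq
      obtain ⟨w, hw⟩ := himm _ _ hcξ hcη
      refine ⟨_, trace_word_mem_traceAlgebra _ c w, ?_⟩
      have h2 := aeval_inl_add_inr ξ η ((w.map fun b => letter (pencilLetters E) b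
        fun p => ∑ i, C (c i) * X (i, p)).prod).trace
      rw [aeval_trace_word] at h2
      have h3 := congrArg TrivSqZeroExt.snd h2
      rw [TrivSqZeroExt.snd_add, TrivSqZeroExt.snd_inl, TrivSqZeroExt.snd_inr, zero_add] at h3
      have h4 : (fun p => ∑ i, algebraMap K (DualNumber K) (c i) *
          (TrivSqZeroExt.inl (ξ (i, p)) + TrivSqZeroExt.inr (η (i, p)))) =
          fun p => TrivSqZeroExt.inl (∑ i, c i * ξ (i, p)) +
            TrivSqZeroExt.inr (∑ i, c i * η (i, p)) := by
        funext p
        ext <;> simp [TrivSqZeroExt.algebraMap_eq_inl, TrivSqZeroExt.fst_sum,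
          TrivSqZeroExt.snd_sum]
      rw [← h3, h4]
      exact hw)
  exact ⟨N, fun k hk => wordSpan_eq_top_of_traceModule _ fun g hg => hN k hk g hg⟩

end StructureConstants

namespace StructureConstants

/-! ### Generic matrices with zero diagonal. -/

section Generic

variable {m : ℕ} {κ : Type*}

/-- The matrix `e` with an additional row of ones. -/
def withOnes [One κ] (e : Fin m → Fin m → κ) : Option (Fin m) → Fin m → κ
  | none, _ => 1
  | some l, k => e l k

variable [Field κ]

/-- A matrix with zero diagonal such that all minors, also with an additional row of ones, are
nonzero as soon as they have a nonzero term in their expansion. -/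
structure IsGenericMatrix (e : Fin m → Fin m → κ) : Prop where
  diag : ∀ l, e l l = 0
  det_ne_zero : ∀ (C : Finset (Fin m)) (f : C → Option (Fin m)), Function.Injective f →
    (∀ i, f i ≠ some (i : Fin m)) →
    (Matrix.of fun i j : C => withOnes e (f i) j).det ≠ 0

/-- The rows and columns share at most one index, so any bijection pairs at most that one with
itself; a swap repairs it when there are two columns. The result is a nonzero term in the expansion
of the minor, as `IsGenericMatrix.det_ne_zero` demands. -/
theorem exists_injective_avoiding (S : Finset (Option (Fin m))) (C : Finset (Fin m))
    (hSC : S.card = C.card)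
    (hov : ∀ k ∈ C, ∀ k' ∈ C, some k ∈ S → some k' ∈ S → k = k')
    (h2 : 2 ≤ C.card ∨ ∀ k ∈ C, some k ∉ S) :
    ∃ f : C → Option (Fin m), Function.Injective f ∧ (∀ i, f i ≠ some (i : Fin m)) ∧
      ∀ s, s ∈ S ↔ ∃ i, f i = s := by
  classical
  have key : ∃ f : C ≃ S, ∀ i, (f i : Option (Fin m)) ≠ some (i : Fin m) := by
    let f₀ : C ≃ S := Finset.equivOfCardEq hSC.symm
    by_cases hno : ∀ k ∈ C, some k ∉ S
    · exact ⟨f₀, fun i hi => hno i i.2 (hi ▸ (f₀ i).2)⟩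
    · push Not at hno
      obtain ⟨a, ha, haS⟩ := hno
      have hcard : 2 ≤ C.card := h2.resolve_right fun h => h a ha haS
      obtain ⟨s, hs, hsa⟩ : ∃ s ∈ S, s ≠ some a := by
        by_contra! h
        have : S.card ≤ 1 := Finset.card_le_one.mpr fun x hx y hy => (h x hx).trans (h y hy).symm
        omega
      refine ⟨f₀.trans (Equiv.swap (f₀ ⟨a, ha⟩) ⟨s, hs⟩), fun i hi => ?_⟩
      have hiS : some (i : Fin m) ∈ S := hi ▸ (f₀.trans (Equiv.swap (f₀ ⟨a, ha⟩) ⟨s, hs⟩) i).2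
      have hia : i = ⟨a, ha⟩ := Subtype.ext (hov i i.2 a ha hiS haS)
      subst hia
      simp only [Equiv.trans_apply, Equiv.swap_apply_left] at hi
      exact hsa hi
  obtain ⟨f, hf⟩ := key
  refine ⟨fun i => f i, fun i j h => f.injective (Subtype.ext h), hf, fun s => ⟨fun hs => ?_, ?_⟩⟩
  · exact ⟨f.symm ⟨s, hs⟩, by simp⟩
  · rintro ⟨i, rfl⟩
    exact (f i).2

variable {e : Fin m → Fin m → κ}

/-- Discard rows until the system is square; its minor is then nonzero. The next lemma discards
columns instead. -/
theorem IsGenericMatrix.eq_zero_of_rows (he : IsGenericMatrix e) (S : Finset (Option (Fin m)))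
    (C : Finset (Fin m)) (hSC : C.card ≤ S.card)
    (hov : ∀ k ∈ C, ∀ k' ∈ C, some k ∈ S → some k' ∈ S → k = k')
    (h2 : 2 ≤ C.card ∨ ∀ k ∈ C, some k ∉ S) (z : Fin m → κ)
    (hz : ∀ s ∈ S, ∑ k ∈ C, z k * withOnes e s k = 0) : ∀ k ∈ C, z k = 0 := by
  classical
  obtain ⟨S', hS', hcard⟩ := Finset.exists_subset_card_eq hSC
  obtain ⟨f, hf, hfa, hfS⟩ := exists_injective_avoiding S' C hcard
    (fun k hk k' hk' h h' => hov k hk k' hk' (hS' h) (hS' h'))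
    (h2.imp id fun h k hk h' => h k hk (hS' h'))
  have hker : (Matrix.of fun i j : C => withOnes e (f i) j).mulVec (fun j => z j) = 0 := by
    ext i
    have := hz (f i) (hS' ((hfS _).mpr ⟨i, rfl⟩))
    rw [← Finset.sum_coe_sort] at this
    simpa [Matrix.mulVec, dotProduct, mul_comm] using this
  have := Matrix.eq_zero_of_mulVec_eq_zero (he.det_ne_zero C f hf hfa) hker
  exact fun k hk => congrFun this ⟨k, hk⟩

theorem IsGenericMatrix.eq_zero_of_columns (he : IsGenericMatrix e) (S : Finset (Option (Fin m)))
    (C : Finset (Fin m)) (hSC : S.card ≤ C.card)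
    (hov : ∀ k ∈ C, ∀ k' ∈ C, some k ∈ S → some k' ∈ S → k = k')
    (h2 : 2 ≤ S.card ∨ ∀ k ∈ C, some k ∉ S) (z : Option (Fin m) → κ)
    (hz : ∀ k ∈ C, ∑ s ∈ S, z s * withOnes e s k = 0) : ∀ s ∈ S, z s = 0 := by
  classical
  obtain ⟨C', hC', hcard⟩ := Finset.exists_subset_card_eq hSC
  obtain ⟨f, hf, hfa, hfS⟩ := exists_injective_avoiding S C' hcard.symm
    (fun k hk k' hk' h h' => hov k (hC' hk) k' (hC' hk') h h')
    (h2.imp (by rw [hcard]; exact id) fun h k hk h' => h k (hC' hk) h')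
  have hker : Matrix.vecMul (fun i => z (f i)) (Matrix.of fun i j : C' => withOnes e (f i) j) = 0 := by
    ext k
    have := hz k (hC' k.2)
    have himg : S = Finset.univ.image f := by
      ext s; simp [hfS]
    rw [himg, Finset.sum_image fun i _ j _ h => hf h] at this
    simpa [Matrix.vecMul, dotProduct] using this
  have := Matrix.eq_zero_of_vecMul_eq_zero (he.det_ne_zero C' f hf hfa) hker
  intro s hs
  obtain ⟨i, rfl⟩ := (hfS s).mp hs
  exact congrFun this i

theorem IsGenericMatrix.ne_zero (he : IsGenericMatrix e) {l k : Fin m} (hlk : l ≠ k) :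
    e l k ≠ 0 := by
  intro h
  have := he.eq_zero_of_rows {some l} {k} (by simp) (by simp) (Or.inr (by simpa using Ne.symm hlk))
    (fun _ => 1) (by simp [withOnes, h]) k (by simp)
  exact one_ne_zero this

/-- Points at which a nonzero combination of the rows in `I` takes the same value are few. -/
theorem IsGenericMatrix.card_le (he : IsGenericMatrix e) {I C : Finset (Fin m)} (hI : I.Nonempty)
    (hov : ∀ k ∈ C, ∀ k' ∈ C, k ∈ I → k' ∈ I → k = k') {τ : Fin m → κ} (hτ : ∀ l ∈ I, τ l ≠ 0)
    {d : κ} (hd : ∀ k ∈ C, ∑ l ∈ I, τ l * e l k = d) : C.card ≤ I.card := by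
  classical
  by_contra! hlt
  have hcard : (insert none (I.image some)).card = I.card + 1 := by
    rw [Finset.card_insert_of_notMem (by simp), Finset.card_image_of_injective _ (Option.some_injective _)]
  obtain ⟨l, hl⟩ := hI
  -- The row of ones with coefficient `-d` turns the constant value into a linear relation among
  -- `I.card + 1` rows on at least as many columns.
  have := he.eq_zero_of_columns (insert none (I.image some)) C (by omega) (by simpa using hov)
    (Or.inl (by rw [hcard]; have := Finset.card_pos.mpr ⟨l, hl⟩; omega))
    (fun s => s.elim (-d) τ) (by
      intro k hk
      rw [Finset.sum_insert (by simp), Finset.sum_image (by simp)]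
      simp [withOnes, hd k hk]) (some l) (by simpa using hl)
  exact hτ l hl this

end Generic

end StructureConstants

namespace StructureConstants

/-! ### The linear systems over the residue field. -/

section Residual

open Polynomial

variable {m : ℕ} {R : Type*} [CommRing R]

/-- The restriction to the block `α` of the matrix with entries `e l k * y l`, `k ≠ l`, and
diagonal entries `- d k`. -/
def blockMatrix (e : Fin m → Fin m → R) (α : Finset (Fin m)) (y d : Fin m → R) :
    Matrix (Fin m) (Fin m) R :=
  Matrix.of fun k l => if k ∈ α ∧ l ∈ α then e l k * y l - (if k = l then d k else 0) else 0

theorem blockMatrix_mulVec (e : Fin m → Fin m → R) (α : Finset (Fin m)) (y d : Fin m → R)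
    (v : Fin m → R) (k : Fin m) :
    (blockMatrix e α y d).mulVec v k =
      if k ∈ α then ∑ l ∈ α, e l k * y l * v l - d k * v k else 0 := by
  classical
  rw [Matrix.mulVec, dotProduct]
  by_cases hk : k ∈ α
  · rw [if_pos hk]
    have h1 : ∀ l, blockMatrix e α y d k l * v l =
        (if l ∈ α then e l k * y l * v l else 0) - (if k = l then d k * v k else 0) := by
      intro l
      by_cases hl : l ∈ α
      · by_cases hkl : k = l
        · subst hkl
          simp [blockMatrix, hk, sub_mul]
        · simp [blockMatrix, hk, hl, hkl]
      · have : k ≠ l := fun h => hl (h ▸ hk)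
        simp [blockMatrix, hl, this]
    rw [Finset.sum_congr rfl fun l _ => h1 l, Finset.sum_sub_distrib]
    simp
  · rw [if_neg hk]
    exact Finset.sum_eq_zero fun l _ => by simp [blockMatrix, hk]

/-- On vectors annihilated entrywise by `y`, the block matrix acts as `diag (-d)`, and this property
persists under iteration. -/
theorem aeval_blockMatrix_mulVec (e : Fin m → Fin m → R) (α : Finset (Fin m)) (y d : Fin m → R)
    (v : Fin m → R) (hv : ∀ k, k ∉ α → v k = 0) (hy : ∀ l ∈ α, y l * v l = 0) (h : R[X]) :
    (aeval (blockMatrix e α y d) h).mulVec v = fun k => h.eval (- d k) * v k := by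
  induction h using Polynomial.induction_on' generalizing v with
  | add p q hp hq =>
    rw [map_add, Matrix.add_mulVec, hp v hv hy, hq v hv hy]
    ext k
    simp [add_mul]
  | monomial n r =>
    rw [← C_mul_X_pow_eq_monomial, map_mul, aeval_C, Algebra.algebraMap_eq_smul_one, smul_mul_assoc,
      one_mul, Matrix.smul_mulVec, map_pow, aeval_X]
    have : ((blockMatrix e α y d) ^ n).mulVec v = fun k => (- d k) ^ n * v k := by
      induction n with
      | zero => simp
      | succ n ih =>
        rw [pow_succ', ← Matrix.mulVec_mulVec, ih]
        ext k
        rw [blockMatrix_mulVec]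
        split_ifs with hk
        · rw [Finset.sum_eq_zero]
          · ring
          · intro l hl
            linear_combination e l k * (- d l) ^ n * hy l hl
        · simp [hv k hk]
    rw [this]
    ext k
    simp [mul_assoc]

theorem eval_prod_X_add_C_ne_zero {κ : Type*} [Field κ] (s : Finset κ) {μ : κ} (hμ : μ ∉ s) :
    (∏ ν ∈ s, (X + C ν : κ[X])).eval (-μ) ≠ 0 := by
  rw [eval_prod, Finset.prod_ne_zero_iff]
  intro ν hν h
  rw [eval_add, eval_X, eval_C] at h
  exact hμ ((show ν = μ by linear_combination h) ▸ hν)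

theorem eval_prod_X_add_C_eq_zero {κ : Type*} [Field κ] (s : Finset κ) {μ : κ} (hμ : μ ∈ s) :
    (∏ ν ∈ s, (X + C ν : κ[X])).eval (-μ) = 0 := by
  rw [eval_prod]
  exact Finset.prod_eq_zero hμ (by simp)

variable {κ : Type*} [Field κ] {e : Fin m → Fin m → κ}

/-- The polynomial vanishes at every level of `-d` except `-μ`, so it isolates one level set of `d`.
-/
theorem sum_filter_eq_of_prod_X_add_C [DecidableEq κ] (α : Finset (Fin m)) (d u : Fin m → κ) (μ : κ)
    (h : ∑ k ∈ α, (∏ ν ∈ (α.image d).erase μ, (X + C ν : κ[X])).eval (- d k) * u k = 0) :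
    ∑ k ∈ α with d k = μ, u k = 0 := by
  have h1 : ∑ k ∈ α, (∏ ν ∈ (α.image d).erase μ, (X + C ν : κ[X])).eval (- d k) * u k =
      (∏ ν ∈ (α.image d).erase μ, (X + C ν : κ[X])).eval (- μ) * ∑ k ∈ α with d k = μ, u k := by
    rw [Finset.mul_sum, Finset.sum_filter]
    refine Finset.sum_congr rfl fun k hk => ?_
    split_ifs with hd
    · rw [hd]
    · rw [eval_prod_X_add_C_eq_zero _ (Finset.mem_erase.mpr ⟨hd, Finset.mem_image_of_mem d hk⟩),
        zero_mul]
  rw [h1] at h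
  exact (mul_eq_zero.mp h).resolve_left (eval_prod_X_add_C_ne_zero _ (by simp))

/-- Here the block matrix is diagonal on `α`, so the conditions split over the level sets of `d`.
Such a set has at most as many elements as `I` by `card_le`, and the rows in `I` then force the
unknowns to vanish. -/
theorem IsGenericMatrix.eq_zero_of_disjoint (he : IsGenericMatrix e) {I α : Finset (Fin m)}
    (hI : I.Nonempty) (hdisj : ∀ k ∈ α, k ∉ I) {τ d c : Fin m → κ} (hτ : ∀ l ∈ I, τ l ≠ 0)
    (hτ0 : ∀ l, l ∉ I → τ l = 0) (hd : ∀ k, d k = ∑ l ∈ I, τ l * e l k)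
    (hT : ∀ g : κ[X], ∀ l ∈ I, ∀ l' ∈ I, l ∉ α → l' ∉ α → ∑ k ∈ α, c k * e k l' *
      (aeval (blockMatrix e α τ d) g).mulVec (fun k => if k ∈ α then e l k else 0) k = 0) :
    ∀ k ∈ α, c k = 0 := by
  classical
  intro k₀ hk₀
  obtain ⟨l', hl'⟩ := hI
  have hdisj' : ∀ l ∈ I, l ∉ α := fun l hl hα => hdisj l hα hl
  set C := α.filter fun k => d k = d k₀ with hC
  have hCα : ∀ k ∈ C, k ∈ α := fun k hk => (Finset.mem_filter.mp hk).1
  have hz : ∀ l ∈ I, ∑ k ∈ C, c k * e k l' * e l k = 0 := by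
    intro l hl
    refine sum_filter_eq_of_prod_X_add_C α d _ (d k₀) ?_
    have := hT (∏ ν ∈ (α.image d).erase (d k₀), (X + Polynomial.C ν : κ[X])) l hl l' hl'
      (hdisj' l hl) (hdisj' l' hl')
    rw [aeval_blockMatrix_mulVec _ _ _ _ _ (fun k hk => if_neg hk)
      (fun k hk => by rw [hτ0 k (hdisj k hk), zero_mul])] at this
    rw [← this]
    refine Finset.sum_congr rfl fun k hk => ?_
    simp only [if_pos hk]
    ring
  have hcard : C.card ≤ I.card := he.card_le ⟨l', hl'⟩
    (fun k hk _ _ h _ => absurd h (hdisj k (hCα k hk))) hτ (d := d k₀)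
    (fun k hk => by rw [← hd, (Finset.mem_filter.mp hk).2])
  have := he.eq_zero_of_rows (I.image some) C
    (by rwa [Finset.card_image_of_injective _ (Option.some_injective _)])
    (fun k hk _ _ h _ => absurd (by simpa using h) (hdisj k (hCα k hk)))
    (Or.inr fun k hk => by simpa using hdisj k (hCα k hk)) (fun k => c k * e k l') (by
      intro s hs
      obtain ⟨l, hl, rfl⟩ := Finset.mem_image.mp hs
      exact hz l hl) k₀ (by simp [hC, hk₀])
  exact (mul_eq_zero.mp this).resolve_right (he.ne_zero fun h => hdisj k₀ hk₀ (h ▸ hl'))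

/-- The block matrix is `diag (-d)` plus a single column at `a`. Applying `N + d a` makes the entry
at `a` vanish, because `e a a = 0`; from then on `N` acts diagonally. -/
theorem IsGenericMatrix.aeval_mul_X_add_C_mulVec (he : IsGenericMatrix e) {I α : Finset (Fin m)}
    {a : Fin m} (haα : a ∈ α) (hIα : ∀ k ∈ α, k ∈ I → k = a) {τ d : Fin m → κ}
    (hτ0 : ∀ l, l ∉ I → τ l = 0) (p : Fin m → κ) (h : κ[X]) {k : Fin m} (hk : k ∈ α) :
    (aeval (blockMatrix e α τ d) (h * (X + C (d a)))).mulVec (fun k => if k ∈ α then p k else 0) k =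
      h.eval (- d k) * ((d a - d k) * p k + p a * τ a * e a k) := by
  classical
  have hv : (aeval (blockMatrix e α τ d) (X + C (d a))).mulVec (fun k => if k ∈ α then p k else 0) =
      fun k => if k ∈ α then (d a - d k) * p k + p a * τ a * e a k else 0 := by
    rw [map_add, aeval_X, aeval_C, Algebra.algebraMap_eq_smul_one, Matrix.add_mulVec,
      Matrix.smul_mulVec, Matrix.one_mulVec]
    ext k
    rw [Pi.add_apply, blockMatrix_mulVec]
    by_cases hk : k ∈ α
    · rw [if_pos hk, Finset.sum_eq_single a]
      · simp [hk, haα]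
        ring
      · intro l hl hla
        rw [hτ0 l fun h => hla (hIα l hl h)]
        ring
      · exact fun h => absurd haα h
    · simp [hk]
  rw [map_mul, ← Matrix.mulVec_mulVec, hv, aeval_blockMatrix_mulVec _ _ _ _ _ fun k hk => if_neg hk]
  · simp [hk]
  · intro l hl
    by_cases hla : l = a
    · subst hla
      simp [he.diag]
    · rw [hτ0 l fun h => hla (hIα l hl h), zero_mul]

/-- Only the rows in `I \ {a}` give equations, one fewer than a level set may have elements. Away
from the level of `a` the deficit is made up by the vanishing coordinate that `hc` supplies; on the
level of `a`, by an extra equation for the row `a`. -/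
theorem IsGenericMatrix.eq_zero_of_mem (he : IsGenericMatrix e) {I α : Finset (Fin m)}
    {a : Fin m} (haα : a ∈ α) (haI : a ∈ I) (hIα : ∀ k ∈ α, k ∈ I → k = a)
    (hI' : ∃ l ∈ I, l ∉ α) {τ d c : Fin m → κ} (hτ : ∀ l ∈ I, τ l ≠ 0)
    (hτ0 : ∀ l, l ∉ I → τ l = 0) (hd : ∀ k, d k = ∑ l ∈ I, τ l * e l k)
    (hT : ∀ g : κ[X], ∀ l ∈ I, ∀ l' ∈ I, l ∉ α → l' ∉ α → ∑ k ∈ α, c k * e k l' *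
      (aeval (blockMatrix e α τ d) g).mulVec (fun k => if k ∈ α then e l k else 0) k = 0)
    (hc : ∀ k ∈ α, d k ≠ d a → ∃ k' ∈ α, d k' = d k ∧ c k' = 0) :
    ∀ k ∈ α, c k = 0 := by
  classical
  obtain ⟨l', hl', hl'α⟩ := hI'
  set I' := I.erase a with hI'
  have hI'mem : ∀ l, l ∈ I' ↔ l ∈ I ∧ l ∉ α := fun l => by
    rw [hI', Finset.mem_erase]
    exact ⟨fun h => ⟨h.2, fun hα => h.1 (hIα l hα h.2)⟩, fun h => ⟨fun h' => h.2 (h' ▸ haα), h.1⟩⟩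
  have hIcard : I'.card + 1 = I.card := Finset.card_erase_add_one haI
  have hsumI : ∀ f : Fin m → κ, ∑ l ∈ I, f l = f a + ∑ l ∈ I', f l := fun f =>
    (Finset.add_sum_erase I f haI).symm
  set z : Fin m → κ := fun k => c k * e k l' with hz
  have hzc : ∀ k ∈ α, z k = 0 → c k = 0 := fun k hk h =>
    (mul_eq_zero.mp h).resolve_right (he.ne_zero fun h => hl'α (h ▸ hk))
  have hkey : ∀ h : κ[X], ∀ l ∈ I', ∑ k ∈ α, h.eval (- d k) *
      (z k * ((d a - d k) * e l k + e l a * τ a * e a k)) = 0 := by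
    intro h l hl
    rw [← hT (h * (X + C (d a))) l ((hI'mem l).mp hl).1 l' hl' ((hI'mem l).mp hl).2 hl'α]
    refine Finset.sum_congr rfl fun k hk => ?_
    rw [he.aeval_mul_X_add_C_mulVec haα hIα hτ0 _ _ hk]
    simp only [hz]
    ring
  have hcardC : ∀ μ, (α.filter fun k => d k = μ).card ≤ I.card := fun μ =>
    he.card_le ⟨a, haI⟩ (fun k hk k' hk' h h' => by
      rw [hIα k (Finset.mem_filter.mp hk).1 h, hIα k' (Finset.mem_filter.mp hk').1 h']) hτ (d := μ)
    (fun k hk => by rw [← hd, (Finset.mem_filter.mp hk).2])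
  have hother : ∀ k ∈ α, d k ≠ d a → c k = 0 := by
    intro k₀ hk₀ hda
    set C := α.filter fun k => d k = d k₀ with hC
    have hCα : ∀ k ∈ C, k ∈ α := fun k hk => (Finset.mem_filter.mp hk).1
    have hCd : ∀ k ∈ C, d k = d k₀ := fun k hk => (Finset.mem_filter.mp hk).2
    have haC : a ∉ C := fun h => hda (hCd a h).symm
    have hCI : ∀ k ∈ C, k ∉ I := fun k hk h => haC (hIα k (hCα k hk) h ▸ hk)
    obtain ⟨k₁, hk₁α, hk₁d, hk₁c⟩ := hc k₀ hk₀ hda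
    have hk₁C : k₁ ∈ C := Finset.mem_filter.mpr ⟨hk₁α, hk₁d⟩
    set C' := C.erase k₁ with hC'
    have haC' : a ∉ C' := fun h => haC (Finset.mem_of_mem_erase h)
    have hzC : ∀ f : Fin m → κ, ∑ k ∈ C, z k * f k = ∑ k ∈ C', z k * f k := fun f => by
      rw [← Finset.add_sum_erase C _ hk₁C, hC', add_eq_right]
      simp [hz, hk₁c]
    set D := d a - d k₀ with hD
    have hD0 : D ≠ 0 := sub_ne_zero.mpr (Ne.symm hda)
    -- The rank-one term is absorbed into an unknown at the column `a`, which takes the place of the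
    -- removed column `k₁`.
    set y : Fin m → κ := fun k => if k = a then τ a * ∑ k ∈ C', z k * e a k else D * z k with hy
    have hya : y a = τ a * ∑ k ∈ C', z k * e a k := if_pos rfl
    have hyC : ∀ k ∈ C', y k = D * z k := fun k hk => if_neg fun h => haC' (by rwa [← h])
    have hyl : ∀ l ∈ I', y a * e l a + ∑ k ∈ C', y k * e l k = 0 := by
      intro l hl
      have := sum_filter_eq_of_prod_X_add_C α d _ (d k₀) (hkey _ l hl)
      rw [← hC, Finset.sum_congr rfl fun k hk => by rw [hCd k hk]] at this
      rw [hzC] at this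
      have hy' : ∑ k ∈ C', y k * e l k = ∑ k ∈ C', D * z k * e l k :=
        Finset.sum_congr rfl fun k hk => by rw [hyC k hk]
      rw [← this, hya, hy']
      simp only [Finset.mul_sum, Finset.sum_mul, ← Finset.sum_add_distrib]
      exact Finset.sum_congr rfl fun k _ => by ring
    -- Weight the rows by `τ`: as `d` is constant on the level set, their combination is a multiple
    -- of the row of ones.
    have hsum : d k₀ * (y a + ∑ k ∈ C', y k) = 0 := by
      have h1 : ∑ k ∈ C', y k * d k₀ = ∑ k ∈ C', y k * (τ a * e a k) +
          ∑ l ∈ I', τ l * ∑ k ∈ C', y k * e l k := by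
        simp only [Finset.mul_sum]
        rw [Finset.sum_comm, ← Finset.sum_add_distrib]
        refine Finset.sum_congr rfl fun k hk => ?_
        rw [← hCd k (Finset.mem_of_mem_erase hk), hd, hsumI, mul_add, Finset.mul_sum]
        congr 1
        exact Finset.sum_congr rfl fun l _ => by ring
      have h2 : ∑ l ∈ I', τ l * ∑ k ∈ C', y k * e l k = - y a * d a := by
        rw [hd a, hsumI, he.diag, mul_zero, zero_add, Finset.mul_sum]
        refine Finset.sum_congr rfl fun l hl => ?_
        linear_combination τ l * hyl l hl
      have h3 : ∑ k ∈ C', y k * (τ a * e a k) = D * y a := by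
        rw [hya, Finset.mul_sum, Finset.mul_sum]
        exact Finset.sum_congr rfl fun k hk => by rw [hyC k hk]; ring
      rw [h2, h3, ← Finset.sum_mul] at h1
      linear_combination h1
    have hins : (insert a C').card = C.card := by
      rw [Finset.card_insert_of_notMem haC', Finset.card_erase_add_one hk₁C]
    have hov : ∀ k ∈ insert a C', k ∉ I' := by
      intro k hk h
      rcases Finset.mem_insert.mp hk with rfl | hk
      · exact ((hI'mem k).mp h).2 haα
      · exact ((hI'mem k).mp h).2 (hCα k (Finset.mem_of_mem_erase hk))
    have hy0 : ∀ k ∈ insert a C', y k = 0 := by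
      by_cases hle : C.card ≤ I'.card
      · refine he.eq_zero_of_rows (I'.image some) _
          (by rwa [Finset.card_image_of_injective _ (Option.some_injective _), hins])
          (fun k hk _ _ h _ => absurd (by simpa using h) (hov k hk))
          (Or.inr fun k hk => by simpa using hov k hk) y ?_
        intro s hs
        obtain ⟨l, hl, rfl⟩ := Finset.mem_image.mp hs
        rw [Finset.sum_insert haC']
        exact hyl l hl
      -- The level set is as large as `I`; at level zero, `τ` would be a relation among the rows of
      -- a nonsingular minor.
      · have hd0 : d k₀ ≠ 0 := by
          intro h0
          have := he.eq_zero_of_columns (I.image some) C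
            (by rw [Finset.card_image_of_injective _ (Option.some_injective _)]; omega)
            (fun k hk _ _ h _ => absurd (by simpa using h) (hCI k hk))
            (Or.inr fun k hk => by simpa using hCI k hk) (fun s => s.elim 0 τ) (by
              intro k hk
              rw [Finset.sum_image (by simp)]
              simp only [Option.elim, withOnes]
              rw [← hd, hCd k hk, h0]) (some a) (by simpa using haI)
          exact hτ a haI this
        refine he.eq_zero_of_rows (insert none (I'.image some)) _
          (by
            rw [hins, Finset.card_insert_of_notMem (by simp),
              Finset.card_image_of_injective _ (Option.some_injective _), hIcard]
            exact hcardC _)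
          (fun k hk _ _ h _ => absurd (by simpa using h) (hov k hk))
          (Or.inr fun k hk => by simpa using hov k hk) y ?_
        intro s hs
        rw [Finset.sum_insert haC']
        rcases Finset.mem_insert.mp hs with rfl | hs
        · simpa [withOnes] using (mul_eq_zero.mp hsum).resolve_left hd0
        · obtain ⟨l, hl, rfl⟩ := Finset.mem_image.mp hs
          exact hyl l hl
    by_cases hk₀₁ : k₀ = k₁
    · rw [hk₀₁, hk₁c]
    · have hk₀C' : k₀ ∈ C' := Finset.mem_erase.mpr ⟨hk₀₁, Finset.mem_filter.mpr ⟨hk₀, rfl⟩⟩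
      have := hy0 k₀ (Finset.mem_insert_of_mem hk₀C')
      rw [hyC k₀ hk₀C'] at this
      exact hzc k₀ hk₀ ((mul_eq_zero.mp this).resolve_left hD0)
  set C := α.filter fun k => d k = d a with hC
  have haC : a ∈ C := Finset.mem_filter.mpr ⟨haα, rfl⟩
  have hCα : ∀ k ∈ C, k ∈ α := fun k hk => (Finset.mem_filter.mp hk).1
  have hsumC : ∀ f : Fin m → κ, ∑ k ∈ α, z k * f k = ∑ k ∈ C, z k * f k := fun f => by
    rw [hC, Finset.sum_filter]
    refine Finset.sum_congr rfl fun k hk => ?_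
    split_ifs with h
    · rfl
    · simp [hz, hother k hk h]
  have h1 : ∀ l ∈ I', ∑ k ∈ C, z k * e l k = 0 := by
    intro l hl
    have := hT 1 l ((hI'mem l).mp hl).1 l' hl' ((hI'mem l).mp hl).2 hl'α
    rw [map_one, Matrix.one_mulVec] at this
    rw [← hsumC, ← this]
    exact Finset.sum_congr rfl fun k hk => by rw [if_pos hk]
  have hl'I' : l' ∈ I' := (hI'mem l').mpr ⟨hl', hl'α⟩
  -- On the level of `a` the terms `d a - d k` drop out and the rank-one term alone gives the
  -- equation of the row `a`.
  have h2 : ∑ k ∈ C, z k * e a k = 0 := by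
    have := hkey 1 l' hl'I'
    simp only [eval_one, one_mul] at this
    rw [hsumC] at this
    have h3 : e l' a * τ a * ∑ k ∈ C, z k * e a k = 0 := by
      rw [← this, Finset.mul_sum]
      refine Finset.sum_congr rfl fun k hk => ?_
      rw [(Finset.mem_filter.mp hk).2]
      ring
    exact (mul_eq_zero.mp h3).resolve_left
      (mul_ne_zero (he.ne_zero fun h => hl'α (h ▸ haα)) (hτ a haI))
  have hzC : ∀ k ∈ C, z k = 0 := by
    by_cases hC2 : 2 ≤ C.card
    · refine he.eq_zero_of_rows (I.image some) C
        (by rw [Finset.card_image_of_injective _ (Option.some_injective _)]; exact hcardC _)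
        (fun k hk k' hk' h h' => by
          rw [hIα k (hCα k hk) (by simpa using h), hIα k' (hCα k' hk') (by simpa using h')])
        (Or.inl hC2) z ?_
      intro s hs
      obtain ⟨l, hl, rfl⟩ := Finset.mem_image.mp hs
      by_cases hla : l = a
      · rw [hla]; exact h2
      · exact h1 l (Finset.mem_erase.mpr ⟨hla, hl⟩)
    · have hov : ∀ k ∈ C, k ∉ I' := fun k hk h => ((hI'mem k).mp h).2 (hCα k hk)
      refine he.eq_zero_of_rows (I'.image some) C
        (by
          rw [Finset.card_image_of_injective _ (Option.some_injective _)]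
          have := Finset.card_pos.mpr ⟨l', hl'I'⟩
          omega)
        (fun k hk _ _ h _ => absurd (by simpa using h) (hov k hk))
        (Or.inr fun k hk => by simpa using hov k hk) z ?_
      intro s hs
      obtain ⟨l, hl, rfl⟩ := Finset.mem_image.mp hs
      exact h1 l hl
  intro k hk
  by_cases h : d k = d a
  · exact hzc k hk (hzC k (Finset.mem_filter.mpr ⟨hk, h⟩))
  · exact hother k hk h

end Residual

end StructureConstants

namespace StructureConstants

/-! ### Polynomials in the block matrix: reduction and diagonal entries. -/

section Valuation

open Polynomial IsLocalRing

variable {m : ℕ}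

theorem map_aeval_blockMatrix {R S : Type*} [CommRing R] [CommRing S] (r : R →+* S)
    (e : Fin m → Fin m → R) (α : Finset (Fin m)) (y d : Fin m → R) (g : R[X]) :
    r.mapMatrix (aeval (blockMatrix e α y d) g) =
      aeval (blockMatrix (fun l k => r (e l k)) α (fun k => r (y k)) fun k => r (d k)) (g.map r) := by
  have h1 : r.mapMatrix (blockMatrix e α y d) =
      blockMatrix (fun l k => r (e l k)) α (fun k => r (y k)) fun k => r (d k) := by
    ext k l
    simp only [blockMatrix, RingHom.mapMatrix_apply, Matrix.map_apply, Matrix.of_apply]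
    split_ifs <;> simp
  rw [← h1]
  exact map_aeval_eq_aeval_map (by
    ext c i j
    by_cases h : i = j <;> simp [Matrix.algebraMap_matrix_apply, h]) g _

theorem map_aeval_blockMatrix_mulVec {R S : Type*} [CommRing R] [CommRing S] (r : R →+* S)
    (e : Fin m → Fin m → R) (α : Finset (Fin m)) (y d : Fin m → R) (g : R[X]) (p : Fin m → R)
    (k : Fin m) :
    r ((aeval (blockMatrix e α y d) g).mulVec p k) =
      (aeval (blockMatrix (fun l k => r (e l k)) α (fun k => r (y k)) fun k => r (d k))
        (g.map r)).mulVec (fun k => r (p k)) k := by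
  rw [← map_aeval_blockMatrix]
  exact RingHom.map_mulVec r _ _ k

/-- The diagonal entries of `F(N)`, where `N` has `k`-th column congruent to `- d k` modulo `y k`. -/
theorem exists_aeval_blockMatrix_apply_self {R : Type*} [CommRing R] (e : Fin m → Fin m → R)
    {α : Finset (Fin m)} (y d : Fin m → R) (F : R[X]) {k : Fin m} (hk : k ∈ α) :
    ∃ w, aeval (blockMatrix e α y d) F k k = F.eval (- d k) + y k * w := by
  have h1 : ∃ w : Fin m → R, (blockMatrix e α y d).mulVec (Pi.single k 1) =
      - d k • Pi.single k 1 + y k • w := by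
    refine ⟨fun j => if j ∈ α then e k j else 0, ?_⟩
    ext j
    rw [Matrix.mulVec_single_one]
    by_cases hj : j ∈ α
    · by_cases hjk : j = k
      · subst hjk
        simp [blockMatrix, hk]
        ring
      · simp [blockMatrix, hk, hj, hjk]
        ring
    · have : j ≠ k := fun h => hj (h ▸ hk)
      simp [blockMatrix, hj, this]
  obtain ⟨w, hw⟩ := h1
  have h2 : ∃ w : Fin m → R, (aeval (blockMatrix e α y d) F).mulVec (Pi.single k 1) =
      F.eval (- d k) • Pi.single k 1 + y k • w := by
    obtain ⟨q, hq⟩ := X_sub_C_dvd_sub_C_eval (a := - d k) (p := F)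
    refine ⟨(aeval (blockMatrix e α y d) q).mulVec w, ?_⟩
    have hF : aeval (blockMatrix e α y d) F = aeval (blockMatrix e α y d) q *
        (blockMatrix e α y d + d k • 1) + F.eval (- d k) • 1 := by
      conv_lhs => rw [eq_add_of_sub_eq hq, mul_comm (X - C _)]
      simp [Algebra.algebraMap_eq_smul_one]
    rw [hF, Matrix.add_mulVec, ← Matrix.mulVec_mulVec, Matrix.add_mulVec, hw, Matrix.smul_mulVec,
      Matrix.smul_mulVec, Matrix.one_mulVec, neg_smul, neg_add_eq_sub, sub_add_cancel,
      Matrix.mulVec_smul, add_comm]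
  obtain ⟨w, hw⟩ := h2
  refine ⟨w k, ?_⟩
  have := congrFun hw k
  rw [Matrix.mulVec_single_one] at this
  simpa using this

/-- If `I = {a}` and `a ∈ α` then the diagonal entries of `F(N)` are the values of `F` at those
of `N`. -/
theorem aeval_blockMatrix_apply_self {κ : Type*} [Field κ] {e : Fin m → Fin m → κ}
    (he : IsGenericMatrix e) {α : Finset (Fin m)} {a : Fin m} (ha : a ∈ α) {τ d : Fin m → κ}
    (hτ0 : ∀ l, l ≠ a → τ l = 0) (F : κ[X]) {k : Fin m} (hk : k ∈ α) :
    aeval (blockMatrix e α τ d) F k k = F.eval (- d k) := by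
  by_cases hka : k = a
  · subst hka
    obtain ⟨q, hq⟩ := X_sub_C_dvd_sub_C_eval (a := - d k) (p := F)
    have h1 := he.aeval_mul_X_add_C_mulVec (I := {k}) (d := d) ha (by simp) (by simpa using hτ0)
      (Pi.single k 1) q ha
    have h2 : (fun j => if j ∈ α then (Pi.single k 1 : Fin m → κ) j else 0) = Pi.single k 1 := by
      ext j
      by_cases hj : j = k
      · subst hj; simp [ha]
      · simp [hj]
    rw [h2, Matrix.mulVec_single_one, Matrix.col_apply] at h1
    rw [eq_add_of_sub_eq hq, mul_comm (X - C _), map_add, Matrix.add_apply, C_neg, sub_neg_eq_add, h1,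
      he.diag]
    simp [Matrix.algebraMap_matrix_apply]
  · obtain ⟨w, hw⟩ := exists_aeval_blockMatrix_apply_self e τ d F hk
    rw [hw, hτ0 k hka, zero_mul, add_zero]

end Valuation

end StructureConstants

namespace StructureConstants

/-! ### Rescaled vectors over a valuation ring. -/

section Localized

theorem mul_lt_one_of_lt_of_le_groupWithZero {Γ : Type*} [LinearOrderedCommGroupWithZero Γ]
    {a b : Γ} (ha : a < 1) (hb : b ≤ 1) : a * b < 1 :=
  (mul_le_of_le_one_right zero_le hb).trans_lt ha

theorem mul_lt_one_of_le_of_lt_groupWithZero {Γ : Type*} [LinearOrderedCommGroupWithZero Γ]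
    {a b : Γ} (ha : a ≤ 1) (hb : b < 1) : a * b < 1 :=
  (mul_le_of_le_one_left zero_le ha).trans_lt hb

open Polynomial IsLocalRing

variable {m : ℕ} {K : Type*} [Field K] (O : ValuationSubring K)

theorem exists_div_mem_valuationSubring {ι : Type*} (s : Finset ι) (u : ι → K)
    (h : ∃ k ∈ s, u k ≠ 0) : ∃ k₁ ∈ s, u k₁ ≠ 0 ∧ ∀ k ∈ s, u k / u k₁ ∈ O := by
  obtain ⟨k, hk, hk0⟩ := h
  obtain ⟨k₁, hk₁, hmax⟩ := s.exists_max_image (fun k => O.valuation (u k)) ⟨k, hk⟩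
  have h0 : u k₁ ≠ 0 := fun h0 => by
    have := hmax k hk
    rw [h0, map_zero, le_zero_iff, map_eq_zero] at this
    exact hk0 this
  refine ⟨k₁, hk₁, h0, fun k hk => ?_⟩
  rw [← O.valuation_le_one_iff, map_div₀]
  exact div_le_one_of_le₀ (hmax k hk) zero_le

theorem residue_eq_zero_iff_valuation (z : O) : residue O z = 0 ↔ O.valuation z < 1 := by
  rw [residue_eq_zero_iff, O.valuation_lt_one_iff]

theorem valuation_eq_one_of_residue_ne_zero {z : O} (h : residue O z ≠ 0) : O.valuation z = 1 :=
  (O.valuation_lt_one_or_eq_one z).resolve_left fun h' => h ((residue_eq_zero_iff_valuation O z).mpr h')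

variable {O}

/-- The data of the localized trace conditions at a vector `x`: `y` is the rescaled vector. -/
structure ScaledVector (O : ValuationSubring K) (e : Fin m → Fin m → O) (eps x : Fin m → K) (t : K)
    (y : Fin m → O) : Prop where
  generic : IsGenericMatrix fun l k => residue O (e l k)
  eps_ne_zero : ∀ l, eps l ≠ 0
  eps_injective : ∀ l l', O.valuation (eps l) = O.valuation (eps l') → l = l'
  t_ne_zero : t ≠ 0
  coe_y : ∀ l, (y l : K) = eps l * x l / t
  exists_ne_zero : ∃ l, residue O (y l) ≠ 0

variable {e : Fin m → Fin m → O} {eps x : Fin m → K} {t : K} {y : Fin m → O}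

/-- Both `eps l * x l` and `eps l' * x l'` have the valuation of `t`. Hence a class of equal
coordinates of `x` contains at most one index with nonzero residue of `y`. -/
theorem ScaledVector.eq_of_residue_ne_zero (h : ScaledVector O e eps x t y) {l l' : Fin m}
    (hl : residue O (y l) ≠ 0) (hl' : residue O (y l') ≠ 0) (hx : x l = x l') : l = l' := by
  have h1 := valuation_eq_one_of_residue_ne_zero O hl
  have h2 := valuation_eq_one_of_residue_ne_zero O hl'
  have hx0 : x l ≠ 0 := by
    intro h0
    rw [h.coe_y, h0, mul_zero, zero_div, map_zero] at h1
    exact zero_ne_one h1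
  refine h.eps_injective l l' ?_
  rw [← h2, h.coe_y, h.coe_y, ← hx, map_div₀, map_div₀, map_mul, map_mul] at h1
  have hv : O.valuation (x l) ≠ 0 := (_root_.map_ne_zero _).mpr hx0
  have ht : O.valuation t ≠ 0 := (_root_.map_ne_zero _).mpr h.t_ne_zero
  field_simp at h1
  exact h1

theorem ScaledVector.ne_zero (h : ScaledVector O e eps x t y) {l : Fin m}
    (hl : residue O (y l) ≠ 0) : x l ≠ 0 := by
  intro h0
  apply hl
  have : y l = 0 := Subtype.ext (by rw [h.coe_y, h0, mul_zero, zero_div]; rfl)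
  rw [this, map_zero]

/-- The diagonal of the matrix `N`, up to sign and scaling. -/
def blockDiag (e : Fin m → Fin m → O) (y : Fin m → O) (k : Fin m) : O := ∑ l, y l * e l k

theorem residue_blockDiag [DecidableEq (ResidueField O)] (k : Fin m) :
    residue O (blockDiag e y k) = ∑ l with residue O (y l) ≠ 0, residue O (y l) * residue O (e l k) := by
  rw [blockDiag, map_sum, Finset.sum_filter]
  refine Finset.sum_congr rfl fun l _ => ?_
  split_ifs with hl
  · rw [map_mul]
  · rw [map_mul, not_not.mp hl, zero_mul]

/-- Among the level set take `k₁` with the smallest `eps`, and test with a polynomial vanishing on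
the other levels. Terms inside the level set are small because of the ratio `eps k₁ / eps k`; terms
outside carry a factor `y k`, which this ratio turns into the small `y k₁`. So the term at `k₁` is
small too, and its polynomial factor is a unit. -/
theorem ScaledVector.exists_residue_eq_zero (h : ScaledVector O e eps x t y) (v : K)
    {α : Finset (Fin m)} (hα : ∀ k, k ∈ α ↔ x k = v) (c : Fin m → K)
    (hT : ∀ F : O[X], ∑ k ∈ α, c k * (aeval (blockMatrix e α y (blockDiag e y)) F k k : O) = 0)
    {s : K} (hs : s ≠ 0) (c' : Fin m → O) (hc' : ∀ k ∈ α, (c' k : K) = s * (eps k * c k))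
    {k₀ : Fin m} (hk₀ : k₀ ∈ α)
    (hI : ∀ k ∈ α, residue O (blockDiag e y k) = residue O (blockDiag e y k₀) → residue O (y k) = 0) :
    ∃ k ∈ α, residue O (blockDiag e y k) = residue O (blockDiag e y k₀) ∧ residue O (c' k) = 0 := by
  classical
  set d := blockDiag e y with hd
  set C := α.filter fun k => residue O (d k) = residue O (d k₀) with hC
  obtain ⟨k₁, hk₁C, hmin⟩ := C.exists_min_image (fun k => O.valuation (eps k))
    ⟨k₀, Finset.mem_filter.mpr ⟨hk₀, rfl⟩⟩
  obtain ⟨hk₁, hk₁d⟩ := Finset.mem_filter.mp hk₁C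
  refine ⟨k₁, hk₁, hk₁d, ?_⟩
  set F : O[X] := ∏ k ∈ α \ C, (X + Polynomial.C (d k)) with hF
  set N := blockMatrix e α y d with hN
  have hy₁ : O.valuation (y k₁) < 1 := (residue_eq_zero_iff_valuation O _).mp (hI k₁ hk₁ hk₁d)
  have hle : ∀ z : O, O.valuation z ≤ 1 := O.valuation_le_one
  have hterm : ∀ k ∈ α, k ≠ k₁ →
      O.valuation ((c' k : K) * (eps k₁ / eps k) * (aeval N F k k : O)) < 1 := by
    intro k hk hkk₁
    have he0 : O.valuation (eps k) ≠ 0 := (_root_.map_ne_zero _).mpr (h.eps_ne_zero k)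
    by_cases hkC : k ∈ C
    · have hlt : O.valuation (eps k₁ / eps k) < 1 := by
        rw [map_div₀, div_lt_one₀ (zero_lt_iff.mpr he0)]
        exact lt_of_le_of_ne (hmin k hkC) fun h' => hkk₁ (h.eps_injective _ _ h'.symm)
      rw [map_mul, map_mul]
      exact mul_lt_one_of_lt_of_le_groupWithZero (mul_lt_one_of_le_of_lt_groupWithZero (hle _) hlt) (hle _)
    · obtain ⟨w, hw⟩ := exists_aeval_blockMatrix_apply_self e y d F hk
      have hF0 : F.eval (- d k) = 0 := by
        rw [hF, eval_prod]
        exact Finset.prod_eq_zero (Finset.mem_sdiff.mpr ⟨hk, hkC⟩) (by simp)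
      rw [hF0, zero_add] at hw
      have hyy : (eps k₁ / eps k) * (y k : K) = y k₁ := by
        rw [h.coe_y, h.coe_y, (hα k).mp hk, (hα k₁).mp hk₁]
        have := h.eps_ne_zero k
        field_simp
      have : (c' k : K) * (eps k₁ / eps k) * (aeval N F k k : O) = c' k * (y k₁ * w) := by
        rw [hN, hw, ← hyy]
        push_cast
        ring
      rw [this, map_mul, map_mul]
      exact mul_lt_one_of_le_of_lt_groupWithZero (hle _) (mul_lt_one_of_lt_of_le_groupWithZero hy₁ (hle _))
  have hsum : ∑ k ∈ α, (c' k : K) * (eps k₁ / eps k) * (aeval N F k k : O) = 0 := by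
    rw [← mul_zero (s * eps k₁), ← hT F, Finset.mul_sum]
    refine Finset.sum_congr rfl fun k hk => ?_
    rw [hc' k hk]
    have := h.eps_ne_zero k
    field_simp
  rw [← Finset.add_sum_erase _ _ hk₁, div_self (h.eps_ne_zero k₁), mul_one] at hsum
  have hlt : O.valuation ((c' k₁ * aeval N F k₁ k₁ : O) : K) < 1 := by
    have : ((c' k₁ * aeval N F k₁ k₁ : O) : K) =
        -∑ k ∈ α.erase k₁, (c' k : K) * (eps k₁ / eps k) * (aeval N F k k : O) := by
      push_cast
      exact eq_neg_of_add_eq_zero_left hsum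
    rw [this, Valuation.map_neg]
    exact Valuation.map_sum_lt _ one_ne_zero fun k hk =>
      hterm k (Finset.mem_of_mem_erase hk) (Finset.ne_of_mem_erase hk)
  rw [← residue_eq_zero_iff_valuation, map_mul] at hlt
  refine (mul_eq_zero.mp hlt).resolve_right ?_
  obtain ⟨w, hw⟩ := exists_aeval_blockMatrix_apply_self e y d F hk₁
  rw [hN, hw, map_add, map_mul, hI k₁ hk₁ hk₁d, zero_mul, add_zero, hF, eval_prod, map_prod]
  refine Finset.prod_ne_zero_iff.mpr ?_
  intro k hk h0
  obtain ⟨hkα, hkC⟩ := Finset.mem_sdiff.mp hk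
  apply hkC
  refine Finset.mem_filter.mpr ⟨hkα, ?_⟩
  rw [eval_add, eval_X, eval_C, map_add, map_neg] at h0
  rw [← hk₁d]
  linear_combination h0

/-- With a single surviving index `a` the levels `d k` are pairwise distinct, and the diagonal of
`F(N)` reduces to `F (-d k)`; interpolation isolates each coordinate. -/
theorem ScaledVector.eq_zero_of_singleton (h : ScaledVector O e eps x t y)
    {α : Finset (Fin m)} (c : Fin m → K)
    (hT : ∀ F : O[X], ∑ k ∈ α, c k * (aeval (blockMatrix e α y (blockDiag e y)) F k k : O) = 0)
    {a : Fin m} (ha : a ∈ α) (hya : residue O (y a) ≠ 0) (hy : ∀ l, l ≠ a → residue O (y l) = 0) :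
    ∀ k ∈ α, c k = 0 := by
  classical
  by_contra! hne
  obtain ⟨k₁, hk₁, hck₁, hdiv⟩ := exists_div_mem_valuationSubring O α c hne
  set c' : Fin m → O := fun k => if hk : k ∈ α then ⟨c k / c k₁, hdiv k hk⟩ else 0 with hc'
  have hc'k : ∀ k ∈ α, (c' k : K) = c k / c k₁ := fun k hk => by simp [hc', hk]
  set d := fun k => residue O (blockDiag e y k) with hd
  have hdk : ∀ k, d k = residue O (y a) * residue O (e a k) := by
    intro k
    rw [hd]
    simp only [blockDiag, map_sum, map_mul]
    rw [Finset.sum_eq_single a (fun l _ hl => by rw [hy l hl, zero_mul]) (by simp)]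
  have hdinj : ∀ k k', d k = d k' → k = k' := by
    intro k k' hkk'
    by_contra hne
    have := h.generic.card_le (I := {a}) (C := {k, k'}) (by simp)
      (by intro i _ j _ hi hj; rw [Finset.mem_singleton.mp hi, Finset.mem_singleton.mp hj])
      (τ := fun _ => residue O (y a)) (by simpa using hya) (d := d k) (by
        intro j hj
        rw [Finset.sum_singleton, ← hdk]
        rcases Finset.mem_insert.mp hj with rfl | hj
        · rfl
        · rw [Finset.mem_singleton.mp hj, hkk'])
    rw [Finset.card_pair hne] at this
    simp at this
  have hTr : ∀ F : (ResidueField O)[X], ∑ k ∈ α, residue O (c' k) * F.eval (- d k) = 0 := by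
    intro F
    obtain ⟨F, rfl⟩ := Polynomial.map_surjective (residue O) residue_surjective F
    have h1 : ∑ k ∈ α, c' k * aeval (blockMatrix e α y (blockDiag e y)) F k k = 0 := by
      apply Subtype.ext
      push_cast
      rw [← mul_zero (c k₁)⁻¹, ← hT F, Finset.mul_sum]
      refine Finset.sum_congr rfl fun k hk => ?_
      rw [hc'k k hk]
      ring
    have h2 := congrArg (residue O) h1
    rw [map_zero, map_sum] at h2
    rw [← h2]
    refine Finset.sum_congr rfl fun k hk => ?_
    rw [map_mul]
    congr 1
    rw [← aeval_blockMatrix_apply_self h.generic ha hy _ hk, ← map_aeval_blockMatrix]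
    rfl
  have := hTr (∏ k ∈ α.erase k₁, (X + Polynomial.C (d k)))
  rw [Finset.sum_eq_single k₁] at this
  · have hc1 : c' k₁ = 1 := Subtype.ext (by rw [hc'k k₁ hk₁, div_self hck₁]; rfl)
    rw [hc1, map_one, one_mul, eval_prod, Finset.prod_eq_zero_iff] at this
    obtain ⟨k, hk, hk0⟩ := this
    rw [eval_add, eval_X, eval_C] at hk0
    exact Finset.ne_of_mem_erase hk (hdinj _ _ (by linear_combination hk0))
  · intro k hk hkk₁
    rw [eval_prod, Finset.prod_eq_zero (Finset.mem_erase.mpr ⟨hkk₁, hk⟩) (by simp), mul_zero]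
  · exact fun h => absurd hk₁ h

end Localized

end StructureConstants

namespace StructureConstants

/-! ### Vanishing of the solutions of the localized trace conditions. -/

section Localized

open Polynomial IsLocalRing

variable {m : ℕ} {K : Type*} [Field K] {O : ValuationSubring K}
  {e : Fin m → Fin m → O} {eps x : Fin m → K} {t : K} {y : Fin m → O}

theorem ScaledVector.residue_sum_filter [DecidableEq K] (h : ScaledVector O e eps x t y) {l : Fin m}
    (hl : residue O (y l) ≠ 0) (f : Fin m → O) :
    residue O (∑ l' with x l' = x l, y l' * f l') = residue O (y l) * residue O (f l) := by
  rw [map_sum, Finset.sum_eq_single l]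
  · rw [map_mul]
  · intro l' hl' hne
    rw [map_mul]
    by_cases h0 : residue O (y l') = 0
    · rw [h0, zero_mul]
    · exact absurd (h.eq_of_residue_ne_zero h0 hl (Finset.mem_filter.mp hl').2) hne
  · exact fun h0 => (h0 (by simp)).elim

theorem residue_aeval_blockMatrix_mulVec (α : Finset (Fin m)) (l : Fin m) (g : O[X]) (k : Fin m) :
    residue O ((aeval (blockMatrix e α y (blockDiag e y)) g).mulVec
      (fun k => if k ∈ α then e l k else 0) k) =
    (aeval (blockMatrix (fun l k => residue O (e l k)) α (fun k => residue O (y k))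
      fun k => residue O (blockDiag e y k)) (g.map (residue O))).mulVec
      (fun k => if k ∈ α then residue O (e l k) else 0) k := by
  rw [map_aeval_blockMatrix_mulVec]
  congr 1
  funext k
  split_ifs <;> simp

/-- The localized trace conditions at `x` for the class `α` of `v` have no nonzero solution. -/
theorem ScaledVector.eq_zero [DecidableEq K] (h : ScaledVector O e eps x t y) (v : K)
    {α : Finset (Fin m)} (hα : ∀ k, k ∈ α ↔ x k = v) (c : Fin m → K)
    (hT₁ : ∀ F : O[X], ∑ k ∈ α, c k * (aeval (blockMatrix e α y (blockDiag e y)) F k k : O) = 0)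
    (hT₂ : ∀ (g : O[X]) (w : K), w ≠ 0 → w ≠ v → ∑ k ∈ α, eps k * c k * ((∑ l with x l = w,
      y l * (e k l * (aeval (blockMatrix e α y (blockDiag e y)) g).mulVec
        (fun k => if k ∈ α then e l k else 0) k) : O) : K) = 0)
    (hT₃ : ∀ (g : O[X]) (w w' : K), w ≠ 0 → w' ≠ 0 → w ≠ v → w' ≠ v → w ≠ w' →
      ∑ k ∈ α, eps k * c k * ((∑ l with x l = w, y l * ∑ l' with x l' = w', y l' *
        (e l' l * (e k l' * (aeval (blockMatrix e α y (blockDiag e y)) g).mulVec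
        (fun k => if k ∈ α then e l k else 0) k)) : O) : K) = 0) :
    ∀ k ∈ α, c k = 0 := by
  classical
  by_contra! hne
  -- Normalize by the largest `eps k * c k`, so that the reduced solution is integral and nonzero.
  obtain ⟨k₁, hk₁, hck₁, hdiv⟩ := exists_div_mem_valuationSubring O α (fun k => eps k * c k) (by
    obtain ⟨k, hk, hk0⟩ := hne
    exact ⟨k, hk, mul_ne_zero (h.eps_ne_zero k) hk0⟩)
  set c' : Fin m → O := fun k =>
    if hk : k ∈ α then ⟨eps k * c k / (eps k₁ * c k₁), hdiv k hk⟩ else 0 with hc'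
  have hc'k : ∀ k ∈ α, (c' k : K) = (eps k₁ * c k₁)⁻¹ * (eps k * c k) := fun k hk => by
    simp [hc', hk, div_eq_inv_mul]
  have hc'1 : residue O (c' k₁) ≠ 0 := by
    have : c' k₁ = 1 := Subtype.ext (by rw [hc'k k₁ hk₁, inv_mul_cancel₀ hck₁]; rfl)
    rw [this, map_one]
    exact one_ne_zero
  have hscale : ∀ f : Fin m → O, ∑ k ∈ α, eps k * c k * (f k : K) = 0 →
      ∑ k ∈ α, residue O (c' k) * residue O (f k) = 0 := by
    intro f hf
    have h1 : ∑ k ∈ α, c' k * f k = 0 := by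
      apply Subtype.ext
      push_cast
      rw [← mul_zero (eps k₁ * c k₁)⁻¹, ← hf, Finset.mul_sum]
      refine Finset.sum_congr rfl fun k hk => ?_
      rw [hc'k k hk]
      ring
    simpa using congrArg (residue O) h1
  set I : Finset (Fin m) := {l | residue O (y l) ≠ 0} with hI
  have hImem : ∀ l, l ∈ I ↔ residue O (y l) ≠ 0 := fun l => by simp [hI]
  have hIne : I.Nonempty := h.exists_ne_zero.imp fun l hl => (hImem l).mpr hl
  -- In a sum over a class only its index in `I` survives reduction. Paths through one class give `l
  -- = l'`, paths through two classes give `l ≠ l'`.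
  have hT : ∀ g : (ResidueField O)[X], ∀ l ∈ I, ∀ l' ∈ I, l ∉ α → l' ∉ α →
      ∑ k ∈ α, residue O (c' k) * residue O (e k l') *
        (aeval (blockMatrix (fun l k => residue O (e l k)) α (fun k => residue O (y k))
          fun k => residue O (blockDiag e y k)) g).mulVec
          (fun k => if k ∈ α then residue O (e l k) else 0) k = 0 := by
    intro g l hl l' hl' hlα hl'α
    obtain ⟨g, rfl⟩ := Polynomial.map_surjective (residue O) residue_surjective g
    rw [hImem] at hl hl'
    rw [hα] at hlα hl'α
    simp only [← residue_aeval_blockMatrix_mulVec]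
    by_cases hw : x l = x l'
    · obtain rfl := h.eq_of_residue_ne_zero hl hl' hw
      have := hscale _ (hT₂ g (x l) (h.ne_zero hl) hlα)
      simp only [h.residue_sum_filter hl, map_mul (residue O) (e _ l)] at this
      refine (mul_eq_zero.mp ?_).resolve_left hl
      rw [← this, Finset.mul_sum]
      exact Finset.sum_congr rfl fun k _ => by ring
    · have := hscale _ (hT₃ g (x l) (x l') (h.ne_zero hl) (h.ne_zero hl') hlα hl'α hw)
      simp only [h.residue_sum_filter hl, h.residue_sum_filter hl', map_mul (residue O) (e _ _)] at this
      have he : residue O (e l' l) ≠ 0 := h.generic.ne_zero fun h => hw (h ▸ rfl)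
      refine (mul_eq_zero.mp ?_).resolve_left (mul_ne_zero (mul_ne_zero hl hl') he)
      rw [← this, Finset.mul_sum]
      exact Finset.sum_congr rfl fun k _ => by ring
  have hτ : ∀ l ∈ I, residue O (y l) ≠ 0 := fun l => (hImem l).mp
  have hτ0 : ∀ l, l ∉ I → residue O (y l) = 0 := fun l hl => not_not.mp fun h' => hl ((hImem l).mpr h')
  have hd : ∀ k, residue O (blockDiag e y k) = ∑ l ∈ I, residue O (y l) * residue O (e l k) :=
    fun k => residue_blockDiag k
  -- Three cases: `α` misses `I`; it meets `I` in one index but does not contain it; or `I` is a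
  -- single index of `α`.
  by_cases hdisj : ∀ k ∈ α, k ∉ I
  · exact hc'1 (h.generic.eq_zero_of_disjoint hIne hdisj (c := fun k => residue O (c' k))
      hτ hτ0 hd hT k₁ hk₁)
  · push Not at hdisj
    obtain ⟨a, haα, haI⟩ := hdisj
    have hIα : ∀ k ∈ α, k ∈ I → k = a := fun k hk hkI =>
      h.eq_of_residue_ne_zero (hτ k hkI) (hτ a haI) (by rw [(hα k).mp hk, (hα a).mp haα])
    by_cases hI' : ∃ l ∈ I, l ∉ α
    · refine hc'1 (h.generic.eq_zero_of_mem haα haI hIα hI' (c := fun k => residue O (c' k))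
        hτ hτ0 hd hT (fun k hk hka => ?_) k₁ hk₁)
      refine h.exists_residue_eq_zero v hα c hT₁ (inv_ne_zero hck₁) c' hc'k hk fun k' hk' hdk' => ?_
      refine hτ0 k' fun hk'I => hka ?_
      rw [← hdk', hIα k' hk' hk'I]
    · push Not at hI'
      refine hck₁ ?_
      rw [h.eq_zero_of_singleton c hT₁ haα (hτ a haI)
        (fun l hl => hτ0 l fun hlI => hl (hIα l (hI' l hlI) hlI)) k₁ hk₁, mul_zero]

end Localized

end StructureConstants

namespace StructureConstants

/-! ### The algebra generated by the pencil. -/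

section PencilAlgebra

open Polynomial

variable {m : ℕ} {K R : Type*} [Field K] [CommRing R] [Algebra K R]

/-- The algebra generated by the matrices `diag z` and `diag z * E - diag (E z)`. -/
def pencilAlgebra (E : Matrix (Fin m) (Fin m) K) (z : Fin m → R) :
    Subalgebra K (Matrix (Fin m) (Fin m) R) :=
  Algebra.adjoin K {Matrix.diagonal z, pencilMatrix (E.map (algebraMap K R)) z}

theorem map_trace_eq_zero_of_mem_pencilAlgebra {E : Matrix (Fin m) (Fin m) K} {z : Fin m → R}
    (φ : R →ₗ[K] K) (h : ∀ w, φ (pencilWord (E.map (algebraMap K R)) z w).trace = 0)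
    {M : Matrix (Fin m) (Fin m) R} (hM : M ∈ pencilAlgebra E z) : φ M.trace = 0 := by
  rw [pencilAlgebra, ← Subalgebra.mem_toSubmodule, Algebra.adjoin_eq_span] at hM
  induction hM using Submodule.span_induction with
  | mem M hM =>
    obtain ⟨l, hl, rfl⟩ := Submonoid.exists_list_of_mem_closure hM
    suffices ∃ w, l.prod = pencilWord (E.map (algebraMap K R)) z w by
      obtain ⟨w, hw⟩ := this
      rw [hw, h]
    clear hM
    induction l with
    | nil => exact ⟨[], by simp [pencilWord]⟩
    | cons A l ih =>
      obtain ⟨w, hw⟩ := ih fun B hB => hl B (List.mem_cons_of_mem _ hB)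
      rcases hl A List.mem_cons_self with hA | hA
      · exact ⟨false :: w, by rw [List.prod_cons, hw, hA]; simp [pencilWord]⟩
      · exact ⟨true :: w, by rw [List.prod_cons, hw, hA]; simp [pencilWord]⟩
  | zero => simp
  | add M M' _ _ hM hM' => rw [Matrix.trace_add, map_add, hM, hM', add_zero]
  | smul a M _ hM => rw [Matrix.trace_smul, map_smul, hM, smul_zero]

theorem diagonal_aeval_mem_pencilAlgebra (E : Matrix (Fin m) (Fin m) K) (z : Fin m → R) (h : K[X]) :
    Matrix.diagonal (fun k => aeval (z k) h) ∈ pencilAlgebra E z := by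
  have h1 : Matrix.diagonal (fun k => aeval (z k) h) = aeval (Matrix.diagonal z) h := by
    have := aeval_algHom_apply (Matrix.diagonalAlgHom (n := Fin m) (α := R) K) z h
    rw [Matrix.diagonalAlgHom_apply] at this
    rw [this, Matrix.diagonalAlgHom_apply]
    congr 1
    funext k
    exact (congrFun (aeval_pi_apply (R := K) z h) k).symm
  rw [h1]
  exact Algebra.adjoin_mono (by simp) (aeval_mem_adjoin_singleton K _)

theorem pencilMatrix_mem_pencilAlgebra (E : Matrix (Fin m) (Fin m) K) (z : Fin m → R) :
    pencilMatrix (E.map (algebraMap K R)) z ∈ pencilAlgebra E z :=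
  Algebra.subset_adjoin (by simp)

theorem exists_polynomial_eval_eq_ite {ι : Type*} [Finite ι] [DecidableEq K] (x : ι → K) (v : K) :
    ∃ h : K[X], ∀ k, h.eval (x k) = if x k = v then 1 else 0 := by
  have := Fintype.ofFinite ι
  refine ⟨Lagrange.interpolate (Finset.univ.image x) id fun u => if u = v then 1 else 0, fun k => ?_⟩
  exact Lagrange.eval_interpolate_at_node _ (Set.injOn_id _) (Finset.mem_image_of_mem x (Finset.mem_univ k))

end PencilAlgebra

end StructureConstants

namespace StructureConstants

/-! ### Infinitesimal matrices in the pencil algebra over the dual numbers. -/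

section Tangent

open Polynomial

variable {m : ℕ} {K : Type*} [Field K]

/-- The point `x + ε y` over the dual numbers. -/
def tangentVector (x y : Fin m → K) : Fin m → DualNumber K :=
  fun p => TrivSqZeroExt.inl (x p) + TrivSqZeroExt.inr (y p)

/-- The matrices `θ` such that `ε θ` lies in the pencil algebra at `x + ε y`. -/
def tangentMatrices (E : Matrix (Fin m) (Fin m) K) (x y : Fin m → K) :
    Set (Matrix (Fin m) (Fin m) K) :=
  {θ | θ.map TrivSqZeroExt.inr ∈ pencilAlgebra E (tangentVector x y)}

variable {E : Matrix (Fin m) (Fin m) K} {x y : Fin m → K}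

/-- Generators reduce to generators, so every element lifts; `tangentMatrices` is therefore closed
under multiplication by the pencil algebra on both sides. -/
theorem exists_map_fst_eq_of_mem_pencilAlgebra (y : Fin m → K) {A : Matrix (Fin m) (Fin m) K}
    (hA : A ∈ pencilAlgebra E x) :
    ∃ B ∈ pencilAlgebra E (tangentVector x y), B.map TrivSqZeroExt.fst = A := by
  have h1 : (pencilAlgebra E (tangentVector x y)).map
      (TrivSqZeroExt.fstHom K K K).mapMatrix = pencilAlgebra E x := by
    rw [pencilAlgebra, AlgHom.map_adjoin, pencilAlgebra, Set.image_pair]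
    congr 2
    · ext i j
      by_cases h : i = j <;> simp [h, tangentVector]
    · congr 1
      ext i j
      simp [pencilMatrix, Matrix.diagonal_apply, Matrix.mulVec, dotProduct, tangentVector]
      split_ifs <;> simp [TrivSqZeroExt.fst_sum, TrivSqZeroExt.algebraMap_eq_inl]
  rw [← h1] at hA
  exact hA

theorem mul_mem_tangentMatrices {A θ : Matrix (Fin m) (Fin m) K} (hA : A ∈ pencilAlgebra E x)
    (hθ : θ ∈ tangentMatrices E x y) : A * θ ∈ tangentMatrices E x y := by
  obtain ⟨B, hB, rfl⟩ := exists_map_fst_eq_of_mem_pencilAlgebra y hA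
  have : (B.map TrivSqZeroExt.fst * θ).map TrivSqZeroExt.inr =
      B * θ.map (TrivSqZeroExt.inr : K → DualNumber K) := by
    ext i j
    · simp [Matrix.mul_apply, TrivSqZeroExt.fst_sum]
    · simp [Matrix.mul_apply, TrivSqZeroExt.snd_sum, mul_comm]
  rw [tangentMatrices, Set.mem_ofPred_eq, this]
  exact mul_mem hB hθ

theorem tangentMatrices_mul_mem {A θ : Matrix (Fin m) (Fin m) K} (hA : A ∈ pencilAlgebra E x)
    (hθ : θ ∈ tangentMatrices E x y) : θ * A ∈ tangentMatrices E x y := by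
  obtain ⟨B, hB, rfl⟩ := exists_map_fst_eq_of_mem_pencilAlgebra y hA
  have : (θ * B.map TrivSqZeroExt.fst).map TrivSqZeroExt.inr =
      θ.map (TrivSqZeroExt.inr : K → DualNumber K) * B := by
    ext i j
    · simp [Matrix.mul_apply, TrivSqZeroExt.fst_sum]
    · simp [Matrix.mul_apply, TrivSqZeroExt.snd_sum, mul_comm]
  rw [tangentMatrices, Set.mem_ofPred_eq, this]
  exact mul_mem hθ hB

theorem trace_eq_zero_of_mem_tangentMatrices
    (h : ∀ w, (pencilWord (E.map (algebraMap K (DualNumber K)))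
      (tangentVector x y) w).trace.snd = 0) {θ : Matrix (Fin m) (Fin m) K}
    (hθ : θ ∈ tangentMatrices E x y) : θ.trace = 0 := by
  have := map_trace_eq_zero_of_mem_pencilAlgebra (TrivSqZeroExt.sndHom K K) h hθ
  simpa [Matrix.trace, TrivSqZeroExt.snd_sum] using this

theorem aeval_tangentVector (h : K[X]) (k : Fin m) :
    aeval (tangentVector x y k) h =
      TrivSqZeroExt.inl (h.eval (x k)) + TrivSqZeroExt.inr (h.derivative.eval (x k) * y k) := by
  have h1 : ∀ g : K[X], aeval (TrivSqZeroExt.inl (x k) : DualNumber K) g =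
      TrivSqZeroExt.inl (g.eval (x k)) := fun g => by
    rw [← TrivSqZeroExt.inlAlgHom_apply K, aeval_algHom_apply]
    simp
  rw [tangentVector, aeval_add_of_sq_eq_zero, h1, h1]
  · ext <;> simp [mul_comm]
  · rw [sq, TrivSqZeroExt.inr_mul_inr]

variable [DecidableEq K]

theorem exists_polynomial_idempotent (x : Fin m → K) (v : K) :
    ∃ h : K[X], ∀ k, h.eval (x k) = (if x k = v then 1 else 0) ∧ h.derivative.eval (x k) = 0 := by
  obtain ⟨l, hl⟩ := exists_polynomial_eval_eq_ite x v
  -- The polynomial `3 l² - 2 l³` fixes `0` and `1` and has zero derivative at both, so the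
  -- idempotents of the classes of `x` lift without an `ε`-part.
  refine ⟨C 3 * l ^ 2 - C 2 * l ^ 3, fun k => ?_⟩
  simp only [eval_sub, eval_mul, eval_pow, eval_C, derivative_sub, derivative_mul, derivative_C,
    derivative_pow, hl, zero_mul, zero_add]
  split_ifs
  · constructor
    · norm_num
    · norm_num
      ring
  · constructor <;> norm_num

theorem diagonal_inl_mem_pencilAlgebra (E : Matrix (Fin m) (Fin m) K) (x y : Fin m → K) (v : K) :
    Matrix.diagonal (fun k => TrivSqZeroExt.inl (if x k = v then 1 else 0)) ∈
      pencilAlgebra E (tangentVector x y) := by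
  obtain ⟨h, hh⟩ := exists_polynomial_idempotent x v
  have := diagonal_aeval_mem_pencilAlgebra E (tangentVector x y) h
  simpa [aeval_tangentVector, hh] using this

theorem diagonal_mem_pencilAlgebra (E : Matrix (Fin m) (Fin m) K) (x : Fin m → K) (v : K) :
    Matrix.diagonal (fun k => if x k = v then 1 else 0) ∈ pencilAlgebra E x := by
  obtain ⟨h, hh⟩ := exists_polynomial_eval_eq_ite x v
  have := diagonal_aeval_mem_pencilAlgebra E x h
  simpa [hh] using this

theorem diagonal_mem_tangentMatrices (E : Matrix (Fin m) (Fin m) K) (x y : Fin m → K) (v : K) :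
    Matrix.diagonal (fun k => if x k = v then y k else 0) ∈ tangentMatrices E x y := by
  obtain ⟨h, hh⟩ := exists_polynomial_idempotent x v
  have h1 := diagonal_aeval_mem_pencilAlgebra E (tangentVector x y) ((X - C v) * h)
  rw [tangentMatrices, Set.mem_ofPred_eq]
  convert h1 using 1
  ext i j
  · by_cases hij : i = j
    · subst hij
      by_cases hv : x i = v <;> simp [aeval_tangentVector, hh, hv, -map_mul, -map_sub]
    · simp [hij]
  · by_cases hij : i = j
    · subst hij
      by_cases hv : x i = v <;> simp [aeval_tangentVector, hh, hv, -map_mul, -map_sub]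
    · simp [hij]

/-- Rows with `x k = 0` of the off-diagonal part of the pencil start at order `ε`. This serves the
class of `0`, where one cannot divide by the value of `x`. -/
theorem diagonal_mul_mem_tangentMatrices (E : Matrix (Fin m) (Fin m) K) (x y : Fin m → K) {w : K}
    (hw : w ≠ 0) : (Matrix.of fun k l => if x k = 0 ∧ x l = w then y k * E k l else 0) ∈
      tangentMatrices E x y := by
  have h1 := mul_mem (mul_mem (diagonal_inl_mem_pencilAlgebra E x y 0)
    (pencilMatrix_mem_pencilAlgebra E (tangentVector x y))) (diagonal_inl_mem_pencilAlgebra E x y w)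
  rw [tangentMatrices, Set.mem_ofPred_eq]
  convert h1 using 1
  have hkl : ∀ k l, x k = 0 → x l = w → k ≠ l := fun k l hk hl h => hw (by rw [← hl, ← h, hk])
  ext k l
  · by_cases hk : x k = 0
    · by_cases hl : x l = w
      · simp [hk, hl, pencilMatrix, tangentVector, hkl k l hk hl]
      · simp [hl]
    · simp [hk]
  · by_cases hk : x k = 0
    · by_cases hl : x l = w
      · simp [hk, hl, pencilMatrix, tangentVector, hkl k l hk hl, TrivSqZeroExt.algebraMap_eq_inl]
      · simp [hl]
    · simp [hk]

end Tangent

end StructureConstants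

namespace StructureConstants

/-! ### Separation of tangent vectors at nonzero points. -/

section Immersion

open Polynomial IsLocalRing

variable {m : ℕ} {K : Type*} [Field K]

theorem pencilMatrix_apply_of_ne {R : Type*} [CommRing R] (E : Matrix (Fin m) (Fin m) R)
    (x : Fin m → R) {i j : Fin m} (h : i ≠ j) : pencilMatrix E x i j = x i * E i j := by
  simp [pencilMatrix, h]

theorem pencilMatrix_apply_self {R : Type*} [CommRing R] {E : Matrix (Fin m) (Fin m) R}
    (x : Fin m → R) {i : Fin m} (h : E i i = 0) : pencilMatrix E x i i = - ∑ j, E i j * x j := by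
  simp [pencilMatrix, h, Matrix.mulVec, dotProduct]

variable {O : ValuationSubring K}

/-- The matrix with entries `e l k`, scaled by the weights `eps l` of the columns. -/
def weightedMatrix (e : Fin m → Fin m → O) (eps : Fin m → K) : Matrix (Fin m) (Fin m) K :=
  Matrix.of fun k l => eps l * e l k

variable {e : Fin m → Fin m → O} {eps x : Fin m → K} {t : K} {y : Fin m → O}

theorem exists_scaledVector (hgen : IsGenericMatrix fun l k => residue O (e l k))
    (heps : ∀ l, eps l ≠ 0) (hinj : ∀ l l', O.valuation (eps l) = O.valuation (eps l') → l = l')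
    (hx : x ≠ 0) : ∃ t y, ScaledVector O e eps x t y := by
  obtain ⟨l, hl⟩ := Function.ne_iff.mp hx
  obtain ⟨l₁, -, hl₁, hdiv⟩ := exists_div_mem_valuationSubring O Finset.univ (fun l => eps l * x l)
    ⟨l, Finset.mem_univ _, mul_ne_zero (heps l) hl⟩
  refine ⟨eps l₁ * x l₁, fun l => ⟨_, hdiv l (Finset.mem_univ _)⟩, hgen, heps, hinj, hl₁,
    fun l => rfl, l₁, ?_⟩
  have : (⟨_, hdiv l₁ (Finset.mem_univ _)⟩ : O) = 1 := Subtype.ext (div_self hl₁)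
  simp only [this, map_one]
  exact one_ne_zero

/-- Inside a class `x k = x l`, so the row factor of the pencil can be traded for the column factor
`eps l * x l = t * y l`. Compress by the idempotent of the class and divide by `t`. -/
theorem blockMatrix_map_mem_pencilAlgebra [DecidableEq K] (hdiag : ∀ l, e l l = 0) (ht : t ≠ 0)
    (hy : ∀ l, (y l : K) = eps l * x l / t) {v : K} {α : Finset (Fin m)}
    (hα : ∀ k, k ∈ α ↔ x k = v) :
    blockMatrix (fun l k => O.subtype (e l k)) α (fun k => O.subtype (y k))
      (fun k => O.subtype (blockDiag e y k)) ∈ pencilAlgebra (weightedMatrix e eps) x := by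
  have h1 := pencilMatrix_mem_pencilAlgebra (weightedMatrix e eps) x
  have h2 := diagonal_mem_pencilAlgebra (weightedMatrix e eps) x v
  have h3 := Subalgebra.smul_mem _ (mul_mem (mul_mem h2 h1) h2) t⁻¹
  convert h3 using 1
  ext k l
  rw [Matrix.smul_apply, Matrix.mul_diagonal, Matrix.diagonal_mul, blockMatrix, Matrix.of_apply]
  have hid : (weightedMatrix e eps).map (algebraMap K K) = weightedMatrix e eps := by
    ext; simp
  rw [hid]
  by_cases hk : x k = v
  · by_cases hl : x l = v
    · rw [if_pos ⟨(hα k).mpr hk, (hα l).mpr hl⟩]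
      by_cases hkl : k = l
      · subst hkl
        rw [pencilMatrix_apply_self x (by simp [weightedMatrix, hdiag]), hdiag, if_pos rfl, if_pos hk]
        simp only [map_zero, zero_mul, zero_sub, one_mul, mul_one, smul_eq_mul, mul_neg,
          Finset.mul_sum, blockDiag, map_sum, map_mul]
        refine congrArg Neg.neg (Finset.sum_congr rfl fun j _ => ?_)
        simp only [weightedMatrix, Matrix.of_apply, ValuationSubring.subtype_apply, hy]
        field_simp
      · rw [pencilMatrix_apply_of_ne _ _ hkl, if_neg hkl, if_pos hk, if_pos hl, hk, ← hl]
        simp only [weightedMatrix, Matrix.of_apply, ValuationSubring.subtype_apply, hy, smul_eq_mul]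
        field_simp
        ring
    · simp [hα, hl]
  · simp [hα, hk]

theorem aeval_blockMatrix_map_mem_pencilAlgebra [DecidableEq K] (hdiag : ∀ l, e l l = 0)
    (ht : t ≠ 0) (hy : ∀ l, (y l : K) = eps l * x l / t) {v : K} {α : Finset (Fin m)}
    (hα : ∀ k, k ∈ α ↔ x k = v) (g : O[X]) :
    (aeval (blockMatrix e α y (blockDiag e y)) g).map O.subtype ∈
      pencilAlgebra (weightedMatrix e eps) x := by
  have := map_aeval_blockMatrix O.subtype e α y (blockDiag e y) g
  rw [RingHom.mapMatrix_apply] at this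
  rw [this]
  exact Algebra.adjoin_le (by simpa using blockMatrix_map_mem_pencilAlgebra hdiag ht hy hα)
    (aeval_mem_adjoin_singleton K _)

/-- For `v ≠ 0`, compose `diag η` on the class of `v` with `g(N)` and with the block of the pencil
from `v` to `w`, divided by `v`. For `v = 0` use the first-order block instead; `y` vanishes on the
class, so `g(N)` is diagonal there and commutes with `diag η`. -/
theorem mem_tangentMatrices_of_classes [DecidableEq K] (hdiag : ∀ l, e l l = 0)
    (ht : t ≠ 0) (hy : ∀ l, (y l : K) = eps l * x l / t) (η : Fin m → K) {v : K}
    {α : Finset (Fin m)} (hα : ∀ k, k ∈ α ↔ x k = v) (g : O[X]) {w : K} (hw : w ≠ 0) (hwv : w ≠ v) :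
    (Matrix.of fun k l => if x k = v ∧ x l = w then η k * (eps l *
      ((aeval (blockMatrix e α y (blockDiag e y)) g).mulVec
        (fun k => if k ∈ α then e l k else 0) k : O)) else 0) ∈
      tangentMatrices (weightedMatrix e eps) x η := by
  have hG := aeval_blockMatrix_map_mem_pencilAlgebra (eps := eps) hdiag ht hy hα g
  set G := aeval (blockMatrix e α y (blockDiag e y)) g with hGdef
  have hv := diagonal_mem_pencilAlgebra (weightedMatrix e eps) x v
  have hw' := diagonal_mem_pencilAlgebra (weightedMatrix e eps) x w
  have hid : (weightedMatrix e eps).map (algebraMap K K) = weightedMatrix e eps := by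
    ext; simp
  have hN := pencilMatrix_mem_pencilAlgebra (weightedMatrix e eps) x
  rw [hid] at hN
  by_cases hv0 : v = 0
  · subst hv0
    have h1 := mul_mem_tangentMatrices hv (mul_mem_tangentMatrices hG
      (diagonal_mul_mem_tangentMatrices (weightedMatrix e eps) x η hw))
    convert h1 using 1
    ext k l
    rw [Matrix.diagonal_mul, Matrix.mul_apply, Matrix.of_apply]
    by_cases hk : x k = 0
    swap
    · simp [hk]
    by_cases hl : x l = w
    swap
    · simp [hl]
    have hyα : ∀ l ∈ α, y l = 0 := fun l hl => Subtype.ext (by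
      rw [hy, (hα l).mp hl, mul_zero, zero_div]; rfl)
    have h2 := aeval_blockMatrix_mulVec e α y (blockDiag e y)
      (fun k => if k ∈ α then e l k else 0) (fun k hk => if_neg hk)
      (fun l hl => by rw [hyα l hl, zero_mul]) g
    have h3 := aeval_blockMatrix_mulVec (fun l k => O.subtype (e l k)) α
      (fun k => O.subtype (y k)) (fun k => O.subtype (blockDiag e y k))
      (fun k => if k ∈ α then η k * (eps l * e l k) else 0) (fun k hk => if_neg hk)
      (fun l hl => by simp [hyα l hl]) (g.map O.subtype)
    rw [← map_aeval_blockMatrix, ← hGdef] at h3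
    have h4 := congrFun h3 k
    rw [h2, if_pos ⟨hk, hl⟩, if_pos hk, one_mul]
    simp only [Matrix.mulVec, dotProduct, (hα k).mpr hk, if_true] at h4 ⊢
    rw [← map_neg, eval_map_apply] at h4
    have h5 : ∀ j, (if x j = 0 ∧ x l = w then η j * weightedMatrix e eps j l else 0) =
        if j ∈ α then η j * (eps l * e l j) else 0 := fun j => by
      simp [hl, hα, weightedMatrix]
    simp only [Matrix.of_apply, h5]
    refine Eq.trans ?_ h4.symm
    push_cast
    simp only [ValuationSubring.subtype_apply]
    ring
  · have h1 := tangentMatrices_mul_mem (mul_mem hG (mul_mem hv (mul_mem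
      (Subalgebra.smul_mem _ hN v⁻¹) hw'))) (diagonal_mem_tangentMatrices (weightedMatrix e eps) x η v)
    convert h1 using 1
    ext k l
    rw [Matrix.diagonal_mul, Matrix.mul_apply, Matrix.of_apply]
    by_cases hk : x k = v
    swap
    · simp [hk]
    by_cases hl : x l = w
    swap
    · simp [hl]
    rw [if_pos ⟨hk, hl⟩, if_pos hk]
    congr 1
    rw [Matrix.mulVec, dotProduct]
    push_cast
    rw [Finset.mul_sum]
    refine Finset.sum_congr rfl fun j _ => ?_
    rw [Matrix.diagonal_mul, Matrix.mul_diagonal, Matrix.smul_apply, Matrix.map_apply, if_pos hl]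
    by_cases hj : x j = v
    · have hjl : j ≠ l := fun h => hwv (by rw [← hl, ← h, hj])
      rw [pencilMatrix_apply_of_ne _ _ hjl, if_pos hj, if_pos ((hα j).mpr hj), hj]
      simp only [weightedMatrix, Matrix.of_apply, ValuationSubring.subtype_apply, smul_eq_mul]
      field_simp
    · simp [hj, hα]

theorem weightedMatrix_immersion [DecidableEq K]
    (hgen : IsGenericMatrix fun l k => residue O (e l k)) (hdiag : ∀ l, e l l = 0)
    (heps : ∀ l, eps l ≠ 0) (hinj : ∀ l l', O.valuation (eps l) = O.valuation (eps l') → l = l')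
    (x η : Fin m → K) (hx : x ≠ 0) (hη : η ≠ 0) :
    ∃ w, (pencilWord ((weightedMatrix e eps).map (algebraMap K (DualNumber K)))
      (tangentVector x η) w).trace.snd ≠ 0 := by
  -- The trace then kills all `tangentMatrices`. Closing up paths that leave the class of `v`
  -- through no, one or two other classes gives the three families of conditions of
  -- `ScaledVector.eq_zero`.
  by_contra! hnull
  obtain ⟨t, y, h⟩ := exists_scaledVector hgen heps hinj hx
  have ht := h.t_ne_zero
  have hy := h.coe_y
  obtain ⟨k₀, hk₀⟩ := Function.ne_iff.mp hη
  have hN := pencilMatrix_mem_pencilAlgebra (weightedMatrix e eps) x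
  have hid : (weightedMatrix e eps).map (algebraMap K K) = weightedMatrix e eps := by
    ext; simp
  rw [hid] at hN
  set v := x k₀ with hv
  have hα : ∀ k, k ∈ ({k | x k = v} : Finset (Fin m)) ↔ x k = v := fun k => by simp
  refine hk₀ (h.eq_zero v hα η ?_ ?_ ?_ k₀ ((hα _).mpr rfl))
  · intro F
    have := trace_eq_zero_of_mem_tangentMatrices hnull (tangentMatrices_mul_mem
      (aeval_blockMatrix_map_mem_pencilAlgebra (eps := eps) hdiag ht hy hα F)
      (diagonal_mem_tangentMatrices (weightedMatrix e eps) x η v))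
    rw [← this, Matrix.trace, Finset.sum_filter]
    refine Finset.sum_congr rfl fun k _ => ?_
    rw [Matrix.diag_apply, Matrix.diagonal_mul]
    split_ifs <;> simp
  · intro g w hw hwv
    have hΘ := mem_tangentMatrices_of_classes (eps := eps) hdiag ht hy η hα g hw hwv
    have := trace_eq_zero_of_mem_tangentMatrices hnull (tangentMatrices_mul_mem hN hΘ)
    rw [← mul_zero t⁻¹, ← this, Matrix.trace, Finset.mul_sum, Finset.sum_filter]
    refine Finset.sum_congr rfl fun k _ => ?_
    rw [Matrix.diag_apply, Matrix.mul_apply]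
    split_ifs with hk
    · push_cast
      rw [Finset.mul_sum, Finset.mul_sum, Finset.sum_filter]
      refine Finset.sum_congr rfl fun l _ => ?_
      rw [Matrix.of_apply]
      split_ifs with hl hl' hl'
      · have hlk : l ≠ k := fun h => hwv (by rw [← hl, h, hk])
        rw [pencilMatrix_apply_of_ne _ _ hlk, hy, weightedMatrix, Matrix.of_apply]
        field_simp
      · exact absurd ⟨hk, hl⟩ hl'
      · exact absurd hl'.2 hl
      · simp
    · simp [hk]
  · intro g w w' hw hw' hwv hw'v hww'
    have hΘ := mem_tangentMatrices_of_classes (eps := eps) hdiag ht hy η hα g hw hwv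
    have := trace_eq_zero_of_mem_tangentMatrices hnull (tangentMatrices_mul_mem
      (mul_mem hN (mul_mem (diagonal_mem_pencilAlgebra (weightedMatrix e eps) x w') hN)) hΘ)
    rw [← mul_zero (t⁻¹ * t⁻¹), ← this, Matrix.trace, Finset.mul_sum, Finset.sum_filter]
    refine Finset.sum_congr rfl fun k _ => ?_
    rw [Matrix.diag_apply, Matrix.mul_apply]
    split_ifs with hk
    · push_cast
      rw [Finset.mul_sum, Finset.mul_sum, Finset.sum_filter]
      refine Finset.sum_congr rfl fun l _ => ?_
      rw [Matrix.of_apply]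
      split_ifs with hl hl' hl'
      · rw [Matrix.mul_apply]
        simp only [Finset.mul_sum]
        rw [Finset.sum_filter]
        refine Finset.sum_congr rfl fun l' _ => ?_
        rw [Matrix.diagonal_mul]
        split_ifs with hl''
        · have hlk : l' ≠ k := fun h => hw'v (by rw [← hl'', h, hk])
          have hll : l ≠ l' := fun h => hww' (by rw [← hl, h, hl''])
          rw [pencilMatrix_apply_of_ne _ _ hlk, pencilMatrix_apply_of_ne _ _ hll, hy, hy,
            weightedMatrix, Matrix.of_apply, Matrix.of_apply]
          field_simp
        · simp
      · exact absurd ⟨hk, hl⟩ hl'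
      · exact absurd hl'.2 hl
      · simp
    · simp [hk]

end Immersion

end StructureConstants

namespace StructureConstants

/-! ### Comparing the pencil at two points. -/

section Separation

open Polynomial IsLocalRing

variable {m : ℕ} {K : Type*} [Field K]

/-- `A` and `B` are obtained in the same way from the two matrices of the pencil, at the points
`x` and `x'`. -/
def PairedMatrices (E : Matrix (Fin m) (Fin m) K) (x x' : Fin m → K)
    (A B : Matrix (Fin m) (Fin m) K) : Prop :=
  ∃ M ∈ pencilAlgebra E (fun k => (x k, x' k)), M.map Prod.fst = A ∧ M.map Prod.snd = B

variable {E : Matrix (Fin m) (Fin m) K} {x x' : Fin m → K}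

theorem PairedMatrices.mul {A B A' B' : Matrix (Fin m) (Fin m) K}
    (h : PairedMatrices E x x' A B) (h' : PairedMatrices E x x' A' B') :
    PairedMatrices E x x' (A * A') (B * B') := by
  obtain ⟨M, hM, rfl, rfl⟩ := h
  obtain ⟨M', hM', rfl, rfl⟩ := h'
  refine ⟨M * M', mul_mem hM hM', ?_, ?_⟩
  · exact Matrix.map_mul (f := RingHom.fst K K)
  · exact Matrix.map_mul (f := RingHom.snd K K)

theorem pencilMatrix_map {R S : Type*} [CommRing R] [CommRing S] (f : R →+* S)
    (E : Matrix (Fin m) (Fin m) R) (z : Fin m → R) :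
    (pencilMatrix E z).map f = pencilMatrix (E.map f) (fun k => f (z k)) := by
  ext i j
  by_cases h : i = j <;> simp [pencilMatrix, Matrix.mulVec, dotProduct, h]

theorem pencilWord_map {R S : Type*} [CommRing R] [CommRing S] (f : R →+* S)
    (E : Matrix (Fin m) (Fin m) R) (z : Fin m → R) (w : List Bool) :
    (pencilWord E z w).map f = pencilWord (E.map f) (fun k => f (z k)) w := by
  rw [← RingHom.mapMatrix_apply, pencilWord, map_list_prod, List.map_map, pencilWord]
  congr 2
  funext b
  cases b
  · simp [Matrix.diagonal_map]
  · simp [pencilMatrix_map]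

theorem PairedMatrices.trace_eq (hw : ∀ w, (pencilWord E x w).trace = (pencilWord E x' w).trace)
    {A B : Matrix (Fin m) (Fin m) K} (h : PairedMatrices E x x' A B) : A.trace = B.trace := by
  obtain ⟨M, hM, rfl, rfl⟩ := h
  have h1 : ∀ M : Matrix (Fin m) (Fin m) (K × K),
      (LinearMap.fst K K K - LinearMap.snd K K K) M.trace =
        (M.map (RingHom.fst K K)).trace - (M.map (RingHom.snd K K)).trace := fun M => by
    simp [Matrix.trace]
  have := map_trace_eq_zero_of_mem_pencilAlgebra (LinearMap.fst K K K - LinearMap.snd K K K)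
    (fun w => by
      rw [h1, pencilWord_map, pencilWord_map, sub_eq_zero]
      exact hw w) hM
  rw [h1, sub_eq_zero] at this
  exact this

theorem pairedMatrices_pencilMatrix (E : Matrix (Fin m) (Fin m) K) (x x' : Fin m → K) :
    PairedMatrices E x x' (pencilMatrix E x) (pencilMatrix E x') :=
  ⟨_, pencilMatrix_mem_pencilAlgebra E _, pencilMatrix_map (RingHom.fst K K) _ _,
    pencilMatrix_map (RingHom.snd K K) _ _⟩

theorem pairedMatrices_diagonal [DecidableEq K] (E : Matrix (Fin m) (Fin m) K) (x x' : Fin m → K)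
    (u : K) : PairedMatrices E x x' (Matrix.diagonal fun k => if x k = u then 1 else 0)
      (Matrix.diagonal fun k => if x' k = u then 1 else 0) := by
  obtain ⟨h, hh⟩ := exists_polynomial_eval_eq_ite (Sum.elim x x') u
  have h1 : ∀ f : K × K →ₐ[K] K, ∀ z, f (aeval z h) = h.eval (f z) := fun f z => by
    rw [← aeval_algHom_apply, coe_aeval_eq_eval]
  refine ⟨_, diagonal_aeval_mem_pencilAlgebra E _ h, ?_, ?_⟩
  · rw [Matrix.diagonal_map rfl]
    congr 1
    funext k
    exact (h1 (AlgHom.fst K K K) _).trans (hh (Sum.inl k))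
  · rw [Matrix.diagonal_map rfl]
    congr 1
    funext k
    exact (h1 (AlgHom.snd K K K) _).trans (hh (Sum.inr k))

/-- Nonzero terms of pairwise distinct valuations cannot cancel: the largest dominates. -/
theorem eq_zero_of_sum_eq_zero_of_valuation {ι Γ : Type*} [LinearOrderedCommGroupWithZero Γ]
    (V : Valuation K Γ) (s : Finset ι) (f : ι → K)
    (hf : ∀ i ∈ s, ∀ j ∈ s, f i ≠ 0 → f j ≠ 0 → V (f i) = V (f j) → i = j)
    (hsum : ∑ i ∈ s, f i = 0) : ∀ i ∈ s, f i = 0 := by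
  classical
  by_contra! hne
  obtain ⟨i, hi, hi0⟩ := hne
  obtain ⟨i₁, hi₁, hmax⟩ := s.exists_max_image (fun i => V (f i)) ⟨i, hi⟩
  have h0 : f i₁ ≠ 0 := fun h0 => by
    have := hmax i hi
    rw [h0, map_zero, le_zero_iff, map_eq_zero] at this
    exact hi0 this
  have hV : V (f i₁) ≠ 0 := (_root_.map_ne_zero V).mpr h0
  have hlt : V (∑ i ∈ s.erase i₁, f i) < V (f i₁) := by
    refine V.map_sum_lt hV fun j hj => ?_
    obtain ⟨hj, hjs⟩ := Finset.mem_erase.mp hj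
    refine lt_of_le_of_ne (hmax j hjs) fun h => hj ?_
    refine hf j hjs i₁ hi₁ (fun h' => ?_) h0 h
    rw [h', map_zero] at h
    exact hV h.symm
  rw [← Finset.add_sum_erase s f hi₁] at hsum
  rw [← V.map_neg, ← eq_neg_of_add_eq_zero_left hsum] at hlt
  exact lt_irrefl _ hlt

end Separation

end StructureConstants

namespace StructureConstants

/-! ### Separation of points. -/

section Separation

open IsLocalRing

variable {m : ℕ} {K : Type*} [Field K] {O : ValuationSubring K}

/-- Generic coefficients `e l k` together with weights `eps l` of sufficiently different sizes. -/
structure IsGenericWeighted (e : Fin m → Fin m → O) (eps : Fin m → K) : Prop where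
  generic : IsGenericMatrix fun l k => residue O (e l k)
  diag : ∀ l, e l l = 0
  sum_ne_zero : ∀ (l : Fin m) (C : Finset (Fin m)), (∃ k ∈ C, k ≠ l) →
    residue O (∑ k ∈ C, e l k) ≠ 0
  eps_ne_zero : ∀ l, eps l ≠ 0
  eps_injective : ∀ l l', O.valuation (eps l) = O.valuation (eps l') → l = l'
  eps_mul_injective : ∀ i j i' j', i < j → i' < j' →
    O.valuation (eps i * eps j) = O.valuation (eps i' * eps j') → i = i' ∧ j = j'

variable {e : Fin m → Fin m → O} {eps : Fin m → K}

theorem IsGenericWeighted.valuation_apply (h : IsGenericWeighted e eps) {k l : Fin m} (hkl : k ≠ l) :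
    O.valuation (weightedMatrix e eps k l) = O.valuation (eps l) := by
  rw [weightedMatrix, Matrix.of_apply, map_mul,
    valuation_eq_one_of_residue_ne_zero O (h.generic.ne_zero hkl.symm), mul_one]

/-- As `y` takes only the values `0` and `±c`, the valuation of a nonzero term is that of `c` times
that of `eps l`, which determines `l`. -/
theorem IsGenericWeighted.eq_zero_of_sum (h : IsGenericWeighted e eps) (S : Finset (Fin m))
    (s : Fin m → O) (hs : ∀ l ∈ S, residue O (s l) ≠ 0) (y : Fin m → K) (c : K)
    (hy : ∀ l ∈ S, y l = 0 ∨ y l = c ∨ y l = - c) (hsum : ∑ l ∈ S, y l * (eps l * s l) = 0) :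
    ∀ l ∈ S, y l = 0 := by
  have hval : ∀ l ∈ S, y l * (eps l * s l) ≠ 0 →
      O.valuation (y l * (eps l * s l)) = O.valuation c * O.valuation (eps l) := by
    intro l hl h0
    rw [map_mul, map_mul, valuation_eq_one_of_residue_ne_zero O (hs l hl), mul_one]
    rcases hy l hl with h' | h' | h'
    · rw [h', zero_mul] at h0
      exact absurd rfl h0
    · rw [h']
    · rw [h', Valuation.map_neg]
  have hs0 : ∀ l ∈ S, (s l : K) ≠ 0 := fun l hl h0 => hs l hl (by
    rw [show s l = 0 from Subtype.ext h0, map_zero])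
  intro l hl
  have := eq_zero_of_sum_eq_zero_of_valuation O.valuation S (fun l => y l * (eps l * s l))
    (fun i hi j hj hi0 hj0 hij => by
      simp only [hval i hi hi0, hval j hj hj0] at hij
      have hc : O.valuation c ≠ 0 := by
        intro h0
        have h1 := hval i hi hi0
        rw [h0, zero_mul, map_eq_zero] at h1
        exact hi0 h1
      exact h.eps_injective i j (mul_left_cancel₀ hc hij)) hsum l hl
  exact (mul_eq_zero.mp this).resolve_right (mul_ne_zero (h.eps_ne_zero l) (hs0 l hl))

theorem sum_sum_eq_sum_lt {M : Type*} [AddCommMonoid M] (f : Fin m → Fin m → M)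
    (hf : ∀ k, f k k = 0) :
    ∑ k, ∑ l, f k l = ∑ p : Fin m × Fin m with p.1 < p.2, (f p.1 p.2 + f p.2 p.1) := by
  have h1 : ∀ p : Fin m × Fin m, f p.1 p.2 =
      (if p.1 < p.2 then f p.1 p.2 else 0) + if p.2 < p.1 then f p.1 p.2 else 0 := by
    rintro ⟨k, l⟩
    rcases lt_trichotomy k l with h | h | h
    · simp [h, h.not_gt]
    · subst h
      simp [hf]
    · simp [h, h.not_gt]
  rw [← Fintype.sum_prod_type' f, Finset.sum_congr rfl fun p _ => h1 p, Finset.sum_add_distrib,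
    Finset.sum_add_distrib, Finset.sum_filter, Finset.sum_filter]
  congr 1
  exact (Equiv.prodComm (Fin m) (Fin m)).sum_comp
    (fun p : Fin m × Fin m => if p.1 < p.2 then f p.2 p.1 else 0)

theorem trace_pencilMatrix_weightedMatrix (hdiag : ∀ l, e l l = 0) (S : Finset (Fin m))
    (x : Fin m → K) : ∑ k ∈ S, pencilMatrix (weightedMatrix e eps) x k k =
      - ∑ l, x l * (eps l * (∑ k ∈ S, e l k : O)) := by
  have h1 : ∀ k, pencilMatrix (weightedMatrix e eps) x k k = - ∑ l, eps l * e l k * x l := fun k => by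
    rw [pencilMatrix_apply_self x (by simp [weightedMatrix, hdiag])]
    rfl
  rw [Finset.sum_congr rfl fun k _ => h1 k, Finset.sum_neg_distrib, Finset.sum_comm]
  congr 1
  refine Finset.sum_congr rfl fun l _ => ?_
  push_cast
  rw [Finset.mul_sum, Finset.mul_sum]
  exact Finset.sum_congr rfl fun k _ => by ring

variable [DecidableEq K] {x x' : Fin m → K}

theorem trace_diagonal_mul_pencilMatrix (E : Matrix (Fin m) (Fin m) K) (x : Fin m → K) {u w : K}
    (huw : u ≠ w) : ((Matrix.diagonal (fun k => if x k = u then 1 else 0) * pencilMatrix E x) *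
      (Matrix.diagonal (fun k => if x k = w then 1 else 0) * pencilMatrix E x)).trace =
      u * w * ∑ k, ∑ l, (if x k = u ∧ x l = w then 1 else 0) * (E k l * E l k) := by
  rw [Matrix.trace, Finset.mul_sum]
  refine Finset.sum_congr rfl fun k _ => ?_
  rw [Matrix.diag_apply, Matrix.mul_apply, Finset.mul_sum]
  refine Finset.sum_congr rfl fun l _ => ?_
  rw [Matrix.diagonal_mul, Matrix.diagonal_mul]
  by_cases hk : x k = u
  · by_cases hl : x l = w
    · have hkl : k ≠ l := fun h => huw (by rw [← hk, ← hl, h])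
      rw [pencilMatrix_apply_of_ne _ _ hkl, pencilMatrix_apply_of_ne _ _ hkl.symm, if_pos hk,
        if_pos hl, if_pos ⟨hk, hl⟩, hk, hl]
      ring
    · simp [hl]
  · simp [hk]

/-- The trace of a path from the class of `u` to the class of `w` and back is `u * w` times the sum
of `E i j * E j i` over the pairs with these values. Distinct unordered pairs have distinct
valuations, so equal traces force equal sets of unordered pairs. -/
theorem IsGenericWeighted.edge (h : IsGenericWeighted e eps)
    (hw : ∀ w, (pencilWord (weightedMatrix e eps) x w).trace =
      (pencilWord (weightedMatrix e eps) x' w).trace) {k l : Fin m} (hk : x k ≠ 0) (hl : x l ≠ 0)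
    (hkl : x k ≠ x l) : (x' k = x k ∧ x' l = x l) ∨ (x' k = x l ∧ x' l = x k) := by
  set u := x k with hu
  set w := x l with hw'
  set E := weightedMatrix e eps with hE
  let a : (Fin m → K) → Fin m → Fin m → K := fun x i j => if x i = u ∧ x j = w then 1 else 0
  have h1 := (((pairedMatrices_diagonal E x x' u).mul (pairedMatrices_pencilMatrix E x x')).mul
    ((pairedMatrices_diagonal E x x' w).mul (pairedMatrices_pencilMatrix E x x'))).trace_eq hw
  rw [trace_diagonal_mul_pencilMatrix E x hkl, trace_diagonal_mul_pencilMatrix E x' hkl] at h1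
  have h2 : ∑ i, ∑ j, (a x i j - a x' i j) * (E i j * E j i) = 0 := by
    simp only [sub_mul, Finset.sum_sub_distrib]
    exact sub_eq_zero.mpr (mul_left_cancel₀ (mul_ne_zero hk hl) h1)
  rw [sum_sum_eq_sum_lt _ (fun i => by simp [hE, weightedMatrix, h.diag])] at h2
  have ha : ∀ x i j, a x i j + a x j i = 0 ∨ a x i j + a x j i = 1 := by
    intro x i j
    by_cases h1 : x i = u ∧ x j = w
    · simp [a, h1, hkl]
    · by_cases h2 : x j = u ∧ x i = w
      · simp [a, h2, hkl]
      · simp [a, h1, h2]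
  have hval : ∀ i j, i ≠ j →
      (a x i j - a x' i j) * (E i j * E j i) + (a x j i - a x' j i) * (E j i * E i j) ≠ 0 →
      O.valuation ((a x i j - a x' i j) * (E i j * E j i) +
        (a x j i - a x' j i) * (E j i * E i j)) = O.valuation (eps i * eps j) := by
    intro i j hij h0
    have hrw : (a x i j - a x' i j) * (E i j * E j i) + (a x j i - a x' j i) * (E j i * E i j) =
      ((a x i j + a x j i) - (a x' i j + a x' j i)) * (E j i * E i j) := by ring
    rw [hrw] at h0 ⊢
    rw [map_mul, map_mul, h.valuation_apply hij, h.valuation_apply hij.symm, map_mul]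
    rcases ha x i j with h1 | h1 <;> rcases ha x' i j with h2 | h2 <;> rw [h1, h2] at h0 ⊢
    · simp at h0
    · simp [Valuation.map_neg]
    · simp
    · simp at h0
  have hzero : ∀ i j, i < j → (a x i j + a x j i) - (a x' i j + a x' j i) = 0 := by
    intro i j hij
    have := eq_zero_of_sum_eq_zero_of_valuation O.valuation _ _ (fun p hp q hq hp0 hq0 hpq => by
      have hp := (Finset.mem_filter.mp hp).2
      have hq := (Finset.mem_filter.mp hq).2
      rw [hval _ _ hp.ne hp0, hval _ _ hq.ne hq0] at hpq
      obtain ⟨h1, h2⟩ := h.eps_mul_injective _ _ _ _ hp hq hpq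
      exact Prod.ext h1 h2) h2 (i, j) (by simpa using hij)
    have hne : E j i * E i j ≠ 0 := by
      have h3 : O.valuation (E j i * E i j) ≠ 0 := by
        rw [map_mul, h.valuation_apply hij.ne, h.valuation_apply hij.ne', ← map_mul]
        exact (map_ne_zero _).mpr (mul_ne_zero (h.eps_ne_zero _) (h.eps_ne_zero _))
      exact (map_ne_zero _).mp h3
    refine (mul_eq_zero.mp ?_).resolve_right hne
    rw [← this]
    ring
  have hkl' : (a x k l + a x l k) - (a x' k l + a x' l k) = 0 := by
    rcases lt_trichotomy k l with hlt | heq | hlt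
    · exact hzero k l hlt
    · exact absurd (by rw [hu, hw', heq]) hkl
    · rw [← hzero l k hlt]
      ring
  have h3 : a x k l + a x l k = 1 := by
    simp [a, hkl, ← hu, ← hw']
  rw [h3] at hkl'
  by_contra! hcon
  have h5 : ¬ (x' k = u ∧ x' l = w) := fun h5 => hcon.1 h5.1 h5.2
  have h6 : ¬ (x' l = u ∧ x' k = w) := fun h6 => hcon.2 h6.2 h6.1
  simp [a, h5, h6] at hkl'

/-- Comparing the edges at `i` with the edge `k l` leaves at most the exchange of the two values `x
k` and `x l`. The difference `x - x'` then has the shape required by `eq_zero_of_sum`. -/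
theorem IsGenericWeighted.eq_of_two_values (h : IsGenericWeighted e eps)
    (hw : ∀ w, (pencilWord (weightedMatrix e eps) x w).trace =
      (pencilWord (weightedMatrix e eps) x' w).trace) {k l : Fin m} (hk : x k ≠ 0) (hl : x l ≠ 0)
    (hkl : x k ≠ x l) (i : Fin m) :
    x i - x' i = 0 ∨ x i - x' i = x k - x l ∨ x i - x' i = - (x k - x l) := by
  have hedge := h.edge hw hk hl hkl
  by_cases hi : x i = 0
  · left
    rw [hi, zero_sub, neg_eq_zero]
    by_contra hi'
    obtain ⟨j, hj, hij⟩ : ∃ j, x' j ≠ 0 ∧ x' i ≠ x' j := by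
      by_cases h1 : x' i = x' k
      · refine ⟨l, ?_, ?_⟩
        · rcases hedge with ⟨-, h'⟩ | ⟨-, h'⟩ <;> rwa [h']
        · rcases hedge with ⟨h2, h'⟩ | ⟨h2, h'⟩ <;> rw [h1, h', h2]
          · exact hkl
          · exact hkl.symm
      · refine ⟨k, ?_, h1⟩
        rcases hedge with ⟨h', -⟩ | ⟨h', -⟩ <;> rwa [h']
    rcases h.edge (fun w => (hw w).symm) hi' hj hij with ⟨h1, -⟩ | ⟨h1, -⟩
    · exact hi' (h1.symm.trans hi)
    · exact hj (h1.symm.trans hi)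
  · by_cases hik : x i = x k
    · rcases h.edge hw hi hl (by rwa [hik]) with ⟨h1, -⟩ | ⟨h1, -⟩
      · simp [h1]
      · right; left; rw [h1, hik]
    · rcases h.edge hw hi hk hik with ⟨h1, -⟩ | ⟨h1, -⟩
      · simp [h1]
      · by_cases hil : x i = x l
        · right; right; rw [h1, hil]; ring
        · rcases h.edge hw hi hl hil with ⟨h2, -⟩ | ⟨h2, -⟩
          · simp [h2]
          · exact absurd (h1.symm.trans h2) hkl

/-- The trace of the pencil compressed to the class of `x k` vanishes at `x'`. At `x` it is a sum of
terms of distinct valuations, all nonzero once the class has two elements. -/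
theorem IsGenericWeighted.card_eq_one (h : IsGenericWeighted e eps)
    (hw : ∀ w, (pencilWord (weightedMatrix e eps) x w).trace =
      (pencilWord (weightedMatrix e eps) x' w).trace) {k : Fin m} (hk : x k ≠ 0)
    (hx : ∀ l, x l ≠ 0 → x l = x k) (hx' : ∀ l, x' l ≠ x k) (l : Fin m) (hl : x l ≠ 0) : l = k := by
  by_contra hlk
  set S : Finset (Fin m) := {i | x i = x k} with hS
  have hmem : ∀ i, i ∈ S ↔ x i = x k := fun i => by simp [hS]
  have h1 := ((pairedMatrices_diagonal (weightedMatrix e eps) x x' (x k)).mul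
    (pairedMatrices_pencilMatrix _ x x')).trace_eq hw
  have h2 : ∑ i ∈ S, pencilMatrix (weightedMatrix e eps) x i i = 0 := by
    have h3 : ∀ i, (Matrix.diagonal (fun k_1 => if x' k_1 = x k then (1 : K) else 0) *
        pencilMatrix (weightedMatrix e eps) x') i i = 0 := fun i => by simp [hx']
    simp only [Matrix.trace, Matrix.diag_apply, h3, Matrix.diagonal_mul, ite_mul, one_mul, zero_mul,
      Finset.sum_const_zero] at h1
    rw [hS, Finset.sum_filter]
    exact h1
  rw [trace_pencilMatrix_weightedMatrix h.diag, neg_eq_zero] at h2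
  have h4 : ∑ i ∈ S, x i * (eps i * (∑ j ∈ S, e i j : O)) = 0 := by
    rw [← h2]
    refine Finset.sum_subset (Finset.subset_univ S) fun i _ hi => ?_
    by_cases h0 : x i = 0
    · rw [h0, zero_mul]
    · exact absurd ((hmem i).mpr (hx i h0)) hi
  refine hk (h.eq_zero_of_sum S (fun i => ∑ j ∈ S, e i j) (fun i _ => h.sum_ne_zero i S ?_) x (x k)
    (fun i hi => Or.inr (Or.inl ((hmem i).mp hi))) h4 k ((hmem k).mpr rfl))
  by_cases hik : i = k
  · exact ⟨l, (hmem l).mpr (hx l hl), fun h => hlk (h.trans hik)⟩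
  · exact ⟨k, (hmem k).mpr rfl, fun h => hik h.symm⟩

/-- The traces of the words in the pencil separate points. -/
theorem IsGenericWeighted.eq_of_trace_eq (h : IsGenericWeighted e eps)
    (hw : ∀ w, (pencilWord (weightedMatrix e eps) x w).trace =
      (pencilWord (weightedMatrix e eps) x' w).trace) : x = x' := by
  have hD : ∑ l, x l = ∑ l, x' l := by
    simpa [pencilWord, Matrix.trace] using hw [false]
  -- With at most one index `E` is zero, and only the trace of `diag x` carries information.
  rcases subsingleton_or_nontrivial (Fin m) with hm | hm
  · funext k
    rwa [Fintype.sum_subsingleton _ k, Fintype.sum_subsingleton _ k] at hD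
  have hN : ∑ l, (x l - x' l) * (eps l * (∑ k, e l k : O)) = 0 := by
    have h1 : (pencilMatrix (weightedMatrix e eps) x).trace =
        (pencilMatrix (weightedMatrix e eps) x').trace := by
      simpa [pencilWord] using hw [true]
    simp only [Matrix.trace, Matrix.diag_apply] at h1
    rw [trace_pencilMatrix_weightedMatrix h.diag, trace_pencilMatrix_weightedMatrix h.diag,
      neg_inj] at h1
    simp only [sub_mul, Finset.sum_sub_distrib]
    rw [h1, sub_self]
  have key : ∀ c, (∀ l, x l - x' l = 0 ∨ x l - x' l = c ∨ x l - x' l = - c) → x = x' := by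
    intro c hc
    funext l
    refine sub_eq_zero.mp (h.eq_zero_of_sum Finset.univ (fun l => ∑ k, e l k) (fun l _ => ?_)
      (fun l => x l - x' l) c (fun l _ => hc l) hN l (Finset.mem_univ l))
    obtain ⟨k, hk⟩ := exists_ne l
    exact h.sum_ne_zero l _ ⟨k, Finset.mem_univ k, hk⟩
  by_cases h1 : ∃ k l, x k ≠ 0 ∧ x l ≠ 0 ∧ x k ≠ x l
  · obtain ⟨k, l, hk, hl, hkl⟩ := h1
    exact key _ (h.eq_of_two_values hw hk hl hkl)
  by_cases h2 : ∃ k l, x' k ≠ 0 ∧ x' l ≠ 0 ∧ x' k ≠ x' l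
  · obtain ⟨k, l, hk, hl, hkl⟩ := h2
    refine key (x' k - x' l) fun i => ?_
    rcases h.eq_of_two_values (fun w => (hw w).symm) hk hl hkl i with h3 | h3 | h3
    · left; linear_combination -h3
    · right; right; linear_combination -h3
    · right; left; linear_combination -h3
  push Not at h1 h2
  by_cases hx : ∃ k, x k ≠ 0
  swap
  · push Not at hx
    by_cases hx' : ∃ k, x' k ≠ 0
    · obtain ⟨k, hk⟩ := hx'
      refine key (x' k) fun l => ?_
      by_cases hl : x' l = 0
      · left; rw [hx, hl, sub_zero]
      · right; right; rw [hx, h2 l k hl hk, zero_sub]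
    · push Not at hx'
      funext k
      rw [hx, hx']
  obtain ⟨k, hk⟩ := hx
  by_cases hxx : ∀ l, x' l = 0 ∨ x' l = x k
  · refine key (x k) fun l => ?_
    by_cases hl : x l = 0
    · rcases hxx l with h3 | h3
      · left; rw [hl, h3, sub_zero]
      · right; right; rw [hl, h3, zero_sub]
    · rcases hxx l with h3 | h3
      · right; left; rw [h1 l k hl hk, h3, sub_zero]
      · left; rw [h1 l k hl hk, h3, sub_self]
  push Not at hxx
  obtain ⟨l, hl, hlk⟩ := hxx
  -- Each vector has one nonzero value and the two values differ, so both supports are singletons;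
  -- the equality of the coordinate sums is then contradicted.
  have hx1 := h.card_eq_one hw hk (fun i hi => h1 i k hi hk) fun i hi => hlk (by
    rw [← hi]
    exact h2 l i hl (by rwa [hi]))
  have hx2 := h.card_eq_one (fun w => (hw w).symm) hl (fun i hi => h2 i l hi hl) fun i hi => hlk (by
    rw [← hi]
    exact (h1 i k (by rwa [hi]) hk))
  rw [Finset.sum_eq_single k (fun i _ hi => by_contra fun h0 => hi (hx1 i h0)) (by simp),
    Finset.sum_eq_single l (fun i _ hi => by_contra fun h0 => hi (hx2 i h0)) (by simp)] at hD
  exact absurd hD.symm hlk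

end Separation

end StructureConstants

namespace StructureConstants

/-! ### Existence of generic weights, and descent to the base field. -/

section Construction

open IsLocalRing

variable {m : ℕ}

/-- The generic matrix with zero diagonal. -/
noncomputable def universalMatrix (F : Type*) [CommRing F] (l k : Fin m) :
    MvPolynomial (Fin m × Fin m) F :=
  if l = k then 0 else MvPolynomial.X (l, k)

theorem det_withOnes_universalMatrix_ne_zero (F : Type*) [Field F] (C : Finset (Fin m))
    (f : C → Option (Fin m)) (hf : Function.Injective f) (hfi : ∀ i, f i ≠ some (i : Fin m)) :
    (Matrix.of fun i j : C => withOnes (universalMatrix F) (f i) j).det ≠ 0 := by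
  classical
  intro h0
  -- Specialize to keep only the term selected by `f`: every row becomes a unit vector, except for
  -- at most one row of ones, and the kernel is zero.
  let θ : Fin m × Fin m → F := fun p => if ∃ i : C, (i : Fin m) = p.2 ∧ f i = some p.1 then 1 else 0
  have h1 := congrArg (MvPolynomial.eval θ) h0
  rw [RingHom.map_det, map_zero, ← Matrix.exists_mulVec_eq_zero_iff] at h1
  obtain ⟨z, hz, hMz⟩ := h1
  set M := (MvPolynomial.eval θ).mapMatrix
    (Matrix.of fun i j : C => withOnes (universalMatrix F) (f i) j) with hM
  have hMs : ∀ i l, f i = some l → ∀ j, M i j = if i = j then 1 else 0 := by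
    intro i l hi j
    have hMij : M i j = MvPolynomial.eval θ (universalMatrix F l j) := by
      simp [hM, hi, withOnes]
    rw [hMij, universalMatrix]
    by_cases hlj : l = j
    · have hij : i ≠ j := fun h => hfi i (by rw [hi, hlj, h])
      rw [if_pos hlj, if_neg hij, map_zero]
    · rw [if_neg hlj, MvPolynomial.eval_X]
      by_cases hij : i = j
      · rw [if_pos hij]
        exact if_pos ⟨i, by rw [hij], hi⟩
      · rw [if_neg hij]
        refine if_neg ?_
        rintro ⟨i', hi', hf'⟩
        exact hij ((hf (hi.trans hf'.symm)).trans (Subtype.ext hi'))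
  have hzs : ∀ i l, f i = some l → z i = 0 := by
    intro i l hi
    have := congrFun hMz i
    simpa [Matrix.mulVec, dotProduct, hMs i l hi] using this
  obtain ⟨i, hi⟩ := Function.ne_iff.mp hz
  rcases hfi' : f i with _ | l
  · have := congrFun hMz i
    have hone : ∀ j, M i j = 1 := fun j => by simp [hM, hfi', withOnes]
    rw [Matrix.mulVec, dotProduct, Finset.sum_eq_single i] at this
    · rw [hone, one_mul] at this
      exact hi this
    · intro j _ hji
      rcases hfj : f j with _ | l
      · exact absurd (hf (hfj.trans hfi'.symm)) hji
      · rw [hzs j l hfj, mul_zero]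
    · simp
  · exact hi (hzs i l hfi')

theorem sum_universalMatrix_ne_zero (F : Type*) [Field F] (l : Fin m) (C : Finset (Fin m))
    (hC : ∃ k ∈ C, k ≠ l) : ∑ k ∈ C, universalMatrix F l k ≠ 0 := by
  classical
  obtain ⟨k, hk, hkl⟩ := hC
  intro h0
  have h1 := congrArg (MvPolynomial.eval (Pi.single (l, k) (1 : F))) h0
  rw [map_sum, map_zero, Finset.sum_eq_single k] at h1
  · simp [universalMatrix, hkl.symm] at h1
  · intro j _ hj
    rw [universalMatrix]
    split_ifs
    · simp
    · simp [hj]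
  · exact fun h => absurd hk h

/-- Uniqueness of binary expansions; with weights `t ^ 2 ^ l`, the products of two distinct weights
have distinct valuations. -/
theorem two_pow_add_two_pow_injective {i j i' j' : ℕ} (h : i < j) (h' : i' < j')
    (heq : 2 ^ i + 2 ^ j = 2 ^ i' + 2 ^ j') : i = i' ∧ j = j' := by
  have h1 : ∀ {i j i' j' : ℕ}, i < j → 2 ^ i + 2 ^ j = 2 ^ i' + 2 ^ j' → ¬ j < j' := by
    intro i j i' j' h heq hlt
    have h2 : 2 ^ i < 2 ^ j := Nat.pow_lt_pow_right (by norm_num) h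
    have h3 : 2 ^ (j + 1) ≤ 2 ^ j' := Nat.pow_le_pow_right (by norm_num) hlt
    have h4 : 0 < 2 ^ i' := Nat.two_pow_pos i'
    rw [pow_succ] at h3
    omega
  obtain rfl : j = j' := le_antisymm (not_lt.mp (h1 h' heq.symm)) (not_lt.mp (h1 h heq))
  exact ⟨Nat.pow_right_injective le_rfl (Nat.add_right_cancel heq), rfl⟩

/-- A valuation subring of an extension field of `L(t)` that contains `L` and has `t` as a nonunit. -/
theorem exists_valuationSubring_of_polynomial {L K : Type*} [Field L] [Field K]
    (φ : Polynomial L →+* K) (hφ : Function.Injective φ) :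
    ∃ O : ValuationSubring K, (∀ a, φ a ∈ O) ∧ O.valuation (φ Polynomial.X) < 1 := by
  have hI : Ideal.span {φ.rangeRestrict Polynomial.X} ≠ ⊤ := by
    intro htop
    rw [Ideal.span_singleton_eq_top] at htop
    obtain ⟨b, hb⟩ := htop.exists_right_inv
    obtain ⟨q, rfl⟩ := φ.rangeRestrict_surjective b
    rw [← map_mul] at hb
    have : Polynomial.X * q = 1 := hφ (by simpa using congrArg Subtype.val hb)
    exact Polynomial.not_isUnit_X (IsUnit.of_mul_eq_one _ this)
  obtain ⟨O, hO, hnonunits⟩ := Ideal.image_subset_nonunits_valuationSubring _ hI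
  refine ⟨O, fun a => hO ⟨a, rfl⟩, ?_⟩
  rw [← O.mem_nonunits_iff]
  exact hnonunits ⟨_, Ideal.subset_span rfl, rfl⟩

/-- The entries of `e` are independent variables in a field of constants, which embeds into the
residue field, so nonzero polynomials in them stay nonzero there; the weights are powers of the
nonunit `t`. -/
theorem exists_isGenericWeighted {F K : Type*} [Field F] [Field K]
    (φ : Polynomial (FractionRing (MvPolynomial (Fin m × Fin m) F)) →+* K)
    (hφ : Function.Injective φ) :
    ∃ (O : ValuationSubring K) (e : Fin m → Fin m → O) (eps : Fin m → K),
      IsGenericWeighted e eps := by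
  obtain ⟨O, hO, hX⟩ := exists_valuationSubring_of_polynomial φ hφ
  have hX0 : O.valuation (φ Polynomial.X) ≠ 0 :=
    (map_ne_zero _).mpr ((map_ne_zero_iff φ hφ).mpr Polynomial.X_ne_zero)
  let ψ : MvPolynomial (Fin m × Fin m) F →+* O :=
    (φ.codRestrict O.toSubring hO).comp (Polynomial.C.comp (algebraMap _ _))
  have hψ : Function.Injective ((residue O).comp ψ) := by
    exact (((residue O).comp (φ.codRestrict O.toSubring hO)).comp Polynomial.C).injective.comp
      (IsFractionRing.injective _ (FractionRing (MvPolynomial (Fin m × Fin m) F)))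
  have hne : ∀ p, p ≠ 0 → residue O (ψ p) ≠ 0 := fun p hp => (map_ne_zero_iff _ hψ).mpr hp
  have hval : ∀ n, O.valuation (φ Polynomial.X ^ n) = O.valuation (φ Polynomial.X) ^ n := fun n =>
    map_pow _ _ _
  have hinj : Function.Injective fun n : ℕ => O.valuation (φ Polynomial.X) ^ n :=
    (pow_right_strictAnti₀ (zero_lt_iff.mpr hX0) hX).injective
  refine ⟨O, fun l k => ψ (universalMatrix F l k), fun l => φ Polynomial.X ^ 2 ^ (l : ℕ), ?_, ?_, ?_,
    ?_, ?_, ?_⟩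
  · refine ⟨fun l => by simp [universalMatrix], fun C f hf hfi => ?_⟩
    have := hne _ (det_withOnes_universalMatrix_ne_zero F C f hf hfi)
    rw [← RingHom.comp_apply, RingHom.map_det] at this
    refine fun h0 => this ((congrArg Matrix.det ?_).trans h0)
    ext i j
    rcases hi : f i with _ | l <;> simp [withOnes, hi]
  · intro l
    simp [universalMatrix]
  · intro l C hC
    rw [← map_sum]
    exact hne _ (sum_universalMatrix_ne_zero F l C hC)
  · exact fun l => pow_ne_zero _ ((map_ne_zero_iff φ hφ).mpr Polynomial.X_ne_zero)
  · intro l l' h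
    rw [hval, hval] at h
    exact Fin.ext (Nat.pow_right_injective le_rfl (hinj h))
  · intro i j i' j' hij hij' h
    rw [← pow_add, ← pow_add, hval, hval] at h
    obtain ⟨h1, h2⟩ := two_pow_add_two_pow_injective hij hij' (hinj h)
    exact ⟨Fin.ext h1, Fin.ext h2⟩

/-- For all large `k` some choice of `m ^ k` contractions gives a generically nonsingular `Q`. -/
theorem exists_contractions_det_Q_ne_zero {F : Type*} [Field F] [IsAlgClosed F]
    (m : ℕ) : ∃ N : ℕ, ∀ n ≥ N, ∃ ρ : (Fin (n + 2) → Fin m) → Contraction (n + 2),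
      ∃ A : Space m F, (Q ρ A).det ≠ 0 := by
  classical
  have : Infinite F := IsAlgClosed.instInfinite
  let L := FractionRing (MvPolynomial (Fin m × Fin m) F)
  -- Algebraic closedness of `K` is needed for the Nullstellensatz and for Schur's lemma; the
  -- resulting choice of contractions then descends to `F`.
  let K := AlgebraicClosure (FractionRing (Polynomial L))
  let φ : Polynomial L →+* K :=
    (algebraMap (FractionRing (Polynomial L)) K).comp (algebraMap (Polynomial L) _)
  have hφ : Function.Injective φ :=
    (algebraMap (FractionRing (Polynomial L)) K).injective.comp
      (IsFractionRing.injective (Polynomial L) _)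
  let _ : Algebra F K := (φ.comp (Polynomial.C.comp (algebraMap F L))).toAlgebra
  have : Infinite K := IsAlgClosed.instInfinite
  obtain ⟨O, e, eps, h⟩ := exists_isGenericWeighted φ hφ
  obtain ⟨N, hN⟩ := exists_wordSpan_pencilLetters_eq_top (weightedMatrix e eps)
    (fun x x' hne => by
      by_contra! hw
      exact hne (h.eq_of_trace_eq hw))
    (weightedMatrix_immersion h.generic h.diag h.eps_ne_zero h.eps_injective)
  refine ⟨N, fun n hn => ?_⟩
  obtain ⟨ρ, A, hA⟩ := exists_contractions_of_wordSpan_pencilLetters (weightedMatrix e eps)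
    (hN (n + 2) (by omega))
  exact ⟨ρ, exists_det_Q_ne_zero_of_extension ρ ⟨A, hA⟩⟩

end Construction

end StructureConstants

theorem theorem3p1 {F : Type*} [Field F] [IsAlgClosed F] (m : ℕ) (hm : 0 < m) :
    -- for all large k = n + 2, some m^k contractions form a generically nonsingular Q
    (∃ N : ℕ, ∀ n ≥ N, ∃ ρ : (Fin (n + 2) → Fin m) → Contraction (n + 2),
      ∃ A : Space m F, (Q ρ A).det ≠ 0) ∧
    -- for every such Q, some m × m submatrix is generically nonsingular
    (∀ (n : ℕ) (ρ : (Fin (n + 2) → Fin m) → Contraction (n + 2)),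
      (∃ A : Space m F, (Q ρ A).det ≠ 0) →
        ∃ γ : Fin m ↪ (Fin (n + 2) → Fin m), (V₀ F ρ γ).Nonempty) ∧
    -- for every such choice, V₀ is invariant, open and dense, and P gives normal forms on V₀
    (∀ (n : ℕ) (ρ : (Fin (n + 2) → Fin m) → Contraction (n + 2))
      (γ : Fin m ↪ (Fin (n + 2) → Fin m)), (V₀ F ρ γ).Nonempty →
        (∀ (g : GL (Fin m) F), ∀ A ∈ V₀ F ρ γ, act (g : Matrix (Fin m) (Fin m) F) A ∈ V₀ F ρ γ) ∧
        IsZariskiOpen (V₀ F ρ γ) ∧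
        IsZariskiDense (V₀ F ρ γ) ∧
        (∀ {W W' : Type*} [AddCommGroup W] [Module F W] [AddCommGroup W'] [Module F W']
          (μ : W →ₗ[F] W →ₗ[F] W) (μ' : W' →ₗ[F] W' →ₗ[F] W')
          (e : Module.Basis (Fin m) F W) (e' : Module.Basis (Fin m) F W') (A B : Space m F),
          A = ofAlgebra e μ → B = ofAlgebra e' μ' → A ∈ V₀ F ρ γ → B ∈ V₀ F ρ γ →
            (AlgebrasIsomorphic μ μ' ↔
              P ρ γ A * A * ((P ρ γ A)⁻¹ ⊗ₖ (P ρ γ A)⁻¹) =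
                P ρ γ B * B * ((P ρ γ B)⁻¹ ⊗ₖ (P ρ γ B)⁻¹)))) := by
  have : Infinite F := IsAlgClosed.instInfinite
  refine ⟨exists_contractions_det_Q_ne_zero m, fun n ρ h => exists_V₀_nonempty ρ h,
    fun n ρ γ hne => ⟨fun g A hA => act_mem_V₀ ρ γ ?_ hA, ?_, ?_, ?_⟩⟩
  · exact (Matrix.isUnit_iff_isUnit_det _).mp g.isUnit
  · rw [V₀_eq]
    exact isZariskiOpen_ne_zero (discriminant_mem ρ γ)
  · rw [V₀_eq] at hne ⊢
    exact isZariskiDense_ne_zero (discriminant_mem ρ γ) hne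
  · rintro W W' _ _ _ _ μ μ' e e' A B rfl rfl hA hB
    exact algebrasIsomorphic_iff_normalForm_eq ρ γ e e' μ μ' hA hB
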